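/- Let $T$ be the generator of an irreducible continuous-time Markov chain $\varphi(t)$ on the finite set $\mathcal S=\{1,\dots,n\}$ (off-diagonal entries nonnegative, row sums $0$), let $c_i\in\mathbb R$ $(i\in\mathcal S)$, and let $X(t)\ge 0$ be the fluid level that changes at rate $c_{\varphi(t)}$ when $X(t)>0$ and at rate $\max\{0,c_{\varphi(t)}\}$ when $X(t)=0$. Put $\mathcal S_1=\{c_i>0\}$, $\mathcal S_2=\{c_i<0\}$, $\mathcal S_0=\{c_i=0\}$, and partition $T$ into blocks $T_{k\ell}$ accordingly. Assume $\mathcal S_1\neq\varnothing$ and that the model is stable: $\sum_i c_i\xi_i<0$ for the stationary distribution $\xi$ of $\varphi$. Let $\theta(0)=\inf\{t>0: X(t)=0\}$ and, for real $s$, $i\in\mathcal S_1$, $j\in\mathcal S_2$, let $$[\Psi(s)]_{ij}=E\big(e^{-s\theta(0)}\mathbf 1\{\theta(0)<\infty,\ \varphi(\theta(0))=j\}\,\big|\,\varphi(0)=i,\,X(0)=0\big)\in[0,\infty].$$ Write $\Psi(s)<\infty$ if all entries are finite and $\Psi(s)=\infty$ otherwise, and let $$s^*=\max\{s\le 0:\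 \Psi(s)<\infty,\ \Psi(z)=\infty\text{ for all }z<s\}.$$ Let $C_1=\mathrm{diag}(c_i)_{i\in\mathcal S_1}$, $C_2=\mathrm{diag}(|c_i|)_{i\in\mathcal S_2}$, $R(s)=T_{00}-sI$ (terms with $R(s)^{-1}$ are absent if $\mathcal S_0=\varnothing$), and for $\{k,\ell\}\subseteq\{1,2\}$ $$Q_{kk}(s)=C_k^{-1}\big(T_{kk}-sI-T_{k0}R(s)^{-1}T_{0k}\big),\qquad A_{kk}(s)=-\tfrac{d}{ds}Q_{kk}(s)=C_k^{-1}\big(I+T_{k0}R(s)^{-2}T_{0k}\big),$$ $$Q_{k\ell}(s)=C_k^{-1}\big(T_{k\ell}-T_{k0}R(s)^{-1}T_{0\ell}\big),\qquad A_{k\ell}(s)=-\tfrac{d}{ds}Q_{k\ell}(s)=C_k^{-1}T_{k0}R(s)^{-2}T_{0\ell}\qquad(k\ne \ell),$$ $$K(s)=Q_{11}(s)+\Psi(s)Q_{21}(s),\qquad D(s)=Q_{22}(s)+Q_{21}(s)\Psi(s),\qquad \Phi(s)=\tfrac{d}{ds}\Psi(s),$$ $$U(s)=A_{12}(s)+A_{11}(s)\Psi(s)+\Psi(s)A_{22}(s)+\Psi(s)A_{21}(s)\Psi(s).$$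 **Theorem.** The maximum $s^*$ exists; for all $s\ge s^*$, $\Psi(s)<\infty$ and $T_{00}-sI$ is invertible; and $\Psi$ is differentiable at every $s>s^*$. Moreover there is a real matrix $B(s^*)$ with all entries (strictly) positive and finite such that, as $s\downarrow s^*$, $$\Psi(s)=\Psi(s^*)-B(s^*)\sqrt{s-s^*}+o(\sqrt{s-s^*})$$ entrywise, the finite limit $$Y(s^*)=\lim_{s\downarrow s^*}\big(K(s^*)\Phi(s)+\Phi(s)D(s^*)\big)$$ exists, and $$B(s^*)Q_{21}(s^*)B(s^*)=U(s^*)-Y(s^*),\qquad K(s^*)B(s^*)+B(s^*)D(s^*)=0.$$ -/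

import Mathlib

open MeasureTheory ProbabilityTheory Filter Topology Matrix
open scoped ENNReal

noncomputable section

/-- The data of a stable Markovian stochastic fluid model: an irreducible conservative generator `T`
on the phases `Fin n`, real fluid rates `c`, negative stationary mean drift, and at least one phase
in which the level increases. -/
structure FluidModel (n : ℕ) where
  T : Matrix (Fin n) (Fin n) ℝ
  c : Fin n → ℝ
  offDiag_nonneg : ∀ i j, i ≠ j → 0 ≤ T i j
  row_sum : ∀ i, ∑ j, T i j = 0
  irreducible : ∀ i j, Relation.ReflTransGen (fun a b => 0 < T a b) i j
  stable : ∃ ξ : Fin n → ℝ, (∀ i, 0 ≤ ξ i) ∧ ∑ i, ξ i = 1 ∧ ξ ᵥ* T = 0 ∧ ∑ i, c i * ξ i < 0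
  exists_up : ∃ i, 0 < c i

namespace FluidModel

variable {n : ℕ} (M : FluidModel n)

/-! ### The driving Markov chain, built from its jump chain and holding times -/

/-- The total rate of leaving phase `i`. -/
def rate (i : Fin n) : ℝ := -M.T i i

lemma exists_down : ∃ i, M.c i < 0 := by
  obtain ⟨ξ, h0, _, _, h⟩ := M.stable
  by_contra! hc
  exact absurd h (not_lt.mpr (Finset.sum_nonneg fun i _ => mul_nonneg (hc i) (h0 i)))

lemma rate_eq (i : Fin n) : M.rate i = ∑ j ∈ Finset.univ.erase i, M.T i j := by
  have h := M.row_sum i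
  rw [← Finset.add_sum_erase _ _ (Finset.mem_univ i)] at h
  unfold rate
  linarith

lemma rate_pos (i : Fin n) : 0 < M.rate i := by
  obtain ⟨u, hu⟩ := M.exists_up
  obtain ⟨d, hd⟩ := M.exists_down
  have hij : ∃ j, i ≠ j := by
    by_cases h : i = u
    · exact ⟨d, by rintro rfl; subst h; linarith⟩
    · exact ⟨u, h⟩
  obtain ⟨j, hij⟩ := hij
  have hnn : ∀ k ∈ Finset.univ.erase i, 0 ≤ M.T i k := fun k hk =>
    M.offDiag_nonneg i k (Finset.ne_of_mem_erase hk).symm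
  obtain h | ⟨k, hk, _⟩ := (M.irreducible i j).cases_head
  · exact absurd h hij
  · rw [rate_eq]
    by_cases hki : k = i
    · subst hki
      have h2 := M.rate_eq k
      have h3 := Finset.sum_nonneg hnn
      unfold rate at h2
      linarith
    · exact lt_of_lt_of_le hk
        (Finset.single_le_sum hnn (Finset.mem_erase.mpr ⟨hki, Finset.mem_univ k⟩))

/-- The law of the next phase and its holding time, when phase `i` is left: the next phase is
`j ≠ i` with probability `T i j / rate i`, and its holding time is exponential with rate `rate j`. -/
def jumpMeasure (i : Fin n) : Measure (Fin n × ℝ) :=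
  ∑ j ∈ Finset.univ.erase i,
    ENNReal.ofReal (M.T i j / M.rate i) • (Measure.dirac j).prod (expMeasure (M.rate j))

instance isProbabilityMeasure_jumpMeasure (i : Fin n) :
    IsProbabilityMeasure (M.jumpMeasure i) := by
  constructor
  have hp : ∀ j, IsProbabilityMeasure (expMeasure (M.rate j)) := fun j =>
    isProbabilityMeasure_expMeasure (M.rate_pos j)
  simp only [jumpMeasure, Measure.finsetSum_apply, Measure.smul_apply, measure_univ, smul_eq_mul,
    mul_one]
  rw [← ENNReal.ofReal_sum_of_nonneg, ← Finset.sum_div, ← M.rate_eq,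
    div_self (M.rate_pos i).ne', ENNReal.ofReal_one]
  intro j hj
  exact div_nonneg (M.offDiag_nonneg i j (Finset.ne_of_mem_erase hj).symm) (M.rate_pos i).le

/-- The transition kernel of the sequence of pairs (phase, holding time); the next pair depends on
the past only through the current phase. -/
def stepKernel (k : ℕ) : Kernel (Π _ : Finset.Iic k, Fin n × ℝ) (Fin n × ℝ) :=
  (Kernel.ofFunOfCountable M.jumpMeasure).comap
    (fun h => (h ⟨k, Finset.mem_Iic.mpr le_rfl⟩).1) (by fun_prop)

instance isMarkovKernel_stepKernel (k : ℕ) : IsMarkovKernel (M.stepKernel k) where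
  isProbabilityMeasure h := by
    rw [stepKernel, Kernel.comap_apply]
    exact M.isProbabilityMeasure_jumpMeasure _

/-- The law, on sequences of pairs (phase, holding time), of the Markov chain with generator `T`
started in phase `i`. -/
def pathLaw (i : Fin n) : Measure (ℕ → Fin n × ℝ) :=
  haveI : IsProbabilityMeasure (expMeasure (M.rate i)) :=
    isProbabilityMeasure_expMeasure (M.rate_pos i)
  Kernel.trajMeasure (X := fun _ => Fin n × ℝ)
    ((Measure.dirac i).prod (expMeasure (M.rate i))) M.stepKernel

/-- The time of the `k`-th jump. -/
def jumpTime (ω : ℕ → Fin n × ℝ) (k : ℕ) : ℝ := ∑ m ∈ Finset.range k, (ω m).2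

/-- The number of jumps up to time `t`. -/
def jumpCount (ω : ℕ → Fin n × ℝ) (t : ℝ) : ℕ := sInf {k | t < jumpTime ω (k + 1)}

/-- The phase `φ(t)`. -/
def phase (ω : ℕ → Fin n × ℝ) (t : ℝ) : Fin n := (ω (jumpCount ω t)).1

/-! ### The level process -/

/-- The level at the `k`-th jump time, started from level `x`: between jumps it moves at the rate of
the current phase, and it stays at `0` while it is at `0` and that rate is not positive. -/
def levelAtJump (x : ℝ) (ω : ℕ → Fin n × ℝ) : ℕ → ℝ
  | 0 => x
  | k + 1 => max 0 (levelAtJump x ω k + M.c (ω k).1 * (ω k).2)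

/-- The level `X(t)`, started from level `x`. -/
def level (x : ℝ) (ω : ℕ → Fin n × ℝ) (t : ℝ) : ℝ :=
  max 0 (M.levelAtJump x ω (jumpCount ω t) +
    M.c (ω (jumpCount ω t)).1 * (t - jumpTime ω (jumpCount ω t)))

/-- The positive times at which the level, started from level `0`, is `0`. -/
def zeroTimes (ω : ℕ → Fin n × ℝ) : Set ℝ := {t | 0 < t ∧ M.level 0 ω t = 0}

/-- The first return time `θ(0)` to level `0`; it is finite when `zeroTimes` is nonempty. -/
def returnTime (ω : ℕ → Fin n × ℝ) : ℝ := sInf (M.zeroTimes ω)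

/-! ### The three classes of phases, and the blocks of the generator -/

/-- The phases in which the level increases. -/
abbrev S1 : Type := {i : Fin n // 0 < M.c i}

/-- The phases in which the level decreases. -/
abbrev S2 : Type := {i : Fin n // M.c i < 0}

/-- The phases in which the level is constant. -/
abbrev S0 : Type := {i : Fin n // M.c i = 0}

def T11 : Matrix M.S1 M.S1 ℝ := M.T.submatrix Subtype.val Subtype.val
def T12 : Matrix M.S1 M.S2 ℝ := M.T.submatrix Subtype.val Subtype.val
def T10 : Matrix M.S1 M.S0 ℝ := M.T.submatrix Subtype.val Subtype.val
def T21 : Matrix M.S2 M.S1 ℝ := M.T.submatrix Subtype.val Subtype.val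
def T22 : Matrix M.S2 M.S2 ℝ := M.T.submatrix Subtype.val Subtype.val
def T20 : Matrix M.S2 M.S0 ℝ := M.T.submatrix Subtype.val Subtype.val
def T01 : Matrix M.S0 M.S1 ℝ := M.T.submatrix Subtype.val Subtype.val
def T02 : Matrix M.S0 M.S2 ℝ := M.T.submatrix Subtype.val Subtype.val
def T00 : Matrix M.S0 M.S0 ℝ := M.T.submatrix Subtype.val Subtype.val

def C1 : Matrix M.S1 M.S1 ℝ := diagonal fun i => M.c i
def C2 : Matrix M.S2 M.S2 ℝ := diagonal fun i => |M.c i|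

/-! ### The fluid generator `Q(s)`, and `A(s) = -dQ(s)/ds` -/

/-- The matrix `T₀₀ - s I`. -/
def R (s : ℝ) : Matrix M.S0 M.S0 ℝ := M.T00 - s • (1 : Matrix M.S0 M.S0 ℝ)

def Q11 (s : ℝ) : Matrix M.S1 M.S1 ℝ :=
  M.C1⁻¹ * (M.T11 - s • (1 : Matrix M.S1 M.S1 ℝ) - M.T10 * (M.R s)⁻¹ * M.T01)
def Q12 (s : ℝ) : Matrix M.S1 M.S2 ℝ := M.C1⁻¹ * (M.T12 - M.T10 * (M.R s)⁻¹ * M.T02)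
def Q21 (s : ℝ) : Matrix M.S2 M.S1 ℝ := M.C2⁻¹ * (M.T21 - M.T20 * (M.R s)⁻¹ * M.T01)
def Q22 (s : ℝ) : Matrix M.S2 M.S2 ℝ :=
  M.C2⁻¹ * (M.T22 - s • (1 : Matrix M.S2 M.S2 ℝ) - M.T20 * (M.R s)⁻¹ * M.T02)

def A11 (s : ℝ) : Matrix M.S1 M.S1 ℝ := M.C1⁻¹ * (1 + M.T10 * ((M.R s)⁻¹) ^ 2 * M.T01)
def A12 (s : ℝ) : Matrix M.S1 M.S2 ℝ := M.C1⁻¹ * (M.T10 * ((M.R s)⁻¹) ^ 2 * M.T02)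
def A21 (s : ℝ) : Matrix M.S2 M.S1 ℝ := M.C2⁻¹ * (M.T20 * ((M.R s)⁻¹) ^ 2 * M.T01)
def A22 (s : ℝ) : Matrix M.S2 M.S2 ℝ := M.C2⁻¹ * (1 + M.T20 * ((M.R s)⁻¹) ^ 2 * M.T02)

/-! ### The matrix `Ψ(s)` and the matrices derived from it -/

/-- The Laplace-Stieltjes transform, with values in `[0, ∞]`, of the first return time to level `0`
on the event that the return is in phase `j`, when the process starts from level `0` in phase `i`. -/
def psiLST (s : ℝ) (i : M.S1) (j : M.S2) : ℝ≥0∞ :=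
  ∫⁻ ω, Set.indicator {ω | (M.zeroTimes ω).Nonempty ∧ phase ω (M.returnTime ω) = j}
    (fun ω => ENNReal.ofReal (Real.exp (-s * M.returnTime ω))) ω ∂(M.pathLaw i)

/-- `Ψ(s) < ∞`. -/
def PsiFinite (s : ℝ) : Prop := ∀ i j, M.psiLST s i j < ∞

/-- The real matrix `Ψ(s)`, meaningful when `Ψ(s) < ∞`. -/
def Psi (s : ℝ) : Matrix M.S1 M.S2 ℝ := Matrix.of fun i j => (M.psiLST s i j).toReal

/-- The set whose maximum is `s*`. -/
def singularSet : Set ℝ := {s | s ≤ 0 ∧ M.PsiFinite s ∧ ∀ z < s, ¬ M.PsiFinite z}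

/-- The singularity `s*`. -/
def sStar : ℝ := sSup M.singularSet

def K (s : ℝ) : Matrix M.S1 M.S1 ℝ := M.Q11 s + M.Psi s * M.Q21 s
def D (s : ℝ) : Matrix M.S2 M.S2 ℝ := M.Q22 s + M.Q21 s * M.Psi s

/-- The entrywise derivative `Φ(s) = dΨ(s)/ds`. -/
def Phi (s : ℝ) : Matrix M.S1 M.S2 ℝ := Matrix.of fun i j => deriv (fun u => M.Psi u i j) s

def U (s : ℝ) : Matrix M.S1 M.S2 ℝ :=
  M.A12 s + M.A11 s * M.Psi s + M.Psi s * M.A22 s + M.Psi s * M.A21 s * M.Psi s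

end FluidModel

end

/-!
# The square-root singularity of the first return matrix of a stable fluid model

**The Riccati equation.** Up to a null set a first return to level `0` happens after finitely many
jumps, in a phase in which the level decreases. Hence `Ψ(s)` is a sum over the number of jumps of
iterated first-jump integrals (`psiLST_eq_passageLST`), and the same sums, started from any phase and
any level `y ≥ 0`, define the weights `passageLST`. They satisfy the first-jump equation, they are
multiplicative in the level because it decreases continuously (`passageLST_add`), they are dominated
by every supersolution of the first-jump equation (`sum_passageLST_le`), and they are all finite as
soon as `Ψ(s)` is (`passageLST_lt_top`). Right derivatives at level `0` give
`Q₁₂ + Q₁₁ Ψ + Ψ Q₂₂ + Ψ Q₂₁ Ψ = 0` wherever `Ψ(s)` is finite (`riccati_Psi`). Evaluated at a positive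
level, the weights also form a positive vector that makes `-(T₀₀ - s I)` a nonsingular M-matrix
(`minPrinciple_R`); in particular `T₀₀ - s I` is invertible and the off-diagonal entries of the block
matrix `Q(s)` are nonnegative.

**Existence of `s*`.** The entries of `Ψ` are Laplace–Stieltjes transforms of measures on `[0, ∞)`, so
`Ψ` is finite on an up-set, which contains `0`; there `Ψ` is decreasing, and it is differentiable in
the interior. The diagonal of the Riccati equation bounds this up-set from below. The other terms of
the equation, which are all nonnegative, bound one entry of `Ψ` and compare neighbouring entries, so that by
irreducibility `Ψ` is bounded on the part of the up-set in `(-∞, 0]` (`Psi_bounded`); by Fatou's lemma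
the up-set is closed. Its minimum is `s*`.

**Criticality.** Let `λ` be the Perron–Frobenius eigenvalue of the Sylvester operator
`H ↦ K H + H D` at `s*`, the sum of those of the irreducible Metzler matrices `K(s*)` and `D(s*)`. It
vanishes.
* If `λ > 0`, the operator still increases a positive functional at nearby `s > s*`, against the
  differentiated Riccati equation `K Φ + Φ D = U`, where `U > 0` and `Φ ≤ 0` (`growth_nonpos`).
* If `λ < 0`, adding a small multiple of the positive eigenmatrix to `Ψ(s*)` gives a strict
  supersolution of the Riccati equation at `s*`, hence a supersolution at some `s < s*`. From it one
  builds a supersolution of the first-jump equation that is exponential in the level, and `Ψ(s)` is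
  finite, against the choice of `s*` (`growth_nonneg`, `psiFinite_of_riccati_nonpos`).

**The expansion.** With `λ = 0`, the increment `Ψ(s*) - Ψ(s)`, normalized, tends to the positive kernel
element `V` of the Sylvester operator. Pairing the equation for the increment with the positive left
eigenvector removes the linear term and leaves a balance between a quadratic term and `s - s*`, whence
the square root. The same pairing, applied to `K Φ + Φ D = U`, gives `Φ(s) ∼ -B / (2 √(s - s*))` and the
limit `Y` (`riccati_sqrt_expansion`).
-/

/-! ### Irreducible Metzler matrices -/

/-- A real square matrix whose off-diagonal entries are nonnegative. -/
def Metzler {ι : Type*} (A : Matrix ι ι ℝ) : Prop := ∀ i j, i ≠ j → 0 ≤ A i j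

/-- Irreducibility: every index is reached from every other one along positive entries. -/
def Irred {ι : Type*} (A : Matrix ι ι ℝ) : Prop :=
  ∀ i j, Relation.ReflTransGen (fun a b => 0 < A a b) i j

/-- The minimum principle: `A z ≤ 0` only for nonnegative vectors `z`. -/
def MinPrinciple {ι : Type*} [Fintype ι] (A : Matrix ι ι ℝ) : Prop :=
  ∀ z : ι → ℝ, (∀ i, (A *ᵥ z) i ≤ 0) → ∀ i, 0 ≤ z i

lemma mul_entry_nonneg {α β γ : Type*} [Fintype β] {A : Matrix α β ℝ} {B : Matrix β γ ℝ}
    (hA : ∀ i j, 0 ≤ A i j) (hB : ∀ i j, 0 ≤ B i j) (i : α) (j : γ) : 0 ≤ (A * B) i j := by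
  rw [Matrix.mul_apply]
  exact Finset.sum_nonneg fun k _ => mul_nonneg (hA i k) (hB k j)

lemma mulVec_entry_nonneg {α β : Type*} [Fintype β] {A : Matrix α β ℝ} {z : β → ℝ}
    (hA : ∀ i j, 0 ≤ A i j) (hz : ∀ i, 0 ≤ z i) (i : α) : 0 ≤ (A *ᵥ z) i :=
  Finset.sum_nonneg fun k _ => mul_nonneg (hA i k) (hz k)

section Metzler

variable {ι : Type*} {A : Matrix ι ι ℝ}

lemma Metzler.transpose (hM : Metzler A) : Metzler Aᵀ := fun i j h => hM j i h.symm

lemma Irred.transpose (hI : Irred A) : Irred Aᵀ := fun i j => by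
  have h := hI j i
  induction h with
  | refl => exact .refl
  | tail _ h ih => exact .head h ih

variable [Fintype ι]

/-- The zero set of a nonnegative vector `z` is closed under the edges of `A` when `A z` is
nonpositive on it. -/
lemma Metzler.zero_of_edge (hM : Metzler A) {z : ι → ℝ} (hz : ∀ i, 0 ≤ z i) {i j : ι}
    (hi : z i = 0) (hA : (A *ᵥ z) i ≤ 0) (hij : 0 < A i j) : z j = 0 := by
  have hnn : ∀ k ∈ Finset.univ, 0 ≤ A i k * z k := fun k _ => by
    by_cases h : i = k
    · subst h; simp [hi]
    · exact mul_nonneg (hM i k h) (hz k)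
  have h0 : ∑ k, A i k * z k = 0 := le_antisymm hA (Finset.sum_nonneg hnn)
  have := (Finset.sum_eq_zero_iff_of_nonneg hnn).1 h0 j (Finset.mem_univ _)
  exact (mul_eq_zero.1 this).resolve_left hij.ne'

lemma Metzler.eq_zero_of_zero (hM : Metzler A) (hI : Irred A) {z : ι → ℝ} (hz : ∀ i, 0 ≤ z i)
    (h : ∀ i, z i = 0 → (A *ᵥ z) i ≤ 0) {i : ι} (hi : z i = 0) : z = 0 := by
  funext j
  have := hI i j
  induction this with
  | refl => exact hi
  | tail _ hbc ih => exact hM.zero_of_edge hz ih (h _ ih) hbc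

/-- A matrix is irreducible as soon as no nonnegative vector has a proper nonempty zero set that is
closed under its edges. -/
lemma irred_of_forall
    (h : ∀ z : ι → ℝ, (∀ i, 0 ≤ z i) → (∀ i, z i = 0 → (A *ᵥ z) i ≤ 0) → ∀ i, z i = 0 → z = 0) :
    Irred A := by
  classical
  intro i j
  let z : ι → ℝ := fun k => if Relation.ReflTransGen (fun a b => 0 < A a b) i k then 0 else 1
  have hz0 : ∀ k, z k = 0 ↔ Relation.ReflTransGen (fun a b => 0 < A a b) i k := fun k => by
    by_cases hk : Relation.ReflTransGen (fun a b => 0 < A a b) i k <;> simp [z, hk]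
  have := h z (fun k => by dsimp only [z]; split_ifs <;> norm_num) (fun k hk => ?_) i
    ((hz0 i).2 .refl)
  · exact (hz0 j).1 (congrFun this j)
  · refine Finset.sum_nonpos fun l _ => ?_
    by_cases hl : 0 < A k l
    · rw [(hz0 l).2 (((hz0 k).1 hk).tail hl), mul_zero]
    · exact mul_nonpos_of_nonpos_of_nonneg (not_lt.1 hl) (by dsimp only [z]; split_ifs <;> norm_num)

lemma mulVec_pos_of_pos {κ : Type*} {P : Matrix κ ι ℝ} (hP : ∀ i j, 0 < P i j) {z : ι → ℝ}
    (hz : ∀ i, 0 ≤ z i) (hne : z ≠ 0) (i : κ) : 0 < (P *ᵥ z) i := by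
  obtain ⟨j, hj⟩ := Function.ne_iff.1 hne
  refine Finset.sum_pos' (fun k _ => mul_nonneg (hP _ _).le (hz k)) ⟨j, Finset.mem_univ _, ?_⟩
  exact mul_pos (hP _ _) (lt_of_le_of_ne (hz j) (Ne.symm hj))

variable [DecidableEq ι]

/-- A nonnegative matrix commuting with `A`, with all entries positive: a sum of powers of
`A + c I`, with `c` so large that `A + c I` is nonnegative. -/
lemma Metzler.exists_pos_commute (hM : Metzler A) (hI : Irred A) :
    ∃ P : Matrix ι ι ℝ, (∀ i j, 0 < P i j) ∧ A * P = P * A := by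
  set c : ℝ := ∑ i, |A i i| with hc
  set B : Matrix ι ι ℝ := A + c • (1 : Matrix ι ι ℝ) with hB
  have hoff : ∀ i j, i ≠ j → B i j = A i j := fun i j h => by simp [hB, h]
  have hcA : ∀ i, |A i i| ≤ c := fun i =>
    Finset.single_le_sum (f := fun i => |A i i|) (fun _ _ => abs_nonneg _) (Finset.mem_univ i)
  have hBnn : ∀ i j, 0 ≤ B i j := fun i j => by
    by_cases h : i = j
    · subst h
      have := neg_abs_le (A i i)
      have := hcA i
      simp [hB]; linarith
    · rw [hoff i j h]; exact hM i j h
  have hpow : ∀ k i j, 0 ≤ (B ^ k) i j := by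
    intro k
    induction k with
    | zero => intro i j; rw [pow_zero, one_apply]; split_ifs <;> norm_num
    | succ k ih =>
      intro i j
      rw [pow_succ', mul_apply]
      exact Finset.sum_nonneg fun l _ => mul_nonneg (hBnn _ _) (ih _ _)
  have hex : ∀ i j, ∃ k, 0 < (B ^ k) i j := by
    intro i j
    have h := hI i j
    induction h using Relation.ReflTransGen.head_induction_on with
    | refl => exact ⟨0, by simp⟩
    | @head a b hab _ ih =>
      obtain ⟨k, hk⟩ := ih
      by_cases hne : a = b
      · subst hne; exact ⟨k, hk⟩
      refine ⟨k + 1, ?_⟩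
      rw [pow_succ', mul_apply]
      refine lt_of_lt_of_le (mul_pos ?_ hk) (Finset.single_le_sum (f := fun l => B a l * (B ^ k) l j)
        (fun l _ => mul_nonneg (hBnn _ _) (hpow _ _ _)) (Finset.mem_univ b))
      rw [hoff a b hne]; exact hab
  -- finitely many powers suffice; the exponents are bounded by the sum of all of them
  choose κ hκ using hex
  refine ⟨∑ k ∈ Finset.range (∑ i, ∑ j, κ i j + 1), B ^ k, fun i j => ?_, ?_⟩
  · rw [Matrix.sum_apply]
    refine lt_of_lt_of_le (hκ i j) (Finset.single_le_sum (f := fun k => (B ^ k) i j)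
      (fun k _ => hpow k i j) (Finset.mem_range.2 (Nat.lt_succ_of_le ?_)))
    exact (Finset.single_le_sum (f := fun j => κ i j) (fun _ _ => Nat.zero_le _)
      (Finset.mem_univ j)).trans (Finset.single_le_sum (f := fun i => ∑ j, κ i j)
      (fun _ _ => Nat.zero_le _) (Finset.mem_univ i))
  · have hAB : Commute A B := (Commute.refl A).add_right ((Commute.one_right A).smul_right c)
    exact (Commute.sum_right _ _ _ fun k _ => hAB.pow_right k).eq

/-- **Perron–Frobenius**: an irreducible Metzler matrix has a positive eigenvector. The eigenvalue is
the largest `r` with `r x ≤ A x` for some point `x` of the simplex. -/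
theorem Metzler.exists_pos_eigenvector [Nonempty ι] (hM : Metzler A) (hI : Irred A) :
    ∃ (r : ℝ) (u : ι → ℝ), (∀ i, 0 < u i) ∧ A *ᵥ u = r • u := by
  obtain ⟨P, hP, hAP⟩ := hM.exists_pos_commute hI
  set c : ℝ := ∑ i, ∑ j, |A i j| with hc
  have hcA : ∀ i j, |A i j| ≤ c := fun i j =>
    (Finset.single_le_sum (f := fun j => |A i j|) (fun _ _ => abs_nonneg _)
      (Finset.mem_univ j)).trans (Finset.single_le_sum (f := fun i => ∑ j, |A i j|)
      (fun _ _ => Finset.sum_nonneg fun _ _ => abs_nonneg _) (Finset.mem_univ i))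
  -- the bounds `± c` on the admissible `r` make the set of pairs `(r, x)` compact
  let S : Set (ℝ × (ι → ℝ)) :=
    (Set.Icc (-c) c ×ˢ stdSimplex ℝ ι) ∩ {p | ∀ i, p.1 * p.2 i ≤ (A *ᵥ p.2) i}
  have hle : ∀ (r : ℝ) (x : ι → ℝ), x ∈ stdSimplex ℝ ι → (∀ i, r * x i ≤ (A *ᵥ x) i) → r ≤ c := by
    intro r x hx h
    calc r = ∑ i, r * x i := by rw [← Finset.mul_sum, hx.2, mul_one]
      _ ≤ ∑ i, (A *ᵥ x) i := Finset.sum_le_sum fun i _ => h i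
      _ ≤ ∑ i, ∑ j, |A i j| := Finset.sum_le_sum fun i _ => Finset.sum_le_sum fun j _ => by
          have hxj : x j ≤ 1 := by
            rw [← hx.2]
            exact Finset.single_le_sum (f := x) (fun k _ => hx.1 k) (Finset.mem_univ j)
          calc A i j * x j ≤ |A i j| * x j := mul_le_mul_of_nonneg_right (le_abs_self _) (hx.1 j)
            _ ≤ |A i j| * 1 := mul_le_mul_of_nonneg_left hxj (abs_nonneg _)
            _ = _ := mul_one _
  have hSc : IsCompact S := by
    refine (isCompact_Icc.prod (isCompact_stdSimplex (𝕜 := ℝ) (ι := ι))).inter_right ?_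
    rw [show {p : ℝ × (ι → ℝ) | ∀ i, p.1 * p.2 i ≤ (A *ᵥ p.2) i} =
      ⋂ i, {p : ℝ × (ι → ℝ) | p.1 * p.2 i ≤ (A *ᵥ p.2) i} by ext; simp]
    refine isClosed_iInter fun i => isClosed_le (by fun_prop) ?_
    exact (continuous_apply i).comp (continuous_const.matrix_mulVec continuous_snd)
  -- a vertex of the simplex is admissible for `r = -c`
  have hSne : S.Nonempty := by
    obtain ⟨i0⟩ := ‹Nonempty ι›
    refine ⟨(-c, Pi.single i0 1), ⟨⟨⟨le_rfl, ?_⟩, single_mem_stdSimplex ℝ i0⟩, fun i => ?_⟩⟩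
    · have := (abs_nonneg _).trans (hcA i0 i0)
      simp only; linarith
    · rw [mulVec_single_one]
      by_cases h : i = i0
      · subst h
        have := neg_abs_le (A i i)
        have := hcA i i
        simp; linarith
      · simpa [h] using hM i i0 h
  obtain ⟨⟨r, x⟩, ⟨⟨_, hx⟩, hrx⟩, hmax⟩ := hSc.exists_isMaxOn hSne continuous_fst.continuousOn
  simp only [Set.mem_ofPred_eq] at hrx hx
  have hr : -c ≤ r := by
    rename_i h; exact h.1
  have hx0 : x ≠ 0 := by
    rintro rfl; simpa using hx.2
  -- If `A x ≠ r x`, then `P (A x - r x) > 0`, so that `P x` does better than `x`.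
  have heig : A *ᵥ x = r • x := by
    by_contra hne
    have hz : ∀ i, 0 < (P *ᵥ (A *ᵥ x - r • x)) i :=
      mulVec_pos_of_pos hP (fun i => by simpa using hrx i) (sub_ne_zero.2 hne)
    have hy : ∀ i, 0 < (P *ᵥ x) i := mulVec_pos_of_pos hP hx.1 hx0
    set y := P *ᵥ x with hydef
    have hAy : A *ᵥ y - r • y = P *ᵥ (A *ᵥ x - r • x) := by
      rw [hydef, mulVec_sub, mulVec_mulVec, mulVec_mulVec, hAP, mulVec_smul]
    have hev : ∀ᶠ ε in 𝓝[>] (0 : ℝ), ∀ i, ε * y i < (P *ᵥ (A *ᵥ x - r • x)) i := by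
      rw [eventually_all]
      intro i
      have : Tendsto (fun ε : ℝ => ε * y i) (𝓝[>] 0) (𝓝 (0 * y i)) :=
        ((continuous_id.mul continuous_const).tendsto 0).mono_left nhdsWithin_le_nhds
      rw [zero_mul] at this
      exact this.eventually_lt_const (hz i)
    obtain ⟨ε, hε, hε0⟩ := (hev.and self_mem_nhdsWithin).exists
    have hε0 : 0 < ε := hε0
    have hs : 0 < ∑ i, y i := Finset.sum_pos (fun i _ => hy i) Finset.univ_nonempty
    set y' : ι → ℝ := (∑ i, y i)⁻¹ • y with hy'
    have hy's : y' ∈ stdSimplex ℝ ι := by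
      refine ⟨fun i => mul_nonneg (inv_nonneg.2 hs.le) (hy i).le, ?_⟩
      simp only [hy', Pi.smul_apply, smul_eq_mul, ← Finset.mul_sum]
      exact inv_mul_cancel₀ hs.ne'
    have hin : ∀ i, (r + ε) * y' i ≤ (A *ᵥ y') i := fun i => by
      have h1 := hε i
      rw [← hAy] at h1
      simp only [Pi.sub_apply, Pi.smul_apply, smul_eq_mul] at h1
      rw [hy', mulVec_smul, Pi.smul_apply, Pi.smul_apply, smul_eq_mul, smul_eq_mul, mul_left_comm]
      refine mul_le_mul_of_nonneg_left ?_ (inv_nonneg.2 hs.le)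
      linarith
    have hmem : ((r + ε, y') : ℝ × (ι → ℝ)) ∈ S :=
      ⟨⟨⟨by simp only; linarith, hle _ _ hy's hin⟩, hy's⟩, hin⟩
    have := hmax hmem
    simp only [Set.mem_ofPred_eq] at this
    linarith
  refine ⟨r, x, fun i => lt_of_le_of_ne (hx.1 i) fun h0 => hx0 ?_, heig⟩
  exact hM.eq_zero_of_zero hI hx.1 (fun j hj => by simp [heig, hj]) h0.symm

/-- The left and the right positive eigenvector belong to the same eigenvalue. -/
lemma Metzler.exists_pos_eigenvectors [Nonempty ι] (hM : Metzler A) (hI : Irred A) :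
    ∃ (r : ℝ) (a u : ι → ℝ), (∀ i, 0 < a i) ∧ (∀ i, 0 < u i) ∧ a ᵥ* A = r • a ∧ A *ᵥ u = r • u := by
  obtain ⟨r, u, hu, hAu⟩ := hM.exists_pos_eigenvector hI
  obtain ⟨r', a, ha, haA⟩ := hM.transpose.exists_pos_eigenvector hI.transpose
  rw [mulVec_transpose] at haA
  have h1 : a ⬝ᵥ (A *ᵥ u) = (a ᵥ* A) ⬝ᵥ u := dotProduct_mulVec _ _ _
  rw [hAu, haA, dotProduct_smul, smul_dotProduct, smul_eq_mul, smul_eq_mul] at h1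
  have hpos : 0 < a ⬝ᵥ u := Finset.sum_pos (fun i _ => mul_pos (ha i) (hu i)) Finset.univ_nonempty
  obtain rfl := mul_right_cancel₀ hpos.ne' h1
  exact ⟨r, a, u, ha, hu, haA, hAu⟩

/-- The minimum principle for a Metzler matrix with a positive vector `v` such that `A v < 0`. -/
lemma Metzler.minPrinciple_of_mulVec_neg (hM : Metzler A) {v : ι → ℝ} (hv : ∀ i, 0 < v i)
    (hAv : ∀ i, (A *ᵥ v) i < 0) : MinPrinciple A := fun z hz i => by
  obtain ⟨m, -, hm⟩ := Finset.exists_min_image Finset.univ (fun i => z i / v i) ⟨i, Finset.mem_univ i⟩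
  set t := z m / v m with ht
  have hzt : ∀ k, t * v k ≤ z k := fun k => by
    have := hm k (Finset.mem_univ _)
    rwa [le_div_iff₀ (hv k)] at this
  have hzm : z m = t * v m := by rw [ht, div_mul_cancel₀ _ (hv m).ne']
  suffices 0 ≤ t from (mul_nonneg this (hv i).le).trans (hzt i)
  by_contra! hneg
  have h1 : t * (A *ᵥ v) m ≤ (A *ᵥ z) m := by
    simp only [mulVec, dotProduct, Finset.mul_sum]
    refine Finset.sum_le_sum fun k _ => ?_
    by_cases h : m = k
    · subst h; rw [hzm]; exact (by ring : _ = _).le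
    · calc t * (A m k * v k) = A m k * (t * v k) := by ring
        _ ≤ _ := mul_le_mul_of_nonneg_left (hzt k) (hM m k h)
  have := mul_pos_of_neg_of_neg hneg (hAv m)
  linarith [hz m]

/-- A matrix that obeys the minimum principle is invertible, and `-A⁻¹` is nonnegative. -/
lemma isUnit_and_inv_nonpos (hA : MinPrinciple A) :
    IsUnit A ∧ ∀ i j, A⁻¹ i j ≤ 0 := by
  have hinj : Function.Injective A.mulVec := by
    intro x y hxy
    have h1 : ∀ x y : ι → ℝ, A *ᵥ x = A *ᵥ y → ∀ i, y i ≤ x i := fun x y h i => by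
      have := hA (x - y) (fun i => by simp [mulVec_sub, h]) i
      simpa using this
    exact funext fun i => le_antisymm (h1 y x hxy.symm i) (h1 x y hxy i)
  have hU : IsUnit A := mulVec_injective_iff_isUnit.1 hinj
  refine ⟨hU, fun i j => ?_⟩
  have hdet := (isUnit_iff_isUnit_det A).1 hU
  have := hA (-(A⁻¹ *ᵥ Pi.single j 1)) (fun k => ?_) i
  · rw [mulVec_single_one] at this
    simpa using this
  · rw [mulVec_neg, mulVec_mulVec, mul_nonsing_inv _ hdet, one_mulVec]
    by_cases h : k = j
    · subst h; simp
    · simp [h]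

/-- For a Metzler matrix the minimum principle yields a positive vector `v` with `A v < 0`. -/
lemma Metzler.exists_pos_mulVec_neg (hM : Metzler A)
    (hA : MinPrinciple A) :
    ∃ v : ι → ℝ, (∀ i, 0 < v i) ∧ ∀ i, (A *ᵥ v) i < 0 := by
  have hdet := (isUnit_iff_isUnit_det A).1 (isUnit_and_inv_nonpos hA).1
  set v : ι → ℝ := -(A⁻¹ *ᵥ 1) with hv
  have hAv : A *ᵥ v = -1 := by
    rw [hv, mulVec_neg, mulVec_mulVec, mul_nonsing_inv _ hdet, one_mulVec]
  have hnn : ∀ i, 0 ≤ v i := hA v fun i => by simp [hAv]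
  refine ⟨v, fun i => lt_of_le_of_ne (hnn i) fun h0 => ?_, fun i => by simp [hAv]⟩
  have h1 : 0 ≤ (A *ᵥ v) i := Finset.sum_nonneg fun k _ => by
    by_cases h : i = k
    · subst h; simp [← h0]
    · exact mul_nonneg (hM i k h) (hnn k)
  rw [hAv] at h1
  simp at h1
  linarith

end Metzler

/-! ### The Sylvester operator `H ↦ K H + H D` -/

section Sylvester

variable {α β : Type*} [Fintype α] [Fintype β]

/-- The functional `H ↦ aᵀ H d` on matrices. -/
def pairing (a : α → ℝ) (d : β → ℝ) : Matrix α β ℝ →ₗ[ℝ] ℝ where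
  toFun H := a ⬝ᵥ (H *ᵥ d)
  map_add' H H' := by rw [add_mulVec, dotProduct_add]
  map_smul' c H := by rw [smul_mulVec, dotProduct_smul]; rfl

lemma pairing_apply (a : α → ℝ) (d : β → ℝ) (H : Matrix α β ℝ) :
    pairing a d H = ∑ i, ∑ j, a i * (H i j * d j) := by
  simp [pairing, dotProduct, mulVec, Finset.mul_sum]

lemma mul_le_pairing {a : α → ℝ} {d : β → ℝ} (ha : ∀ i, 0 < a i) (hd : ∀ j, 0 < d j)
    {H : Matrix α β ℝ} (hH : ∀ i j, 0 ≤ H i j) (i : α) (j : β) :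
    a i * (H i j * d j) ≤ pairing a d H := by
  rw [pairing_apply]
  have hnn : ∀ i j, 0 ≤ a i * (H i j * d j) := fun i j =>
    mul_nonneg (ha i).le (mul_nonneg (hH i j) (hd j).le)
  exact (Finset.single_le_sum (f := fun j => a i * (H i j * d j)) (fun j _ => hnn i j)
    (Finset.mem_univ j)).trans (Finset.single_le_sum (f := fun i => ∑ j, a i * (H i j * d j))
    (fun i _ => Finset.sum_nonneg fun j _ => hnn i j) (Finset.mem_univ i))

lemma pairing_nonneg {a : α → ℝ} {d : β → ℝ} (ha : ∀ i, 0 < a i) (hd : ∀ j, 0 < d j)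
    {H : Matrix α β ℝ} (hH : ∀ i j, 0 ≤ H i j) : 0 ≤ pairing a d H := by
  rw [pairing_apply]
  exact Finset.sum_nonneg fun i _ => Finset.sum_nonneg fun j _ =>
    mul_nonneg (ha i).le (mul_nonneg (hH i j) (hd j).le)

lemma pairing_pos [Nonempty α] [Nonempty β] {a : α → ℝ} {d : β → ℝ} (ha : ∀ i, 0 < a i)
    (hd : ∀ j, 0 < d j) {H : Matrix α β ℝ} (hH : ∀ i j, 0 < H i j) : 0 < pairing a d H := by
  rw [pairing_apply]
  exact Finset.sum_pos (fun i _ => Finset.sum_pos (fun j _ =>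
    mul_pos (ha i) (mul_pos (hH i j) (hd j))) Finset.univ_nonempty) Finset.univ_nonempty

lemma eq_zero_of_pairing_eq_zero {a : α → ℝ} {d : β → ℝ} (ha : ∀ i, 0 < a i) (hd : ∀ j, 0 < d j)
    {H : Matrix α β ℝ} (hH : ∀ i j, 0 ≤ H i j) (h0 : pairing a d H = 0) : H = 0 := by
  ext i j
  have h1 := mul_le_pairing ha hd hH i j
  rw [h0] at h1
  have h2 : H i j * d j ≤ 0 := nonpos_of_mul_nonpos_right h1 (ha i)
  exact le_antisymm (nonpos_of_mul_nonpos_left h2 (hd j)) (hH i j)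

lemma pairing_sylvester {K : Matrix α α ℝ} {D : Matrix β β ℝ} {a : α → ℝ} {d : β → ℝ} {κ η : ℝ}
    (ha : a ᵥ* K = κ • a) (hd : D *ᵥ d = η • d) (H : Matrix α β ℝ) :
    pairing a d (K * H + H * D) = (κ + η) * pairing a d H := by
  rw [map_add]
  simp only [pairing, LinearMap.coe_mk, AddHom.coe_mk]
  rw [← mulVec_mulVec, ← mulVec_mulVec, hd, dotProduct_mulVec, ha, mulVec_smul, smul_dotProduct,
    dotProduct_smul, smul_eq_mul, smul_eq_mul, add_mul]

/-- With only lower bounds on `a K` and `D d`, the action of the pairing on the Sylvester operator is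
bounded below on nonnegative matrices. -/
lemma pairing_sylvester_ge {K : Matrix α α ℝ}
    {D : Matrix β β ℝ} {a : α → ℝ} {d : β → ℝ} {κ η : ℝ} (ha0 : ∀ i, 0 < a i) (hd0 : ∀ j, 0 < d j)
    (ha : ∀ k, κ * a k ≤ (a ᵥ* K) k) (hd : ∀ j, η * d j ≤ (D *ᵥ d) j) {H : Matrix α β ℝ}
    (hH : ∀ i j, 0 ≤ H i j) : (κ + η) * pairing a d H ≤ pairing a d (K * H + H * D) := by
  have h1 : pairing a d (K * H) = (a ᵥ* K) ⬝ᵥ (H *ᵥ d) := by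
    simp only [pairing, LinearMap.coe_mk, AddHom.coe_mk]
    rw [← mulVec_mulVec, dotProduct_mulVec]
  have h2 : pairing a d (H * D) = (a ᵥ* H) ⬝ᵥ (D *ᵥ d) := by
    simp only [pairing, LinearMap.coe_mk, AddHom.coe_mk]
    rw [← mulVec_mulVec, dotProduct_mulVec]
  have h3 : κ * pairing a d H ≤ (a ᵥ* K) ⬝ᵥ (H *ᵥ d) := by
    simp only [pairing, LinearMap.coe_mk, AddHom.coe_mk, dotProduct, Finset.mul_sum]
    refine Finset.sum_le_sum fun i _ => ?_
    rw [← mul_assoc]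
    exact mul_le_mul_of_nonneg_right (ha i) (mulVec_entry_nonneg hH (fun j => (hd0 j).le) i)
  have h4 : η * pairing a d H ≤ (a ᵥ* H) ⬝ᵥ (D *ᵥ d) := by
    simp only [pairing, LinearMap.coe_mk, AddHom.coe_mk]
    rw [dotProduct_mulVec]
    simp only [dotProduct, Finset.mul_sum]
    refine Finset.sum_le_sum fun j _ => ?_
    rw [mul_left_comm]
    refine mul_le_mul_of_nonneg_left (hd j) ?_
    exact Finset.sum_nonneg fun i _ => mul_nonneg (ha0 i).le (hH i j)
  rw [map_add, h1, h2, add_mul]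
  exact add_le_add h3 h4

/-- The rank-one matrix of right eigenvectors is an eigenvector of the Sylvester operator. -/
lemma sylvester_vecMulVec {K : Matrix α α ℝ}
    {D : Matrix β β ℝ} {a : α → ℝ} {d : β → ℝ} {κ η : ℝ} (ha : K *ᵥ a = κ • a)
    (hd : d ᵥ* D = η • d) : K * vecMulVec a d + vecMulVec a d * D = (κ + η) • vecMulVec a d := by
  rw [mul_vecMulVec, vecMulVec_mul, ha, hd]
  ext i j
  simp only [Matrix.add_apply, Matrix.smul_apply, vecMulVec_apply, Pi.smul_apply, smul_eq_mul]
  ring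

/-- When `K` and `D` are irreducible and a positive `V` is in the kernel of the Sylvester operator,
that kernel is spanned by `V`: subtracting from an element the multiple of `V` that makes it
nonnegative with a zero entry, the zero spreads along `K` in its column and along `D` in all rows. -/
lemma sylvester_ker {K : Matrix α α ℝ} {D : Matrix β β ℝ} [Nonempty α] [Nonempty β]
    (hK : Metzler K) (hKI : Irred K) (hD : Metzler D) (hDI : Irred D) {V H : Matrix α β ℝ}
    (hVpos : ∀ i j, 0 < V i j) (hV : K * V + V * D = 0) (hH : K * H + H * D = 0) :
    ∃ t : ℝ, H = t • V := by
  obtain ⟨⟨i0, j0⟩, -, hm⟩ := Finset.exists_min_image (Finset.univ : Finset (α × β))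
    (fun p => H p.1 p.2 / V p.1 p.2) Finset.univ_nonempty
  set t := H i0 j0 / V i0 j0 with ht
  refine ⟨t, ?_⟩
  set Z := H - t • V with hZdef
  have hZ : ∀ i j, 0 ≤ Z i j := fun i j => by
    have := hm (i, j) (Finset.mem_univ _)
    simp only at this
    rw [le_div_iff₀ (hVpos i j)] at this
    simpa [hZdef] using this
  have hZ0 : Z i0 j0 = 0 := by simp [hZdef, ht, div_mul_cancel₀ _ (hVpos i0 j0).ne']
  have hLZ : K * Z + Z * D = 0 := by
    have : K * Z + Z * D = (K * H + H * D) - t • (K * V + V * D) := by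
      simp only [hZdef, Matrix.mul_sub, Matrix.sub_mul, Matrix.mul_smul, Matrix.smul_mul, smul_add]
      abel
    rw [this, hH, hV, smul_zero, sub_zero]
  -- `Z ≥ 0` vanishes somewhere; its zeros spread along the columns by `K` and the rows by `D`
  have key : ∀ i j, Z i j = 0 → (K *ᵥ fun k => Z k j) i ≤ 0 ∧ (Dᵀ *ᵥ fun l => Z i l) j ≤ 0 := by
    intro i j hij
    have h1 : 0 ≤ (K *ᵥ fun k => Z k j) i := Finset.sum_nonneg fun k _ => by
      by_cases h : i = k
      · subst h; simp [hij]
      · exact mul_nonneg (hK i k h) (hZ k j)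
    have h2 : 0 ≤ (Dᵀ *ᵥ fun l => Z i l) j := Finset.sum_nonneg fun l _ => by
      by_cases h : j = l
      · subst h; simp [hij]
      · exact mul_nonneg (hD.transpose j l h) (hZ i l)
    have h3 : (K *ᵥ fun k => Z k j) i + (Dᵀ *ᵥ fun l => Z i l) j = 0 := by
      have := congrFun (congrFun hLZ i) j
      simpa [mul_apply, mulVec, dotProduct, mul_comm] using this
    constructor <;> linarith
  have hcol := hK.eq_zero_of_zero hKI (fun k => hZ k j0) (fun i hi => (key i j0 hi).1) hZ0
  have hZzero : Z = 0 := by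
    ext i j
    exact congrFun (hD.transpose.eq_zero_of_zero hDI.transpose (fun l => hZ i l)
      (fun j hj => (key i j hj).2) (congrFun hcol i)) j
  exact sub_eq_zero.1 hZzero

/-- Matrices normalized by `pairing a d H = 1` on which the Sylvester operator tends to `0` tend to
the normalized element of its kernel. -/
lemma tendsto_of_sylvester_tendsto_zero {K : Matrix α α ℝ} {D : Matrix β β ℝ} [Nonempty α]
    [Nonempty β] (hK : Metzler K) (hKI : Irred K) (hD : Metzler D) (hDI : Irred D)
    {V : Matrix α β ℝ} (hVpos : ∀ i j, 0 < V i j) (hV : K * V + V * D = 0)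
    {a : α → ℝ} {d : β → ℝ} (hV1 : pairing a d V = 1) {γ : Type*} {l : Filter γ}
    {H : γ → Matrix α β ℝ} (h1 : ∀ᶠ s in l, pairing a d (H s) = 1)
    (h0 : Tendsto (fun s => K * H s + H s * D) l (𝓝 0)) : Tendsto H l (𝓝 V) := by
  let L : Matrix α β ℝ →ₗ[ℝ] Matrix α β ℝ × ℝ :=
    { toFun := fun H => (K * H + H * D, pairing a d H)
      map_add' := fun H H' => by
        rw [map_add, Matrix.mul_add, Matrix.add_mul, Prod.mk_add_mk, add_add_add_comm]
      map_smul' := fun c H => by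
        rw [map_smul, Matrix.mul_smul, Matrix.smul_mul, ← smul_add]; rfl }
  -- `L` is injective, so it has a continuous left inverse
  have hinj : LinearMap.ker L = ⊥ := by
    rw [LinearMap.ker_eq_bot']
    intro H hH
    have hH1 : K * H + H * D = 0 := congrArg Prod.fst hH
    have hH2 : pairing a d H = 0 := congrArg Prod.snd hH
    obtain ⟨t, rfl⟩ := sylvester_ker hK hKI hD hDI hVpos hV hH1
    rw [map_smul, hV1, smul_eq_mul, mul_one] at hH2
    rw [hH2, zero_smul]
  obtain ⟨g, hg⟩ := LinearMap.exists_leftInverse_of_injective L hinj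
  have hgL : ∀ H, g (L H) = H := fun H => congrArg (fun f => f H) hg
  have hgc : Continuous g := LinearMap.continuous_of_finiteDimensional g
  have hL : Tendsto (fun s => L (H s)) l (𝓝 (L V)) := by
    have : L V = (0, 1) := Prod.ext hV hV1
    rw [this]
    exact h0.prodMk_nhds (tendsto_const_nhds.congr' (h1.mono fun s hs => hs.symm))
  have := (hgc.tendsto (L V)).comp hL
  simpa only [Function.comp_def, hgL] using this

end Sylvester

/-! ### Limits of matrix products -/

section MatrixLimits

variable {α β γ ι : Type*} {l : Filter ι}

lemma tendsto_matrix_iff {F : ι → Matrix α β ℝ} {A : Matrix α β ℝ} :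
    Tendsto F l (𝓝 A) ↔ ∀ i j, Tendsto (fun s => F s i j) l (𝓝 (A i j)) := by
  refine Iff.trans (tendsto_pi_nhds (f := F) (g := A)) (forall_congr' fun i => ?_)
  exact tendsto_pi_nhds (f := fun s => F s i) (g := A i)

variable [Fintype β]

lemma tendsto_matrix_mul {F : ι → Matrix α β ℝ} {G : ι → Matrix β γ ℝ} {A : Matrix α β ℝ}
    {B : Matrix β γ ℝ} (hF : Tendsto F l (𝓝 A)) (hG : Tendsto G l (𝓝 B)) :
    Tendsto (fun s => F s * G s) l (𝓝 (A * B)) :=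
  ((continuous_fst.matrix_mul continuous_snd).tendsto (A, B)).comp (hF.prodMk_nhds hG)

lemma tendsto_mul_zero_of_bounded {F : ι → Matrix α β ℝ} {G : ι → Matrix β γ ℝ} [Fintype γ] {C : ℝ}
    (hF : ∀ᶠ s in l, ∀ i j, |F s i j| ≤ C) (hG : Tendsto G l (𝓝 0)) :
    Tendsto (fun s => F s * G s) l (𝓝 0) := by
  rw [tendsto_matrix_iff] at hG ⊢
  intro i j
  have h0 : Tendsto (fun s => ∑ k, C * |G s k j|) l (𝓝 0) := by
    have : Tendsto (fun s => ∑ k, C * |G s k j|) l (𝓝 (∑ k : β, C * |(0 : Matrix β γ ℝ) k j|)) :=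
      tendsto_finsetSum _ fun k _ => ((hG k j).abs).const_mul C
    simpa using this
  refine squeeze_zero_norm' (hF.mono fun s hs => ?_) h0
  rw [mul_apply, Real.norm_eq_abs]
  refine (Finset.abs_sum_le_sum_abs _ _).trans (Finset.sum_le_sum fun k _ => ?_)
  rw [abs_mul]
  exact mul_le_mul_of_nonneg_right (hs i k) (abs_nonneg _)

lemma tendsto_mul_zero_of_bounded' {F : ι → Matrix α β ℝ} {G : ι → Matrix β γ ℝ} [Fintype α]
    {C : ℝ} (hF : Tendsto F l (𝓝 0)) (hG : ∀ᶠ s in l, ∀ i j, |G s i j| ≤ C) :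
    Tendsto (fun s => F s * G s) l (𝓝 0) := by
  have hF' : Tendsto (fun s => (F s)ᵀ) l (𝓝 0) := by
    simpa [Function.comp_def] using (continuous_id.matrix_transpose.tendsto (0 : Matrix α β ℝ)).comp hF
  have h := tendsto_mul_zero_of_bounded (F := fun s => (G s)ᵀ) (G := fun s => (F s)ᵀ)
    (hG.mono fun s hs i j => hs j i) hF'
  have h2 := (continuous_id.matrix_transpose.tendsto (0 : Matrix γ α ℝ)).comp h
  simpa [Function.comp_def, transpose_mul] using h2

/-- A strict positive vector for `A(s₀)` serves for all nearby `A(s)`: the minimum principle is an open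
condition on Metzler matrices. -/
lemma Metzler.eventually_minPrinciple {ι : Type*} [Fintype ι] [DecidableEq ι] {A : ℝ → Matrix ι ι ℝ}
    (hM : ∀ s, Metzler (A s)) {s₀ : ℝ} (hA : ContinuousAt A s₀) (h : MinPrinciple (A s₀)) :
    ∀ᶠ s in 𝓝 s₀, MinPrinciple (A s) := by
  obtain ⟨v, hv, hAv⟩ := (hM s₀).exists_pos_mulVec_neg h
  have h1 : ∀ i, ∀ᶠ s in 𝓝 s₀, (A s *ᵥ v) i < 0 := fun i => by
    have : Tendsto (fun s => (A s *ᵥ v) i) (𝓝 s₀) (𝓝 ((A s₀ *ᵥ v) i)) :=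
      tendsto_finsetSum _ fun j _ => (tendsto_matrix_iff.1 hA i j).mul_const _
    exact this.eventually_lt_const (hAv i)
  filter_upwards [eventually_all.2 h1] with s hs
  exact (hM s).minPrinciple_of_mulVec_neg hv hs

end MatrixLimits

/-! ### Square-root singularity of a Riccati equation -/

section Riccati

variable {α β : Type*} [Fintype α] [Fintype β]

/-- The Riccati polynomial `Q₁₂ + Q₁₁ X + X Q₂₂ + X Q₂₁ X`. -/
def riccati (Q11 : Matrix α α ℝ) (Q12 : Matrix α β ℝ) (Q21 : Matrix β α ℝ) (Q22 : Matrix β β ℝ)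
    (X : Matrix α β ℝ) : Matrix α β ℝ := Q12 + Q11 * X + X * Q22 + X * Q21 * X

/-- The difference of two solutions of Riccati equations, expanded about the first one. -/
lemma riccati_sub {Q11 P11 : Matrix α α ℝ} {Q12 P12 : Matrix α β ℝ} {Q21 P21 : Matrix β α ℝ}
    {Q22 P22 : Matrix β β ℝ} {X Z : Matrix α β ℝ} (hX : riccati Q11 Q12 Q21 Q22 X = 0)
    (hZ : riccati P11 P12 P21 P22 Z = 0) :
    (Q11 + X * Q21) * (X - Z) + (X - Z) * (Q22 + Q21 * X) = (X - Z) * Q21 * (X - Z) -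
      ((Q12 - P12) + (Q11 - P11) * Z + Z * (Q22 - P22) + Z * (Q21 - P21) * Z) := by
  rw [← sub_eq_zero]
  calc _ = riccati Q11 Q12 Q21 Q22 X - riccati P11 P12 P21 P22 Z := by
        simp only [riccati, Matrix.mul_add, Matrix.add_mul, Matrix.mul_sub, Matrix.sub_mul,
          Matrix.mul_assoc]
        abel
    _ = 0 := by rw [hX, hZ, sub_zero]

/-- A right derivative `Φ` of a family `Ψ` of solutions of Riccati equations solves the Sylvester
equation obtained by differentiation. -/
lemma sylvester_of_slope {s₀ : ℝ} {Ψ : ℝ → Matrix α β ℝ} {Φ : Matrix α β ℝ}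
    {Q11 : ℝ → Matrix α α ℝ} {Q12 : ℝ → Matrix α β ℝ} {Q21 : ℝ → Matrix β α ℝ}
    {Q22 : ℝ → Matrix β β ℝ} {A11 : Matrix α α ℝ} {A12 : Matrix α β ℝ} {A21 : Matrix β α ℝ}
    {A22 : Matrix β β ℝ}
    (h11 : Tendsto (fun s => (s - s₀)⁻¹ • (Q11 s₀ - Q11 s)) (𝓝[>] s₀) (𝓝 A11))
    (h12 : Tendsto (fun s => (s - s₀)⁻¹ • (Q12 s₀ - Q12 s)) (𝓝[>] s₀) (𝓝 A12))
    (h21 : Tendsto (fun s => (s - s₀)⁻¹ • (Q21 s₀ - Q21 s)) (𝓝[>] s₀) (𝓝 A21))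
    (h22 : Tendsto (fun s => (s - s₀)⁻¹ • (Q22 s₀ - Q22 s)) (𝓝[>] s₀) (𝓝 A22))
    (hric : ∀ s, s₀ ≤ s → riccati (Q11 s) (Q12 s) (Q21 s) (Q22 s) (Ψ s) = 0)
    (hΨ : Tendsto Ψ (𝓝[>] s₀) (𝓝 (Ψ s₀)))
    (hΦ : Tendsto (fun s => (s - s₀)⁻¹ • (Ψ s - Ψ s₀)) (𝓝[>] s₀) (𝓝 Φ)) :
    (Q11 s₀ + Ψ s₀ * Q21 s₀) * Φ + Φ * (Q22 s₀ + Q21 s₀ * Ψ s₀) =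
      A12 + A11 * Ψ s₀ + Ψ s₀ * A22 + Ψ s₀ * A21 * Ψ s₀ := by
  set K := Q11 s₀ + Ψ s₀ * Q21 s₀
  set D := Q22 s₀ + Q21 s₀ * Ψ s₀
  have hL : Tendsto (fun s => K * ((s - s₀)⁻¹ • (Ψ s - Ψ s₀)) + ((s - s₀)⁻¹ • (Ψ s - Ψ s₀)) * D)
      (𝓝[>] s₀) (𝓝 (K * Φ + Φ * D)) :=
    (tendsto_matrix_mul tendsto_const_nhds hΦ).add (tendsto_matrix_mul hΦ tendsto_const_nhds)
  have hΔ : Tendsto (fun s => Ψ s₀ - Ψ s) (𝓝[>] s₀) (𝓝 0) := by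
    simpa using hΨ.const_sub (Ψ s₀)
  have hR : Tendsto (fun s => ((s - s₀)⁻¹ • (Ψ s - Ψ s₀)) * Q21 s₀ * (Ψ s₀ - Ψ s) +
      ((s - s₀)⁻¹ • (Q12 s₀ - Q12 s) + ((s - s₀)⁻¹ • (Q11 s₀ - Q11 s)) * Ψ s +
        Ψ s * ((s - s₀)⁻¹ • (Q22 s₀ - Q22 s)) + Ψ s * ((s - s₀)⁻¹ • (Q21 s₀ - Q21 s)) * Ψ s))
      (𝓝[>] s₀) (𝓝 (Φ * Q21 s₀ * (0 : Matrix α β ℝ) + (A12 + A11 * Ψ s₀ + Ψ s₀ * A22 + Ψ s₀ * A21 * Ψ s₀))) :=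
    (tendsto_matrix_mul (tendsto_matrix_mul hΦ tendsto_const_nhds) hΔ).add
      (((h12.add (tendsto_matrix_mul h11 hΨ)).add (tendsto_matrix_mul hΨ h22)).add
        (tendsto_matrix_mul (tendsto_matrix_mul hΨ h21) hΨ))
  rw [Matrix.mul_zero, zero_add] at hR
  refine tendsto_nhds_unique hL (hR.congr' ?_)
  filter_upwards [self_mem_nhdsWithin] with s hs
  have h := riccati_sub (hric s₀ le_rfl) (hric s (le_of_lt hs))
  have h2 : K * ((s - s₀)⁻¹ • (Ψ s - Ψ s₀)) + ((s - s₀)⁻¹ • (Ψ s - Ψ s₀)) * D =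
      -((s - s₀)⁻¹ • (K * (Ψ s₀ - Ψ s) + (Ψ s₀ - Ψ s) * D)) := by
    rw [← neg_sub (Ψ s₀) (Ψ s)]
    simp only [Matrix.mul_smul, Matrix.smul_mul, Matrix.mul_neg, Matrix.neg_mul, smul_neg, smul_add,
      neg_add]
  rw [h2, h, ← neg_sub (Ψ s₀) (Ψ s), smul_sub _ (_ * _ * _)]
  simp only [Matrix.mul_smul, Matrix.smul_mul, Matrix.neg_mul, smul_neg, smul_add]
  abel

/-- **Square-root singularity.** Let `Ψ(s)`, `s ≥ s₀`, solve Riccati equations whose linearization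
at `s₀` has a positive element `V` in its kernel, and let `Φ(s) ≤ 0` solve the differentiated
equations. Then `Ψ(s₀) - Ψ(s)` and `-Φ(s)`, divided by their pairings with the positive left
eigenvector, both tend to `V`, and pairing the equations with that eigenvector removes the linear
term and determines the sizes `ρ √(s - s₀)` and `ρ / (2 √(s - s₀))`. -/
theorem riccati_sqrt_expansion [Nonempty α] [Nonempty β] {s₀ : ℝ} {Ψ Φ : ℝ → Matrix α β ℝ}
    {Q11 : ℝ → Matrix α α ℝ} {Q12 : ℝ → Matrix α β ℝ} {Q21 : ℝ → Matrix β α ℝ}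
    {Q22 : ℝ → Matrix β β ℝ} {A11 : Matrix α α ℝ} {A12 : Matrix α β ℝ} {A21 : Matrix β α ℝ}
    {A22 : Matrix β β ℝ} {U : ℝ → Matrix α β ℝ}
    (h11 : Tendsto (fun s => (s - s₀)⁻¹ • (Q11 s₀ - Q11 s)) (𝓝[>] s₀) (𝓝 A11))
    (h12 : Tendsto (fun s => (s - s₀)⁻¹ • (Q12 s₀ - Q12 s)) (𝓝[>] s₀) (𝓝 A12))
    (h21 : Tendsto (fun s => (s - s₀)⁻¹ • (Q21 s₀ - Q21 s)) (𝓝[>] s₀) (𝓝 A21))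
    (h22 : Tendsto (fun s => (s - s₀)⁻¹ • (Q22 s₀ - Q22 s)) (𝓝[>] s₀) (𝓝 A22))
    (hric : ∀ s, s₀ ≤ s → riccati (Q11 s) (Q12 s) (Q21 s) (Q22 s) (Ψ s) = 0)
    (hΨ : Tendsto Ψ (𝓝[>] s₀) (𝓝 (Ψ s₀)))
    (hmono : ∀ s, s₀ < s → ∀ i j, Ψ s i j ≤ Ψ s₀ i j)
    (hU : A12 + A11 * Ψ s₀ + Ψ s₀ * A22 + Ψ s₀ * A21 * Ψ s₀ = U s₀)
    (hUpos : ∀ i j, 0 < U s₀ i j) (hUt : Tendsto U (𝓝[>] s₀) (𝓝 (U s₀)))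
    (hΦ : ∀ s, s₀ < s → (Q11 s + Ψ s * Q21 s) * Φ s + Φ s * (Q22 s + Q21 s * Ψ s) = U s)
    (hΦneg : ∀ s, s₀ < s → ∀ i j, Φ s i j ≤ 0)
    {K : Matrix α α ℝ} {D : Matrix β β ℝ} (hKdef : Q11 s₀ + Ψ s₀ * Q21 s₀ = K)
    (hDdef : Q22 s₀ + Q21 s₀ * Ψ s₀ = D)
    (hK : Metzler K) (hKI : Irred K) (hD : Metzler D) (hDI : Irred D)
    (hQ21 : ∀ i j, 0 ≤ Q21 s₀ i j) (hQ21ne : Q21 s₀ ≠ 0)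
    {V : Matrix α β ℝ} (hVpos : ∀ i j, 0 < V i j) (hV : K * V + V * D = 0)
    {a : α → ℝ} {d : β → ℝ} {κ : ℝ} (hapos : ∀ i, 0 < a i) (hdpos : ∀ j, 0 < d j)
    (ha : a ᵥ* K = κ • a) (hd : D *ᵥ d = (-κ) • d) (hV1 : pairing a d V = 1) :
    ∃ B Y : Matrix α β ℝ, (∀ i j, 0 < B i j) ∧
      Tendsto (fun s => (√(s - s₀))⁻¹ • (Ψ s₀ - Ψ s)) (𝓝[>] s₀) (𝓝 B) ∧
      Tendsto (fun s => K * Φ s + Φ s * D) (𝓝[>] s₀) (𝓝 Y) ∧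
      B * Q21 s₀ * B = U s₀ - Y ∧ K * B + B * D = 0 := by
  set w := pairing a d with hw
  have hwc : Continuous w := LinearMap.continuous_of_finiteDimensional w
  have hwL : ∀ H : Matrix α β ℝ, w (K * H + H * D) = 0 := fun H => by
    rw [hw, pairing_sylvester ha hd, add_neg_cancel, zero_mul]
  have hu : 0 < w (U s₀) := pairing_pos hapos hdpos hUpos
  set N := V * Q21 s₀ * V with hN
  have hNpos : 0 < w N := by
    have hNnn : ∀ i j, 0 ≤ N i j := fun i j => by
      rw [hN, mul_apply]
      refine Finset.sum_nonneg fun l _ => mul_nonneg ?_ (hVpos _ _).le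
      rw [mul_apply]
      exact Finset.sum_nonneg fun k _ => mul_nonneg (hVpos _ _).le (hQ21 _ _)
    refine lt_of_le_of_ne (pairing_nonneg hapos hdpos hNnn) fun h0 => hQ21ne ?_
    have hN0 := eq_zero_of_pairing_eq_zero hapos hdpos hNnn h0.symm
    ext j i
    have h1 : ∑ l, (V * Q21 s₀) i l * V l j = 0 := by
      have := congrFun (congrFun hN0 i) j
      rwa [hN, mul_apply] at this
    have hVQ : ∀ l, 0 ≤ (V * Q21 s₀) i l := fun l => by
      rw [mul_apply]
      exact Finset.sum_nonneg fun k _ => mul_nonneg (hVpos _ _).le (hQ21 _ _)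
    have h2 := (Finset.sum_eq_zero_iff_of_nonneg fun l _ =>
      mul_nonneg (hVQ l) (hVpos l j).le).1 h1 i (Finset.mem_univ _)
    have h3 := (mul_eq_zero.1 h2).resolve_right (hVpos _ _).ne'
    rw [mul_apply] at h3
    have h4 := (Finset.sum_eq_zero_iff_of_nonneg fun k _ =>
      mul_nonneg (hVpos i k).le (hQ21 k i)).1 h3 j (Finset.mem_univ _)
    exact (mul_eq_zero.1 h4).resolve_left (hVpos _ _).ne'
  -- nonnegative matrices normalized by the pairing are bounded
  obtain ⟨C, hC⟩ : ∃ C : ℝ, ∀ H : Matrix α β ℝ, (∀ i j, 0 ≤ H i j) → w H = 1 →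
      ∀ i j, |H i j| ≤ C := by
    refine ⟨∑ i, ∑ j, (a i * d j)⁻¹, fun H hH h1 i j => ?_⟩
    have hpos : 0 < a i * d j := mul_pos (hapos i) (hdpos j)
    have h2 := mul_le_pairing hapos hdpos hH i j
    rw [← hw, h1] at h2
    have h3 : H i j ≤ (a i * d j)⁻¹ := by
      rw [← one_div, le_div_iff₀ hpos]; linarith
    have hnn : ∀ i j, 0 ≤ (a i * d j)⁻¹ := fun i j =>
      inv_nonneg.2 (mul_pos (hapos i) (hdpos j)).le
    rw [abs_of_nonneg (hH i j)]
    exact h3.trans ((Finset.single_le_sum (f := fun j => (a i * d j)⁻¹) (fun j _ => hnn i j)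
      (Finset.mem_univ j)).trans (Finset.single_le_sum (f := fun i => ∑ j, (a i * d j)⁻¹)
      (fun i _ => Finset.sum_nonneg fun j _ => hnn i j) (Finset.mem_univ i)))
  set Δ : ℝ → Matrix α β ℝ := fun s => Ψ s₀ - Ψ s with hΔdef
  have hΔ : Tendsto Δ (𝓝[>] s₀) (𝓝 0) := by
    simpa using hΨ.const_sub (Ψ s₀)
  have hΔnn : ∀ s, s₀ < s → ∀ i j, 0 ≤ Δ s i j := fun s hs i j => by
    simpa [hΔdef] using hmono s hs i j
  set Ut : ℝ → Matrix α β ℝ := fun s => (s - s₀)⁻¹ • (Q12 s₀ - Q12 s) +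
    ((s - s₀)⁻¹ • (Q11 s₀ - Q11 s)) * Ψ s + Ψ s * ((s - s₀)⁻¹ • (Q22 s₀ - Q22 s)) +
    Ψ s * ((s - s₀)⁻¹ • (Q21 s₀ - Q21 s)) * Ψ s with hUtdef
  have hUt' : Tendsto Ut (𝓝[>] s₀) (𝓝 (U s₀)) := by
    rw [← hU]
    exact ((h12.add (tendsto_matrix_mul h11 hΨ)).add (tendsto_matrix_mul hΨ h22)).add
      (tendsto_matrix_mul (tendsto_matrix_mul hΨ h21) hΨ)
  have hwUt : Tendsto (fun s => w (Ut s)) (𝓝[>] s₀) (𝓝 (w (U s₀))) :=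
    (hwc.tendsto _).comp hUt'
  have hwUt_pos : ∀ᶠ s in 𝓝[>] s₀, 0 < w (Ut s) := hwUt.eventually_const_lt hu
  -- `Δ` solves a Riccati equation whose linear part is the Sylvester operator at `s₀`
  have heq : ∀ s, s₀ < s →
      K * Δ s + Δ s * D = Δ s * Q21 s₀ * Δ s - (s - s₀) • Ut s := by
    intro s hs
    have h := riccati_sub (hric s₀ le_rfl) (hric s (le_of_lt hs))
    rw [hKdef, hDdef] at h
    rw [hΔdef]
    simp only
    rw [h, hUtdef]
    have hne : s - s₀ ≠ 0 := (sub_pos.2 hs).ne'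
    simp only [smul_add, Matrix.smul_mul, Matrix.mul_smul, smul_smul, mul_inv_cancel₀ hne, one_smul]
  set m : ℝ → ℝ := fun s => w (Δ s) with hm
  have hm0 : Tendsto m (𝓝[>] s₀) (𝓝 0) := by
    have := (hwc.tendsto 0).comp hΔ
    rwa [map_zero] at this
  have hmpos : ∀ᶠ s in 𝓝[>] s₀, 0 < m s := by
    filter_upwards [self_mem_nhdsWithin, hwUt_pos] with s hs hws
    have hs : s₀ < s := hs
    refine lt_of_le_of_ne (pairing_nonneg hapos hdpos (hΔnn s hs)) fun h0 => ?_
    have hz := eq_zero_of_pairing_eq_zero hapos hdpos (hΔnn s hs) h0.symm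
    have h := congrArg w (heq s hs)
    rw [hwL, hz, Matrix.mul_zero, zero_sub, map_neg, map_smul, smul_eq_mul] at h
    have := mul_pos (sub_pos.2 hs) hws
    linarith
  set H : ℝ → Matrix α β ℝ := fun s => (m s)⁻¹ • Δ s with hHdef
  have hH1 : ∀ᶠ s in 𝓝[>] s₀, w (H s) = 1 := by
    filter_upwards [hmpos] with s hs
    rw [hHdef]
    simp only
    rw [map_smul, smul_eq_mul]
    exact inv_mul_cancel₀ hs.ne'
  have hHC : ∀ᶠ s in 𝓝[>] s₀, ∀ i j, |H s i j| ≤ C := by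
    filter_upwards [hmpos, hH1, self_mem_nhdsWithin] with s hs h1 hs0
    exact hC _ (fun i j => mul_nonneg (inv_nonneg.2 hs.le) (hΔnn s hs0 i j)) h1
  have hHQΔ : Tendsto (fun s => H s * Q21 s₀ * Δ s) (𝓝[>] s₀) (𝓝 0) := by
    have h1 : Tendsto (fun s => Q21 s₀ * Δ s) (𝓝[>] s₀) (𝓝 0) := by
      simpa using tendsto_matrix_mul tendsto_const_nhds hΔ
    simpa only [Matrix.mul_assoc] using tendsto_mul_zero_of_bounded hHC h1
  -- The pairing annihilates the linear part: `s - s₀` is quadratic in `Δ`, so of order `o(m)`.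
  have hδ : ∀ s, s₀ < s → (s - s₀) * w (Ut s) = w (Δ s * Q21 s₀ * Δ s) := fun s hs => by
    have h := congrArg w (heq s hs)
    rw [hwL, map_sub, map_smul, smul_eq_mul] at h
    linarith
  have hδm : Tendsto (fun s => (m s)⁻¹ * (s - s₀)) (𝓝[>] s₀) (𝓝 0) := by
    have h1 : Tendsto (fun s => w (H s * Q21 s₀ * Δ s) / w (Ut s)) (𝓝[>] s₀)
        (𝓝 (w 0 / w (U s₀))) := ((hwc.tendsto 0).comp hHQΔ).div hwUt hu.ne'
    rw [map_zero, zero_div] at h1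
    refine h1.congr' ?_
    filter_upwards [self_mem_nhdsWithin, hwUt_pos] with s hs hws
    rw [div_eq_iff hws.ne', mul_assoc, hδ s hs, hHdef]
    simp only [Matrix.smul_mul, map_smul, smul_eq_mul]
  have hLH : Tendsto (fun s => K * H s + H s * D) (𝓝[>] s₀) (𝓝 0) := by
    have h1 : Tendsto (fun s => H s * Q21 s₀ * Δ s - ((m s)⁻¹ * (s - s₀)) • Ut s) (𝓝[>] s₀)
        (𝓝 (0 - (0 : ℝ) • U s₀)) := hHQΔ.sub (hδm.smul hUt')
    rw [zero_smul, sub_zero] at h1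
    refine h1.congr' ?_
    filter_upwards [self_mem_nhdsWithin] with s hs
    have h := congrArg (fun X => (m s)⁻¹ • X) (heq s hs)
    simp only [hHdef, Matrix.smul_mul, Matrix.mul_smul, smul_sub, smul_add, smul_smul] at h ⊢
    rw [h]
  have hHV : Tendsto H (𝓝[>] s₀) (𝓝 V) :=
    tendsto_of_sylvester_tendsto_zero hK hKI hD hDI hVpos hV hV1 hH1 hLH
  -- The same identity with `Δ = m H`, `H → V`, gives `(s - s₀) w(U) ∼ m² w(N)`, hence the size of `m`.
  set ρ : ℝ := √(w (U s₀) / w N) with hρ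
  have hρpos : 0 < ρ := Real.sqrt_pos.2 (div_pos hu hNpos)
  have hρ2 : ρ * ρ * w N = w (U s₀) := by
    rw [hρ, Real.mul_self_sqrt (div_pos hu hNpos).le, div_mul_cancel₀ _ hNpos.ne']
  have hmρ : Tendsto (fun s => (√(s - s₀))⁻¹ * m s) (𝓝[>] s₀) (𝓝 ρ) := by
    have hHH : Tendsto (fun s => w (H s * Q21 s₀ * H s)) (𝓝[>] s₀) (𝓝 (w N)) :=
      (hwc.tendsto N).comp
        (tendsto_matrix_mul (tendsto_matrix_mul hHV tendsto_const_nhds) hHV)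
    have h1 : Tendsto (fun s => √(w (Ut s) / w (H s * Q21 s₀ * H s))) (𝓝[>] s₀) (𝓝 ρ) :=
      (Real.continuous_sqrt.tendsto _).comp (hwUt.div hHH hNpos.ne')
    refine h1.congr' ?_
    filter_upwards [self_mem_nhdsWithin, hmpos, hwUt_pos, hHH.eventually_const_lt hNpos]
      with s hs hms hws hwH
    have hs : 0 < s - s₀ := sub_pos.2 hs
    have h2 : w (Δ s * Q21 s₀ * Δ s) = m s * m s * w (H s * Q21 s₀ * H s) := by
      rw [hHdef]
      simp only [Matrix.smul_mul, Matrix.mul_smul, map_smul, smul_eq_mul]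
      field_simp
    have h3 := hδ s (sub_pos.1 hs)
    rw [h2] at h3
    have h4 : w (Ut s) / w (H s * Q21 s₀ * H s) = (m s) ^ 2 / (s - s₀) := by
      rw [div_eq_div_iff hwH.ne' hs.ne']
      linarith
    rw [h4, Real.sqrt_div (sq_nonneg _), Real.sqrt_sq hms.le, div_eq_inv_mul]
  set B : Matrix α β ℝ := ρ • V with hB
  have hΔB : Tendsto (fun s => (√(s - s₀))⁻¹ • Δ s) (𝓝[>] s₀) (𝓝 B) := by
    refine (hmρ.smul hHV).congr' ?_
    filter_upwards [hmpos] with s hs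
    rw [hHdef]
    simp only
    rw [smul_smul, mul_assoc, mul_inv_cancel₀ hs.ne', mul_one]
  have hLB : K * B + B * D = 0 := by
    rw [hB, Matrix.mul_smul, Matrix.smul_mul, ← smul_add, hV, smul_zero]
  have hBQB : B * Q21 s₀ * B = (ρ * ρ) • N := by
    rw [hB, hN]; simp only [Matrix.mul_smul, Matrix.smul_mul, smul_smul]
  -- For `Φ`, the coefficients differ from `K` and `D` by `√(s - s₀) B Q₂₁` and `√(s - s₀) Q₂₁ B` to
  -- leading order; pairing the equation `K Φ + Φ D = U` with `a`, `d` then fixes the size of `Φ`.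
  have hsq : Tendsto (fun s => √(s - s₀)) (𝓝[>] s₀) (𝓝 0) := by
    have : Tendsto (fun s => √(s - s₀)) (𝓝 s₀) (𝓝 (√(s₀ - s₀))) :=
      (Real.continuous_sqrt.comp (continuous_id.sub continuous_const)).tendsto s₀
    rw [sub_self, Real.sqrt_zero] at this
    exact this.mono_left nhdsWithin_le_nhds
  have hsqrt_inv : ∀ s, s₀ < s → √(s - s₀) * (s - s₀)⁻¹ = (√(s - s₀))⁻¹ := fun s hs => by
    have hs : 0 < s - s₀ := sub_pos.2 hs
    have h1 := Real.mul_self_sqrt hs.le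
    have h2 : √(s - s₀) ≠ 0 := (Real.sqrt_pos.2 hs).ne'
    field_simp
    nlinarith
  have hKs : Tendsto (fun s => (√(s - s₀))⁻¹ • (K - (Q11 s + Ψ s * Q21 s))) (𝓝[>] s₀)
      (𝓝 (B * Q21 s₀)) := by
    have h1 : Tendsto (fun s => √(s - s₀) • ((s - s₀)⁻¹ • (Q11 s₀ - Q11 s)) +
        ((√(s - s₀))⁻¹ • Δ s) * Q21 s₀ +
        √(s - s₀) • (Ψ s * ((s - s₀)⁻¹ • (Q21 s₀ - Q21 s)))) (𝓝[>] s₀)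
        (𝓝 ((0 : ℝ) • A11 + B * Q21 s₀ + (0 : ℝ) • (Ψ s₀ * A21))) :=
      ((hsq.smul h11).add (tendsto_matrix_mul hΔB tendsto_const_nhds)).add
        (hsq.smul (tendsto_matrix_mul hΨ h21))
    rw [zero_smul, zero_smul, zero_add, add_zero] at h1
    refine h1.congr' ?_
    filter_upwards [self_mem_nhdsWithin] with s hs
    rw [Matrix.mul_smul, smul_smul, smul_smul, hsqrt_inv s hs, Matrix.smul_mul, ← smul_add,
      ← smul_add, ← hKdef, hΔdef]
    simp only [Matrix.mul_sub, Matrix.sub_mul]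
    congr 1
    abel
  have hDs : Tendsto (fun s => (√(s - s₀))⁻¹ • (D - (Q22 s + Q21 s * Ψ s))) (𝓝[>] s₀)
      (𝓝 (Q21 s₀ * B)) := by
    have h1 : Tendsto (fun s => √(s - s₀) • ((s - s₀)⁻¹ • (Q22 s₀ - Q22 s)) +
        Q21 s₀ * ((√(s - s₀))⁻¹ • Δ s) +
        √(s - s₀) • (((s - s₀)⁻¹ • (Q21 s₀ - Q21 s)) * Ψ s)) (𝓝[>] s₀)
        (𝓝 ((0 : ℝ) • A22 + Q21 s₀ * B + (0 : ℝ) • (A21 * Ψ s₀))) :=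
      ((hsq.smul h22).add (tendsto_matrix_mul tendsto_const_nhds hΔB)).add
        (hsq.smul (tendsto_matrix_mul h21 hΨ))
    rw [zero_smul, zero_smul, zero_add, add_zero] at h1
    refine h1.congr' ?_
    filter_upwards [self_mem_nhdsWithin] with s hs
    rw [Matrix.smul_mul, smul_smul, smul_smul, hsqrt_inv s hs, Matrix.mul_smul, ← smul_add,
      ← smul_add, ← hDdef, hΔdef]
    simp only [Matrix.mul_sub, Matrix.sub_mul]
    congr 1
    abel
  have hK0 : Tendsto (fun s => K - (Q11 s + Ψ s * Q21 s)) (𝓝[>] s₀) (𝓝 0) := by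
    have h1 := hsq.smul hKs
    rw [zero_smul] at h1
    refine h1.congr' ?_
    filter_upwards [self_mem_nhdsWithin] with s hs
    rw [smul_smul, mul_inv_cancel₀ (Real.sqrt_pos.2 (sub_pos.2 hs)).ne', one_smul]
  have hD0 : Tendsto (fun s => D - (Q22 s + Q21 s * Ψ s)) (𝓝[>] s₀) (𝓝 0) := by
    have h1 := hsq.smul hDs
    rw [zero_smul] at h1
    refine h1.congr' ?_
    filter_upwards [self_mem_nhdsWithin] with s hs
    rw [smul_smul, mul_inv_cancel₀ (Real.sqrt_pos.2 (sub_pos.2 hs)).ne', one_smul]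
  have hGnn : ∀ s, s₀ < s → ∀ i j, 0 ≤ (-Φ s) i j := fun s hs i j => by
    have := hΦneg s hs i j
    simpa using this
  have hwU : Tendsto (fun s => w (U s)) (𝓝[>] s₀) (𝓝 (w (U s₀))) := (hwc.tendsto _).comp hUt
  have hwU_pos : ∀ᶠ s in 𝓝[>] s₀, 0 < w (U s) := hwU.eventually_const_lt hu
  set g : ℝ → ℝ := fun s => w (-Φ s) with hg
  have hgpos : ∀ᶠ s in 𝓝[>] s₀, 0 < g s := by
    filter_upwards [self_mem_nhdsWithin, hwU_pos] with s hs hws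
    refine lt_of_le_of_ne (pairing_nonneg hapos hdpos (hGnn s hs)) fun h0 => ?_
    have hz := neg_eq_zero.1 (eq_zero_of_pairing_eq_zero hapos hdpos (hGnn s hs) h0.symm)
    have h := hΦ s hs
    rw [hz, Matrix.mul_zero, Matrix.zero_mul, add_zero] at h
    rw [← h, map_zero] at hws
    exact lt_irrefl _ hws
  -- the normalized derivative tends to `V`, as the normalized increment does
  set G : ℝ → Matrix α β ℝ := fun s => (g s)⁻¹ • -Φ s with hGdef
  have hG1 : ∀ᶠ s in 𝓝[>] s₀, w (G s) = 1 := by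
    filter_upwards [hgpos] with s hs
    rw [hGdef]
    simp only
    rw [map_smul, smul_eq_mul]
    exact inv_mul_cancel₀ hs.ne'
  have hGC : ∀ᶠ s in 𝓝[>] s₀, ∀ i j, |G s i j| ≤ C := by
    filter_upwards [hgpos, hG1, self_mem_nhdsWithin] with s hs h1 hs0
    exact hC _ (fun i j => mul_nonneg (inv_nonneg.2 hs.le) (hGnn s hs0 i j)) h1
  set E : ℝ → Matrix α β ℝ := fun s =>
    (K - (Q11 s + Ψ s * Q21 s)) * G s + G s * (D - (Q22 s + Q21 s * Ψ s)) with hE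
  have hE0 : Tendsto E (𝓝[>] s₀) (𝓝 0) := by
    have := (tendsto_mul_zero_of_bounded' hK0 hGC).add (tendsto_mul_zero_of_bounded hGC hD0)
    rwa [add_zero] at this
  have hLG : ∀ s, s₀ < s → K * G s + G s * D = E s - (g s)⁻¹ • U s := fun s hs => by
    have h := hΦ s hs
    rw [hE, hGdef, ← h]
    simp only [Matrix.sub_mul, Matrix.mul_sub, smul_add, smul_sub, Matrix.mul_smul,
      Matrix.smul_mul, Matrix.mul_neg, Matrix.neg_mul, smul_neg]
    abel
  have hwE : ∀ s, s₀ < s → w (E s) = (g s)⁻¹ * w (U s) := fun s hs => by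
    have h := congrArg w (hLG s hs)
    rw [hwL, map_sub, map_smul, smul_eq_mul] at h
    linarith
  have hginv : Tendsto (fun s => (g s)⁻¹) (𝓝[>] s₀) (𝓝 0) := by
    have h1 : Tendsto (fun s => w (E s) / w (U s)) (𝓝[>] s₀) (𝓝 (w 0 / w (U s₀))) :=
      ((hwc.tendsto 0).comp hE0).div hwU hu.ne'
    rw [map_zero, zero_div] at h1
    refine h1.congr' ?_
    filter_upwards [self_mem_nhdsWithin, hwU_pos] with s hs hws
    rw [div_eq_iff hws.ne', hwE s hs]
  have hGV : Tendsto G (𝓝[>] s₀) (𝓝 V) := by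
    refine tendsto_of_sylvester_tendsto_zero hK hKI hD hDI hVpos hV hV1 hG1 ?_
    have h1 := hE0.sub (hginv.smul hUt)
    rw [zero_smul, sub_zero] at h1
    refine h1.congr' ?_
    filter_upwards [self_mem_nhdsWithin] with s hs
    rw [hLG s hs]
  have hEs : Tendsto (fun s => (√(s - s₀))⁻¹ • E s) (𝓝[>] s₀) (𝓝 ((2 * ρ) • N)) := by
    have h1 := (tendsto_matrix_mul hKs hGV).add (tendsto_matrix_mul hGV hDs)
    have h2 : B * Q21 s₀ * V + V * (Q21 s₀ * B) = (2 * ρ) • N := by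
      rw [hB, hN]
      simp only [Matrix.mul_smul, Matrix.smul_mul, Matrix.mul_assoc]
      rw [two_mul, add_smul]
    rw [h2] at h1
    refine h1.congr fun s => ?_
    simp only [hE]
    rw [smul_add, ← Matrix.smul_mul, ← Matrix.mul_smul]
  have hgs : Tendsto (fun s => g s * √(s - s₀)) (𝓝[>] s₀) (𝓝 (ρ / 2)) := by
    have hpos : 0 < w ((2 * ρ) • N) := by
      rw [map_smul, smul_eq_mul]; positivity
    have hwEs : Tendsto (fun s => w ((√(s - s₀))⁻¹ • E s)) (𝓝[>] s₀) (𝓝 (w ((2 * ρ) • N))) :=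
      (hwc.tendsto _).comp hEs
    have h1 := hwU.div hwEs hpos.ne'
    have h2 : w (U s₀) / w ((2 * ρ) • N) = ρ / 2 := by
      rw [map_smul, smul_eq_mul, ← hρ2]
      field_simp
    rw [h2] at h1
    refine h1.congr' ?_
    filter_upwards [self_mem_nhdsWithin, hgpos, hwEs.eventually_const_lt hpos] with s hs hgs hws
    have hq : √(s - s₀) ≠ 0 := (Real.sqrt_pos.2 (sub_pos.2 hs)).ne'
    simp only [Pi.div_apply]
    rw [div_eq_iff hws.ne', map_smul, smul_eq_mul, hwE s hs]
    field_simp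
  refine ⟨B, U s₀ - B * Q21 s₀ * B, fun i j => mul_pos hρpos (hVpos i j), hΔB, ?_, by abel, hLB⟩
  -- `K Φ + Φ D = U - g E`, where `g E` tends to `(ρ / 2) (2 ρ) N = B Q₂₁ B`
  have h1 := hUt.sub (hgs.smul hEs)
  have h2 : (ρ / 2) • (2 * ρ) • N = B * Q21 s₀ * B := by
    rw [hBQB, smul_smul]; congr 1; ring
  rw [h2] at h1
  refine h1.congr' ?_
  filter_upwards [self_mem_nhdsWithin, hgpos] with s hs hgs
  have hq : √(s - s₀) ≠ 0 := (Real.sqrt_pos.2 (sub_pos.2 hs)).ne'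
  have h3 := congrArg (fun X => -(g s • X)) (hLG s hs)
  have h4 : g s • G s = -Φ s := by
    rw [hGdef]
    simp only
    rw [smul_smul, mul_inv_cancel₀ hgs.ne', one_smul]
  simp only [smul_add, smul_sub, smul_smul, mul_inv_cancel₀ hgs.ne', one_smul] at h3
  rw [← Matrix.mul_smul, ← Matrix.smul_mul, h4] at h3
  rw [smul_smul, mul_assoc, mul_inv_cancel₀ hq, mul_one]
  rw [Matrix.mul_neg, Matrix.neg_mul] at h3
  rw [← neg_add, neg_neg] at h3
  rw [h3]
  abel

end Riccati

noncomputable section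

namespace FluidModel

variable {n : ℕ} (M : FluidModel n)

/-! ### First passage to level zero, by number of jumps -/

/-- The positive durations for which phase `a` keeps a level that starts from `y` nonnegative. -/
def durations (a : Fin n) (y : ℝ) : Set ℝ := {t | 0 < t ∧ 0 ≤ y + M.c a * t}

lemma measurableSet_durations (a : Fin n) (y : ℝ) : MeasurableSet (M.durations a y) :=
  (measurableSet_lt measurable_const measurable_id).inter
    (measurableSet_le (f := fun _ : ℝ => (0 : ℝ)) (g := fun t => y + M.c a * t) (by fun_prop)
      (by fun_prop))

/-- The first-jump operator: the process starts in phase `a` at level `y`, holds for a time `t` that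
keeps the level nonnegative, jumps to a phase `b`, and collects `g b` at the level reached, with the
discount `exp (-s t)`. -/
def jumpStep (s : ℝ) (g : Fin n → ℝ → ℝ≥0∞) (a : Fin n) (y : ℝ) : ℝ≥0∞ :=
  ∫⁻ t in M.durations a y, ENNReal.ofReal (Real.exp (-((M.rate a + s) * t))) *
    ∑ b ∈ Finset.univ.erase a, ENNReal.ofReal (M.T a b) * g b (y + M.c a * t)

/-- The discounted weight `E[exp (-s τ); r jumps before τ, phase j at τ]` of the first passage time
`τ` of the level to `0`, when the process starts in phase `a` at level `y`. -/
def passage (s : ℝ) (j : Fin n) : ℕ → Fin n → ℝ → ℝ≥0∞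
  | 0 => fun a y => if a = j ∧ M.c a < 0 then
      ENNReal.ofReal (Real.exp (-((M.rate a + s) * (y / |M.c a|)))) else 0
  | r + 1 => M.jumpStep s (passage s j r)

/-- The discounted weight of the first passage to level `0` in phase `j`. -/
def passageLST (s : ℝ) (a j : Fin n) (y : ℝ) : ℝ≥0∞ := ∑' r, M.passage s j r a y

variable {M}

lemma measurable_jumpStep {s : ℝ} {g : Fin n → ℝ → ℝ≥0∞} (hg : ∀ b, Measurable (g b))
    (a : Fin n) : Measurable (M.jumpStep s g a) := by
  have h1 : ∀ y, M.jumpStep s g a y = ∫⁻ t, ({p : ℝ × ℝ | 0 < p.2 ∧ 0 ≤ p.1 + M.c a * p.2}).indicator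
      (fun p => ENNReal.ofReal (Real.exp (-((M.rate a + s) * p.2))) *
        ∑ b ∈ Finset.univ.erase a, ENNReal.ofReal (M.T a b) * g b (p.1 + M.c a * p.2)) (y, t) := by
    intro y
    rw [jumpStep, ← lintegral_indicator (M.measurableSet_durations a y)]
    rfl
  rw [funext h1]
  refine Measurable.lintegral_prod_right' (f := ({p : ℝ × ℝ | 0 < p.2 ∧ 0 ≤ p.1 + M.c a * p.2}).indicator
      (fun p => ENNReal.ofReal (Real.exp (-((M.rate a + s) * p.2))) *
        ∑ b ∈ Finset.univ.erase a, ENNReal.ofReal (M.T a b) * g b (p.1 + M.c a * p.2)))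
    (Measurable.indicator ?_ ?_)
  · refine Measurable.mul (by fun_prop) (Finset.measurable_sum _ fun b _ => ?_)
    exact ((hg b).comp (by fun_prop)).const_mul _
  · exact (measurableSet_lt measurable_const measurable_snd).inter
      (measurableSet_le (f := fun _ : ℝ × ℝ => (0 : ℝ)) (g := fun p => p.1 + M.c a * p.2)
        (by fun_prop) (by fun_prop))

lemma measurable_passage (s : ℝ) (j : Fin n) (r : ℕ) (a : Fin n) :
    Measurable (M.passage s j r a) := by
  induction r generalizing a with
  | zero =>
    by_cases h : a = j ∧ M.c a < 0
    · simp only [passage, if_pos h]; fun_prop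
    · simp only [passage, if_neg h]; fun_prop
  | succ r ih => exact measurable_jumpStep ih a

lemma measurable_passageLST (s : ℝ) (a j : Fin n) : Measurable (M.passageLST s a j) :=
  Measurable.tsum fun r => measurable_passage s j r a

lemma jumpStep_congr {s : ℝ} {g g' : Fin n → ℝ → ℝ≥0∞} (h : ∀ b y, 0 ≤ y → g b y = g' b y)
    (a : Fin n) (y : ℝ) : M.jumpStep s g a y = M.jumpStep s g' a y :=
  setLIntegral_congr_fun (M.measurableSet_durations a y) fun t ht => by
    have h1 : ∀ b, g b (y + M.c a * t) = g' b (y + M.c a * t) := fun b => h b _ ht.2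
    simp only [h1]

lemma jumpStep_mono {s : ℝ} {g g' : Fin n → ℝ → ℝ≥0∞} (h : ∀ b y, 0 ≤ y → g b y ≤ g' b y)
    (a : Fin n) (y : ℝ) : M.jumpStep s g a y ≤ M.jumpStep s g' a y :=
  setLIntegral_mono' (M.measurableSet_durations a y) fun t ht => by
    gcongr with b _
    exact h b _ ht.2

lemma measurable_jumpStep_integrand {s : ℝ} {g : Fin n → ℝ → ℝ≥0∞} (hg : ∀ b, Measurable (g b))
    (a : Fin n) (y : ℝ) : Measurable fun t => ENNReal.ofReal (Real.exp (-((M.rate a + s) * t))) *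
    ∑ b ∈ Finset.univ.erase a, ENNReal.ofReal (M.T a b) * g b (y + M.c a * t) :=
  Measurable.mul (by fun_prop) (Finset.measurable_sum _ fun b _ =>
    ((hg b).comp (by fun_prop)).const_mul _)

lemma jumpStep_tsum {s : ℝ} {g : ℕ → Fin n → ℝ → ℝ≥0∞} (hg : ∀ r b, Measurable (g r b))
    (a : Fin n) (y : ℝ) :
    M.jumpStep s (fun b z => ∑' r, g r b z) a y = ∑' r, M.jumpStep s (g r) a y := by
  simp only [jumpStep]
  rw [← lintegral_tsum fun r => (measurable_jumpStep_integrand (hg r) a y).aemeasurable]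
  refine lintegral_congr fun t => ?_
  rw [ENNReal.tsum_mul_left]
  congr 1
  rw [Summable.tsum_finsetSum fun _ _ => ENNReal.summable]
  exact Finset.sum_congr rfl fun b _ => ENNReal.tsum_mul_left.symm

lemma jumpStep_sum_mul {κ : Type*} {s : ℝ} {g : κ → Fin n → ℝ → ℝ≥0∞} (S : Finset κ)
    (hg : ∀ r b, Measurable (g r b)) (w : κ → ℝ≥0∞) (a : Fin n) (y : ℝ) :
    M.jumpStep s (fun b z => ∑ k ∈ S, g k b z * w k) a y = ∑ k ∈ S, M.jumpStep s (g k) a y * w k := by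
  simp only [jumpStep]
  rw [← Finset.sum_congr rfl fun k _ =>
    lintegral_mul_const (w k) (measurable_jumpStep_integrand (hg k) a y),
    ← lintegral_finsetSum _ fun k _ => (measurable_jumpStep_integrand (hg k) a y).mul_const _]
  refine lintegral_congr fun t => ?_
  simp only [Finset.mul_sum, Finset.sum_mul]
  rw [Finset.sum_comm]
  exact Finset.sum_congr rfl fun k _ => Finset.sum_congr rfl fun b _ => by ring

lemma jumpStep_add_of_nonneg {s : ℝ} {g : Fin n → ℝ → ℝ≥0∞} {a : Fin n} (ha : 0 ≤ M.c a) {x y : ℝ}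
    (hx : 0 ≤ x) (hy : 0 ≤ y) :
    M.jumpStep s g a (x + y) = M.jumpStep s (fun b z => g b (z + y)) a x := by
  have h1 : ∀ z, 0 ≤ z → M.durations a z = Set.Ioi 0 := fun z hz => by
    ext t
    exact ⟨fun h => h.1, fun h => ⟨h, add_nonneg hz (mul_nonneg ha (le_of_lt h))⟩⟩
  simp only [jumpStep]
  rw [h1 x hx, h1 (x + y) (add_nonneg hx hy)]
  refine lintegral_congr fun t => ?_
  rw [show x + y + M.c a * t = x + M.c a * t + y by ring]

/-- From a phase in which the level decreases, the first jump takes place either before the level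
has decreased by `x`, or afterwards. -/
lemma jumpStep_add_of_neg {s : ℝ} {g : Fin n → ℝ → ℝ≥0∞} {a : Fin n} (ha : M.c a < 0) {x y : ℝ}
    (hx : 0 ≤ x) (hy : 0 ≤ y) :
    M.jumpStep s g a (x + y) = M.jumpStep s (fun b z => g b (z + y)) a x +
      ENNReal.ofReal (Real.exp (-((M.rate a + s) * (x / |M.c a|)))) * M.jumpStep s g a y := by
  set τ := x / |M.c a| with hτ
  have hτ0 : 0 ≤ τ := div_nonneg hx (abs_nonneg _)
  have hcτ : M.c a * τ = -x := by
    rw [hτ, abs_of_neg ha]; field_simp [ha.ne]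
  have hiff : ∀ t, 0 ≤ x + M.c a * t ↔ t ≤ τ := fun t => by
    rw [hτ, abs_of_neg ha, le_div_iff₀ (neg_pos.2 ha)]
    constructor <;> intro h <;> linarith
  -- after the time `τ` the level has decreased by `x`, and the process starts afresh from `y`
  have hU : M.durations a (x + y) = M.durations a x ∪ (fun t => -τ + t) ⁻¹' M.durations a y := by
    ext t
    simp only [durations, Set.mem_ofPred_eq, Set.mem_union, Set.mem_preimage, hiff]
    rw [show y + M.c a * (-τ + t) = x + y + M.c a * t by rw [mul_add, mul_neg, hcτ]; ring]
    constructor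
    · rintro ⟨h0, h1⟩
      by_cases h : t ≤ τ
      · exact .inl ⟨h0, h⟩
      · exact .inr ⟨by linarith [not_le.1 h], h1⟩
    · rintro (⟨h0, h1⟩ | ⟨h0, h1⟩)
      · exact ⟨h0, by linarith [(hiff t).2 h1]⟩
      · exact ⟨by linarith, h1⟩
  have hdisj : Disjoint (M.durations a x) ((fun t => -τ + t) ⁻¹' M.durations a y) := by
    rw [Set.disjoint_left]
    intro t h1 h2
    have h3 := (hiff t).1 h1.2
    have h4 : 0 < -τ + t := h2.1
    linarith
  have hms : MeasurableSet ((fun t => -τ + t) ⁻¹' M.durations a y) :=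
    (M.measurableSet_durations a y).preimage (by fun_prop)
  simp only [jumpStep]
  rw [hU, lintegral_union hms hdisj]
  congr 1
  · refine lintegral_congr fun t => ?_
    rw [show x + y + M.c a * t = x + M.c a * t + y by ring]
  · rw [← lintegral_indicator hms, ← lintegral_indicator (M.measurableSet_durations a y),
      ← lintegral_const_mul' _ _ ENNReal.ofReal_ne_top, ← lintegral_add_left_eq_self _ τ]
    refine lintegral_congr fun t => ?_
    by_cases h : t ∈ M.durations a y
    · rw [Set.indicator_of_mem h, Set.indicator_of_mem
        (show τ + t ∈ (fun t => -τ + t) ⁻¹' M.durations a y by simpa using h), ← mul_assoc,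
        ← ENNReal.ofReal_mul (Real.exp_pos _).le, ← Real.exp_add]
      rw [show x + y + M.c a * (τ + t) = y + M.c a * t by rw [mul_add, hcτ]; ring,
        show -((M.rate a + s) * (τ + t)) = -((M.rate a + s) * τ) + -((M.rate a + s) * t) by ring]
    · rw [Set.indicator_of_notMem h, Set.indicator_of_notMem
        (show τ + t ∉ (fun t => -τ + t) ⁻¹' M.durations a y by simpa using h), mul_zero]

lemma passage_zero_of_neg {s : ℝ} {a : Fin n} (ha : M.c a < 0) (y : ℝ) :
    M.passage s a 0 a y = ENNReal.ofReal (Real.exp (-((M.rate a + s) * (y / |M.c a|)))) := by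
  simp [passage, ha]

lemma passage_zero_of_nonneg {s : ℝ} {a : Fin n} (ha : 0 ≤ M.c a) (j : Fin n) (y : ℝ) :
    M.passage s j 0 a y = 0 := by
  simp [passage, ha.not_gt]

lemma passage_zero_of_ne {s : ℝ} {a j : Fin n} (h : a ≠ j) (y : ℝ) : M.passage s j 0 a y = 0 := by
  simp [passage, h]

lemma passage_succ (s : ℝ) (j : Fin n) (r : ℕ) (a : Fin n) (y : ℝ) :
    M.passage s j (r + 1) a y = M.jumpStep s (M.passage s j r) a y := rfl

/-- The level decreases continuously, so a passage from `x + y` to `0` with `r` jumps splits, when the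
level is first `y`, into passages whose jumps add up to `r`. -/
lemma passage_add (s : ℝ) (j : Fin n) (r : ℕ) (a : Fin n) {x y : ℝ} (hx : 0 ≤ x) (hy : 0 ≤ y) :
    M.passage s j r a (x + y) = ∑ l, ∑ p ∈ Finset.HasAntidiagonal.antidiagonal r,
      M.passage s l p.1 a x * M.passage s j p.2 l y := by
  induction r generalizing a x with
  | zero =>
    simp only [Finset.Nat.antidiagonal_zero, Finset.sum_singleton]
    rw [Finset.sum_eq_single a (fun l _ h => by rw [passage_zero_of_ne h.symm, zero_mul])
      (fun h => absurd (Finset.mem_univ a) h)]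
    by_cases ha : M.c a < 0
    · by_cases hj : a = j
      · subst hj
        rw [passage_zero_of_neg ha, passage_zero_of_neg ha, passage_zero_of_neg ha,
          ← ENNReal.ofReal_mul (Real.exp_pos _).le, ← Real.exp_add]
        congr 2; ring
      · rw [passage_zero_of_ne hj, passage_zero_of_ne hj, mul_zero]
    · rw [passage_zero_of_nonneg (not_lt.1 ha), passage_zero_of_nonneg (not_lt.1 ha), zero_mul]
  | succ r ih =>
    have hstep : M.jumpStep s (fun b z => M.passage s j r b (z + y)) a x =
        ∑ l, ∑ p ∈ Finset.HasAntidiagonal.antidiagonal r, M.passage s l (p.1 + 1) a x * M.passage s j p.2 l y := by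
      rw [jumpStep_congr (fun b z hz => ih b hz)]
      simp only [← Finset.sum_product']
      rw [jumpStep_sum_mul (g := fun (k : Fin n × ℕ × ℕ) => M.passage s k.1 k.2.1) _
        (fun k b => measurable_passage _ _ _ _)
        (fun k => M.passage s j k.2.2 k.1 y)]
      rfl
    simp only [Finset.Nat.sum_antidiagonal_succ, Finset.sum_add_distrib]
    rw [← hstep, passage_succ]
    by_cases ha : M.c a < 0
    · rw [jumpStep_add_of_neg ha hx hy, add_comm, Finset.sum_eq_single a
        (fun l _ h => by rw [passage_zero_of_ne h.symm, zero_mul])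
        (fun h => absurd (Finset.mem_univ a) h), passage_zero_of_neg ha]
      rfl
    · rw [jumpStep_add_of_nonneg (not_lt.1 ha) hx hy]
      simp [passage_zero_of_nonneg (not_lt.1 ha)]

/-- To reach level `0` from level `x + y`, the process first has to reach level `y`. -/
lemma passageLST_add (s : ℝ) (a j : Fin n) {x y : ℝ} (hx : 0 ≤ x) (hy : 0 ≤ y) :
    M.passageLST s a j (x + y) = ∑ l, M.passageLST s a l x * M.passageLST s l j y := by
  have hconv : ∀ u v : ℕ → ℝ≥0∞, ∑' r, ∑ p ∈ Finset.HasAntidiagonal.antidiagonal r, u p.1 * v p.2 =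
      (∑' r, u r) * ∑' r, v r := by
    intro u v
    calc ∑' r, ∑ p ∈ Finset.HasAntidiagonal.antidiagonal r, u p.1 * v p.2
        = ∑' r, ∑' p : Finset.HasAntidiagonal.antidiagonal r, u p.1.1 * v p.1.2 :=
          tsum_congr fun r => ((Finset.HasAntidiagonal.antidiagonal r).tsum_subtype (fun p => u p.1 * v p.2)).symm
      _ = ∑' q : (Σ r, Finset.HasAntidiagonal.antidiagonal r), u q.2.1.1 * v q.2.1.2 :=
          (ENNReal.tsum_sigma' (f := fun q : (Σ r, Finset.HasAntidiagonal.antidiagonal r) =>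
            u q.2.1.1 * v q.2.1.2)).symm
      _ = ∑' p : ℕ × ℕ, u p.1 * v p.2 :=
          (Finset.HasAntidiagonal.sigmaAntidiagonalEquivProd (A := ℕ)).tsum_eq (fun p : ℕ × ℕ => u p.1 * v p.2)
      _ = ∑' p, ∑' q, u p * v q := ENNReal.tsum_prod' (f := fun p : ℕ × ℕ => u p.1 * v p.2)
      _ = _ := by simp_rw [ENNReal.tsum_mul_left, ENNReal.tsum_mul_right]
  simp only [passageLST, passage_add s j _ a hx hy]
  rw [Summable.tsum_finsetSum fun _ _ => ENNReal.summable]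
  exact Finset.sum_congr rfl fun l _ =>
    hconv (fun r => M.passage s l r a x) fun r => M.passage s j r l y

/-- The first-jump equation. -/
lemma passageLST_eq (s : ℝ) (a j : Fin n) (y : ℝ) :
    M.passageLST s a j y = M.passage s j 0 a y + M.jumpStep s (fun b => M.passageLST s b j) a y := by
  have h := jumpStep_tsum (M := M) (s := s) (g := fun r => M.passage s j r)
    (fun r b => measurable_passage s j r b) a y
  rw [passageLST, tsum_eq_zero_add' ENNReal.summable]
  exact congrArg _ h.symm

/-- A supersolution of the first-jump equation dominates the passage weights. -/
lemma sum_passageLST_le {s : ℝ} {u : Fin n → ℝ≥0∞} {g : Fin n → ℝ → ℝ≥0∞}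
    (hg : ∀ a y, 0 ≤ y → ∑ j, M.passage s j 0 a y * u j + M.jumpStep s g a y ≤ g a y)
    (a : Fin n) {y : ℝ} (hy : 0 ≤ y) : ∑ j, M.passageLST s a j y * u j ≤ g a y := by
  -- induction on the number of jumps taken into account
  have hN : ∀ N a y, 0 ≤ y → ∑ j, ∑ r ∈ Finset.range N, M.passage s j r a y * u j ≤ g a y := by
    intro N
    induction N with
    | zero => intro a y _; simp
    | succ N ih =>
      intro a y hy
      refine le_trans ?_ (hg a y hy)
      simp only [Finset.sum_range_succ', Finset.sum_add_distrib]
      rw [add_comm]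
      gcongr
      refine le_trans (le_of_eq ?_) (jumpStep_mono ih a y)
      simp only [← Finset.sum_product']
      rw [jumpStep_sum_mul (g := fun (k : Fin n × ℕ) => M.passage s k.1 k.2) _
        (fun k b => measurable_passage _ _ _ _) (fun k => u k.1)]
      rfl
  simp only [passageLST, ← ENNReal.tsum_mul_right]
  rw [← Summable.tsum_finsetSum fun _ _ => ENNReal.summable]
  refine ENNReal.tsum_le_of_sum_range_le fun N => ?_
  rw [Finset.sum_comm]
  exact hN N a y hy

variable (M)

/-! ### The law of the jump chain and its holding times -/

lemma lintegral_expMeasure {r : ℝ} {g : ℝ → ℝ≥0∞} (hg : Measurable g) :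
    ∫⁻ t, g t ∂(expMeasure r) =
      ∫⁻ t in Set.Ioi 0, ENNReal.ofReal (r * Real.exp (-(r * t))) * g t := by
  have hm : Measurable (exponentialPDF r) := by
    unfold exponentialPDF; fun_prop
  have h1 : ∫⁻ t, g t ∂(expMeasure r) = ∫⁻ t, exponentialPDF r t * g t :=
    lintegral_withDensity_eq_lintegral_mul volume hm hg
  rw [h1, ← lintegral_indicator measurableSet_Ioi]
  refine lintegral_congr_ae ?_
  filter_upwards [Measure.ae_ne volume (0 : ℝ)] with t ht
  rcases lt_or_gt_of_ne ht with h | h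
  · rw [Set.indicator_of_notMem (by simpa using h.le), exponentialPDF_of_neg h, zero_mul]
  · rw [Set.indicator_of_mem (by simpa using h), exponentialPDF_of_nonneg h.le]

lemma expMeasure_Ioi {r : ℝ} (hr : 0 < r) {x : ℝ} (hx : 0 ≤ x) :
    expMeasure r (Set.Ioi x) = ENNReal.ofReal (Real.exp (-(r * x))) := by
  have := isProbabilityMeasure_expMeasure hr
  rw [← Set.compl_Iic, prob_compl_eq_one_sub measurableSet_Iic, ← ofReal_cdf, cdf_expMeasure_eq hr,
    if_pos hx, ← ENNReal.ofReal_one, ← ENNReal.ofReal_sub]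
  · congr 1; ring
  · rw [sub_nonneg, Real.exp_le_one_iff, neg_nonpos]; positivity

lemma expMeasure_absolutelyContinuous (r : ℝ) : expMeasure r ≪ volume :=
  withDensity_absolutelyContinuous _ _

lemma ae_expMeasure_pos {r : ℝ} : ∀ᵐ t ∂(expMeasure r), 0 < t := by
  rw [ae_iff, ← lintegral_indicator_one (by measurability), lintegral_expMeasure
    (measurable_one.indicator (by measurability))]
  refine setLIntegral_eq_zero measurableSet_Ioi fun t ht => ?_
  rw [Set.indicator_of_notMem (by simpa using ht), mul_zero]
  rfl

lemma lintegral_jumpMeasure (a : Fin n) {F : Fin n × ℝ → ℝ≥0∞} (hF : Measurable F) :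
    ∫⁻ z, F z ∂(M.jumpMeasure a) = ∑ b ∈ Finset.univ.erase a,
      ENNReal.ofReal (M.T a b / M.rate a) * ∫⁻ t, F (b, t) ∂(expMeasure (M.rate b)) := by
  have hp : ∀ j, IsProbabilityMeasure (expMeasure (M.rate j)) := fun j =>
    isProbabilityMeasure_expMeasure (M.rate_pos j)
  rw [jumpMeasure, lintegral_finsetSum_measure]
  refine Finset.sum_congr rfl fun b _ => ?_
  rw [lintegral_smul_measure, lintegral_prod _ hF.aemeasurable, lintegral_dirac' _
    (Measurable.lintegral_prod_right' hF), smul_eq_mul]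

lemma ae_jumpMeasure (a : Fin n) {p : Fin n × ℝ → Prop} (hp : MeasurableSet {z | p z})
    (h : ∀ b, ∀ᵐ t ∂(expMeasure (M.rate b)), p (b, t)) : ∀ᵐ z ∂(M.jumpMeasure a), p z := by
  have hpc : MeasurableSet {z | ¬ p z} := hp.compl
  rw [ae_iff, ← lintegral_indicator_one hpc, lintegral_jumpMeasure _ _
    (measurable_one.indicator hpc)]
  refine Finset.sum_eq_zero fun b _ => ?_
  have h0 : ∫⁻ t, {z | ¬ p z}.indicator 1 (b, t) ∂(expMeasure (M.rate b)) = ∫⁻ _, (0 : ℝ≥0∞)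
      ∂(expMeasure (M.rate b)) := lintegral_congr_ae <| by
    filter_upwards [h b] with t ht
    exact Set.indicator_of_notMem (by simpa using ht) _
  rw [h0, lintegral_zero, mul_zero]

instance isProbabilityMeasure_pathLaw (i : Fin n) : IsProbabilityMeasure (M.pathLaw i) := by
  have : IsProbabilityMeasure (expMeasure (M.rate i)) :=
    isProbabilityMeasure_expMeasure (M.rate_pos i)
  unfold pathLaw
  infer_instance

lemma pathLaw_map_eval_zero (i : Fin n) : (M.pathLaw i).map (fun ω => ω 0) =
    (Measure.dirac i).prod (expMeasure (M.rate i)) := by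
  have : IsProbabilityMeasure (expMeasure (M.rate i)) :=
    isProbabilityMeasure_expMeasure (M.rate_pos i)
  have h0 : (fun ω : ℕ → Fin n × ℝ => ω 0) =
      (fun h : (Π _ : Finset.Iic 0, Fin n × ℝ) => h ⟨0, Finset.mem_Iic.mpr le_rfl⟩) ∘
        (Preorder.frestrictLe 0) := rfl
  rw [h0, ← Measure.map_map (by fun_prop) (by fun_prop), pathLaw, Kernel.trajMeasure,
    Measure.map_comp _ _ (by fun_prop), Kernel.traj_map_frestrictLe, Kernel.partialTraj_self,
    Measure.id_comp, Measure.map_map (by fun_prop) (by fun_prop)]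
  exact Measure.map_id

/-- The Markov property, for functionals `F ω z` that depend on `ω` only up to index `k`. -/
lemma lintegral_pathLaw_succ (i : Fin n) (k : ℕ) {F : (ℕ → Fin n × ℝ) × (Fin n × ℝ) → ℝ≥0∞}
    (hF : Measurable F) (hdep : ∀ ω ω' z, (∀ m ≤ k, ω m = ω' m) → F (ω, z) = F (ω', z)) :
    ∫⁻ ω, F (ω, ω (k + 1)) ∂(M.pathLaw i) =
      ∫⁻ ω, ∫⁻ z, F (ω, z) ∂(M.jumpMeasure (ω k).1) ∂(M.pathLaw i) := by
  have : IsProbabilityMeasure (expMeasure (M.rate i)) :=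
    isProbabilityMeasure_expMeasure (M.rate_pos i)
  -- `ext` completes an initial segment to a path; `F` does not see the completion
  let ext : (Π _ : Finset.Iic k, Fin n × ℝ) → ℕ → Fin n × ℝ := fun h m =>
    if hm : m ≤ k then h ⟨m, Finset.mem_Iic.mpr hm⟩ else (i, 0)
  have hext : Measurable ext := by
    refine measurable_pi_lambda _ fun m => ?_
    by_cases hm : m ≤ k
    · simp only [ext, hm, dif_pos]; fun_prop
    · simp only [ext, hm, dif_neg, not_false_eq_true]; fun_prop
  have hFe : ∀ ω z, F (ext (Preorder.frestrictLe k ω), z) = F (ω, z) := fun ω z =>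
    hdep _ _ _ fun m hm => by simp [ext, hm, Preorder.frestrictLe]
  let G : (Π _ : Finset.Iic k, Fin n × ℝ) × (Fin n × ℝ) → ℝ≥0∞ := fun p => F (ext p.1, p.2)
  have hG : Measurable G := hF.comp (by fun_prop)
  have hmap := Kernel.map_frestrictLe_trajMeasure_compProd_eq_map_trajMeasure
    (X := fun _ => Fin n × ℝ) (μ₀ := (Measure.dirac i).prod (expMeasure (M.rate i)))
    (κ := M.stepKernel) (a := k)
  have h1 := congrArg (fun μ => ∫⁻ p, G p ∂μ) hmap
  rw [Measure.lintegral_compProd hG, lintegral_map hG (by fun_prop),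
    lintegral_map (by exact hG.lintegral_kernel_prod_right') (by fun_prop)] at h1
  simp only [G, hFe] at h1
  exact h1.symm

/-! ### The law of the first return time -/

/-- The level at the `k`-th jump time, started from `0`, without reflection at `0`. -/
def freeLevel (ω : ℕ → Fin n × ℝ) (k : ℕ) : ℝ := ∑ m ∈ Finset.range k, M.c (ω m).1 * (ω m).2

/-- The paths on which the free level becomes negative during the holding time number `r`, for the
first time, in phase `j`. -/
def crossing (j : Fin n) (r : ℕ) : Set (ℕ → Fin n × ℝ) :=
  {ω | (∀ m ≤ r, 0 ≤ M.freeLevel ω m) ∧ (ω r).1 = j ∧ M.c j < 0 ∧ M.freeLevel ω (r + 1) < 0}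

/-- The time at which the free level is `0` on the paths in `crossing j r`. -/
def crossTime (j : Fin n) (r : ℕ) (ω : ℕ → Fin n × ℝ) : ℝ :=
  jumpTime ω r + M.freeLevel ω r / |M.c j|

/-- The discounted weight of a first passage to level `0` from level `y`, as in `passage`, given
the current pair `z` of phase and holding time. -/
def holdWeight (s : ℝ) (j : Fin n) : ℕ → Fin n × ℝ → ℝ → ℝ≥0∞
  | 0 => fun z y => if z.1 = j ∧ M.c j < 0 ∧ y + M.c z.1 * z.2 < 0 then
      ENNReal.ofReal (Real.exp (-(s * (y / |M.c j|)))) else 0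
  | r + 1 => fun z y => if 0 ≤ y + M.c z.1 * z.2 then
      ENNReal.ofReal (Real.exp (-(s * z.2))) *
        ∫⁻ z', holdWeight s j r z' (y + M.c z.1 * z.2) ∂(M.jumpMeasure z.1) else 0

/-- The discount at the `k`-th jump on the paths whose free level has not been negative. -/
def aliveWeight (s : ℝ) (k : ℕ) (ω : ℕ → Fin n × ℝ) : ℝ≥0∞ :=
  {ω | ∀ m ≤ k, 0 ≤ M.freeLevel ω m}.indicator
    (fun ω => ENNReal.ofReal (Real.exp (-(s * jumpTime ω k)))) ω

variable {M}

lemma freeLevel_zero (ω : ℕ → Fin n × ℝ) : M.freeLevel ω 0 = 0 := by simp [freeLevel]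

lemma freeLevel_succ (ω : ℕ → Fin n × ℝ) (k : ℕ) :
    M.freeLevel ω (k + 1) = M.freeLevel ω k + M.c (ω k).1 * (ω k).2 := Finset.sum_range_succ _ _

lemma jumpTime_zero (ω : ℕ → Fin n × ℝ) : jumpTime ω 0 = 0 := by simp [jumpTime]

lemma jumpTime_succ (ω : ℕ → Fin n × ℝ) (k : ℕ) :
    jumpTime ω (k + 1) = jumpTime ω k + (ω k).2 := Finset.sum_range_succ _ _

lemma measurable_c_fst : Measurable fun z : Fin n × ℝ => M.c z.1 :=
  (measurable_of_countable M.c).comp measurable_fst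

lemma measurable_freeLevel (k : ℕ) : Measurable fun ω => M.freeLevel ω k := by
  unfold freeLevel
  refine Finset.measurable_sum _ fun m _ => ?_
  exact (measurable_c_fst.comp (measurable_pi_apply m)).mul
    (measurable_snd.comp (measurable_pi_apply m))

lemma measurable_jumpTime (k : ℕ) : Measurable fun ω : ℕ → Fin n × ℝ => jumpTime ω k := by
  unfold jumpTime
  exact Finset.measurable_sum _ fun m _ => measurable_snd.comp (measurable_pi_apply m)

lemma measurable_crossTime (j : Fin n) (r : ℕ) : Measurable (M.crossTime j r) :=
  (measurable_jumpTime r).add ((measurable_freeLevel r).div_const _)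

lemma measurableSet_alive (k : ℕ) :
    MeasurableSet {ω : ℕ → Fin n × ℝ | ∀ m ≤ k, 0 ≤ M.freeLevel ω m} := by
  have : {ω : ℕ → Fin n × ℝ | ∀ m ≤ k, 0 ≤ M.freeLevel ω m} =
      ⋂ m, ⋂ (_ : m ≤ k), {ω | 0 ≤ M.freeLevel ω m} := by ext; simp
  rw [this]
  exact MeasurableSet.iInter fun m => MeasurableSet.iInter fun _ =>
    measurableSet_le measurable_const (measurable_freeLevel m)

lemma measurableSet_crossing (j : Fin n) (r : ℕ) : MeasurableSet (M.crossing j r) := by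
  refine (measurableSet_alive r).inter (MeasurableSet.inter ?_ (MeasurableSet.inter ?_ ?_))
  · exact (measurable_fst.comp (measurable_pi_apply r)) (measurableSet_singleton j)
  · exact MeasurableSet.const _
  · exact measurableSet_lt (measurable_freeLevel (r + 1)) measurable_const

lemma measurable_aliveWeight (s : ℝ) (k : ℕ) : Measurable (M.aliveWeight s k) :=
  Measurable.indicator (by have := measurable_jumpTime (n := n) k; fun_prop) (measurableSet_alive k)

lemma measurable_holdWeight (s : ℝ) (j : Fin n) (r : ℕ) :
    Measurable fun p : (Fin n × ℝ) × ℝ => M.holdWeight s j r p.1 p.2 := by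
  have hc : Measurable fun p : (Fin n × ℝ) × ℝ => p.2 + M.c p.1.1 * p.1.2 :=
    measurable_snd.add ((measurable_c_fst.comp measurable_fst).mul
      (measurable_snd.comp measurable_fst))
  induction r with
  | zero =>
    simp only [holdWeight]
    refine Measurable.ite (MeasurableSet.inter ?_ (MeasurableSet.inter ?_ ?_)) (by fun_prop)
      measurable_const
    · exact (measurable_fst.comp measurable_fst) (measurableSet_singleton j)
    · exact MeasurableSet.const _
    · exact measurableSet_lt hc measurable_const
  | succ r ih =>
    simp only [holdWeight]
    refine Measurable.ite (measurableSet_le measurable_const hc) (Measurable.mul (by fun_prop) ?_)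
      measurable_const
    have h1 : Measurable fun q : Fin n × ℝ => ∫⁻ z', M.holdWeight s j r z' q.2 ∂(M.jumpMeasure q.1) :=
      measurable_from_prod_countable_right fun a =>
        Measurable.lintegral_prod_left' (μ := M.jumpMeasure a) ih
    exact h1.comp ((measurable_fst.comp measurable_fst).prodMk hc)

lemma measurable_holdWeight_left (s : ℝ) (j : Fin n) (r : ℕ) (y : ℝ) :
    Measurable fun z => M.holdWeight s j r z y :=
  (measurable_holdWeight s j r).comp (f := fun z => (z, y)) (by fun_prop)

/-- Integrating out the holding time turns `holdWeight` into `passage`. -/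
lemma lintegral_holdWeight (s : ℝ) (j : Fin n) (r : ℕ) (a : Fin n) {y : ℝ} (hy : 0 ≤ y) :
    ∫⁻ t, M.holdWeight s j r (a, t) y ∂(expMeasure (M.rate a)) = M.passage s j r a y := by
  have hq := M.rate_pos a
  induction r generalizing a y with
  | zero =>
    by_cases h : a = j ∧ M.c j < 0
    · obtain ⟨rfl, h⟩ := h
      have hset : {t : ℝ | y + M.c a * t < 0} = Set.Ioi (y / |M.c a|) := by
        ext t
        simp only [Set.mem_ofPred_eq, Set.mem_Ioi]
        rw [abs_of_neg h, div_lt_iff₀ (neg_pos.2 h)]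
        constructor <;> intro h <;> linarith
      have h1 : ∀ t, M.holdWeight s a 0 (a, t) y = (Set.Ioi (y / |M.c a|)).indicator
          (fun _ => ENNReal.ofReal (Real.exp (-(s * (y / |M.c a|))))) t := fun t => by
        rw [← hset]
        by_cases ht : y + M.c a * t < 0
        · rw [Set.indicator_of_mem (by exact ht)]; simp [holdWeight, h, ht]
        · rw [Set.indicator_of_notMem (by exact ht)]; simp [holdWeight, ht]
      simp only [h1]
      rw [lintegral_indicator measurableSet_Ioi, setLIntegral_const,
        expMeasure_Ioi hq (div_nonneg hy (abs_nonneg _)), passage_zero_of_neg h,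
        ← ENNReal.ofReal_mul (Real.exp_pos _).le, ← Real.exp_add]
      congr 2; ring
    · have h1 : ∀ t, M.holdWeight s j 0 (a, t) y = 0 := fun t => by
        simp only [holdWeight]
        exact if_neg fun h' => h ⟨h'.1, h'.2.1⟩
      simp only [h1, lintegral_zero]
      refine (if_neg ?_).symm
      rintro ⟨rfl, h'⟩
      exact h ⟨rfl, h'⟩
  | succ r ih =>
    have hm : Measurable fun t => M.holdWeight s j (r + 1) (a, t) y :=
      (measurable_holdWeight s j (r + 1)).comp (f := fun t : ℝ => ((a, t), y)) (by fun_prop)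
    rw [lintegral_expMeasure hm, passage_succ, jumpStep, ← lintegral_indicator measurableSet_Ioi,
      ← lintegral_indicator (M.measurableSet_durations a y)]
    refine lintegral_congr fun t => ?_
    by_cases ht : t ∈ M.durations a y
    · rw [Set.indicator_of_mem ht, Set.indicator_of_mem (by exact ht.1)]
      simp only [holdWeight, if_pos ht.2]
      rw [lintegral_jumpMeasure _ _ (measurable_holdWeight_left s j r _),
        ← mul_assoc,
        ← ENNReal.ofReal_mul (by positivity)]
      rw [Finset.mul_sum, Finset.mul_sum]
      refine Finset.sum_congr rfl fun b hb => ?_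
      rw [ih b ht.2 (M.rate_pos b), ← mul_assoc, ← mul_assoc,
        ← ENNReal.ofReal_mul (by positivity), ← ENNReal.ofReal_mul (by positivity)]
      congr 2
      rw [show -((M.rate a + s) * t) = -(M.rate a * t) + -(s * t) by ring, Real.exp_add]
      field_simp
    · rw [Set.indicator_of_notMem ht]
      by_cases h0 : 0 < t
      · rw [Set.indicator_of_mem (by exact h0)]
        simp only [holdWeight]
        rw [if_neg fun h => ht ⟨h0, h⟩, mul_zero]
      · rw [Set.indicator_of_notMem (by exact h0)]

lemma freeLevel_congr {ω ω' : ℕ → Fin n × ℝ} {k : ℕ} (h : ∀ m < k, ω m = ω' m) :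
    M.freeLevel ω k = M.freeLevel ω' k :=
  Finset.sum_congr rfl fun m hm => by rw [h m (Finset.mem_range.1 hm)]

lemma jumpTime_congr {ω ω' : ℕ → Fin n × ℝ} {k : ℕ} (h : ∀ m < k, ω m = ω' m) :
    jumpTime ω k = jumpTime ω' k :=
  Finset.sum_congr rfl fun m hm => by rw [h m (Finset.mem_range.1 hm)]

lemma aliveWeight_congr {s : ℝ} {ω ω' : ℕ → Fin n × ℝ} {k : ℕ} (h : ∀ m < k, ω m = ω' m) :
    M.aliveWeight s k ω = M.aliveWeight s k ω' := by
  have h1 : ∀ m ≤ k, M.freeLevel ω m = M.freeLevel ω' m := fun m hm =>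
    freeLevel_congr fun l hl => h l (hl.trans_le hm)
  have h2 : (ω ∈ {ω | ∀ m ≤ k, 0 ≤ M.freeLevel ω m}) ↔
      (ω' ∈ {ω | ∀ m ≤ k, 0 ≤ M.freeLevel ω m}) :=
    forall₂_congr fun m hm => by rw [h1 m hm]
  unfold aliveWeight
  by_cases hω : ω ∈ {ω | ∀ m ≤ k, 0 ≤ M.freeLevel ω m}
  · rw [Set.indicator_of_mem hω, Set.indicator_of_mem (h2.1 hω), jumpTime_congr h]
  · rw [Set.indicator_of_notMem hω, Set.indicator_of_notMem (fun h' => hω (h2.2 h'))]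

/-- One jump of the chain, integrated out by the Markov property. -/
lemma lintegral_aliveWeight_step (i : Fin n) (s : ℝ) (j : Fin n) (k r : ℕ) :
    ∫⁻ ω, M.aliveWeight s k ω * M.holdWeight s j (r + 1) (ω k) (M.freeLevel ω k) ∂(M.pathLaw i) =
      ∫⁻ ω, M.aliveWeight s (k + 1) ω *
        M.holdWeight s j r (ω (k + 1)) (M.freeLevel ω (k + 1)) ∂(M.pathLaw i) := by
  have hm : Measurable fun p : (ℕ → Fin n × ℝ) × (Fin n × ℝ) =>
      M.aliveWeight s (k + 1) p.1 * M.holdWeight s j r p.2 (M.freeLevel p.1 (k + 1)) :=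
    ((measurable_aliveWeight s (k + 1)).comp measurable_fst).mul
      ((measurable_holdWeight s j r).comp
        (measurable_snd.prodMk ((measurable_freeLevel (k + 1)).comp measurable_fst)))
  rw [lintegral_pathLaw_succ M i k hm fun ω ω' z h => by
    have h' : ∀ m < k + 1, ω m = ω' m := fun m hm => h m (Nat.lt_succ_iff.1 hm)
    simp only
    rw [aliveWeight_congr h', freeLevel_congr h']]
  refine lintegral_congr fun ω => ?_
  simp only
  rw [lintegral_const_mul _ (measurable_holdWeight_left s j r _)]
  simp only [holdWeight, aliveWeight]
  rw [← freeLevel_succ]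
  by_cases hk : ∀ m ≤ k, 0 ≤ M.freeLevel ω m
  · by_cases hk1 : 0 ≤ M.freeLevel ω (k + 1)
    · rw [Set.indicator_of_mem (by exact hk), if_pos hk1, Set.indicator_of_mem, ← mul_assoc,
        ← ENNReal.ofReal_mul (Real.exp_pos _).le, ← Real.exp_add, jumpTime_succ]
      · congr 3; ring
      · intro m hm
        rcases Nat.le_succ_iff.1 hm with h | h
        · exact hk m h
        · rw [h]; exact hk1
    · rw [if_neg hk1, mul_zero, Set.indicator_of_notMem
        (by exact fun h => hk1 (h _ le_rfl)), zero_mul]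
  · rw [Set.indicator_of_notMem (by exact hk), zero_mul, Set.indicator_of_notMem
      (by exact fun h => hk fun m hm => h m (hm.trans (Nat.le_succ k))), zero_mul]

/-- The weight of the paths in `crossing j r` is `passage` with `r` jumps. -/
lemma lintegral_crossing (i : Fin n) (s : ℝ) (j : Fin n) (r : ℕ) :
    ∫⁻ ω in M.crossing j r, ENNReal.ofReal (Real.exp (-s * M.crossTime j r ω)) ∂(M.pathLaw i) =
      M.passage s j r i 0 := by
  have hiter : ∀ r k, ∫⁻ ω, M.aliveWeight s k ω * M.holdWeight s j r (ω k) (M.freeLevel ω k)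
      ∂(M.pathLaw i) = ∫⁻ ω, M.aliveWeight s (k + r) ω *
        M.holdWeight s j 0 (ω (k + r)) (M.freeLevel ω (k + r)) ∂(M.pathLaw i) := by
    intro r
    induction r with
    | zero => intro k; rfl
    | succ r ih => intro k; rw [lintegral_aliveWeight_step, ih (k + 1), add_right_comm]; rfl
  have h := hiter r 0
  rw [zero_add] at h
  have hq : IsProbabilityMeasure (expMeasure (M.rate i)) :=
    isProbabilityMeasure_expMeasure (M.rate_pos i)
  have hmr : Measurable fun z => M.holdWeight s j r z 0 := measurable_holdWeight_left s j r 0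
  have h0 : ∫⁻ ω, M.aliveWeight s 0 ω * M.holdWeight s j r (ω 0) (M.freeLevel ω 0)
      ∂(M.pathLaw i) = M.passage s j r i 0 := by
    have h1 : ∀ ω, M.aliveWeight s 0 ω * M.holdWeight s j r (ω 0) (M.freeLevel ω 0) =
        M.holdWeight s j r (ω 0) 0 := fun ω => by
      rw [aliveWeight, Set.indicator_of_mem, jumpTime_zero, freeLevel_zero]
      · simp
      · intro m hm; rw [Nat.le_zero.1 hm, freeLevel_zero]
    simp only [h1]
    rw [← lintegral_map (f := fun z => M.holdWeight s j r z 0) hmr (measurable_pi_apply 0),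
      pathLaw_map_eval_zero, lintegral_prod _ hmr.aemeasurable, lintegral_dirac' _
      (Measurable.lintegral_prod_right' hmr), lintegral_holdWeight s j r i le_rfl]
  rw [← h0, h, ← lintegral_indicator (measurableSet_crossing j r)]
  refine lintegral_congr fun ω => ?_
  by_cases hω : ω ∈ M.crossing j r
  · obtain ⟨h1, h2, h3, h4⟩ := hω
    rw [Set.indicator_of_mem (by exact ⟨h1, h2, h3, h4⟩), aliveWeight, Set.indicator_of_mem (by exact h1)]
    simp only [holdWeight]
    rw [if_pos ⟨h2, h3, by rwa [← freeLevel_succ]⟩, ← ENNReal.ofReal_mul (Real.exp_pos _).le,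
      ← Real.exp_add, crossTime]
    congr 2; ring
  · rw [Set.indicator_of_notMem hω]
    by_cases h1 : ∀ m ≤ r, 0 ≤ M.freeLevel ω m
    · simp only [holdWeight]
      rw [if_neg, mul_zero]
      rintro ⟨h2, h3, h4⟩
      exact hω ⟨h1, h2, h3, by rwa [freeLevel_succ]⟩
    · rw [aliveWeight, Set.indicator_of_notMem (by exact h1), zero_mul]

/-- Almost surely, all holding times are positive, and a path that starts with an increase of the
level has its free level different from `0` at all later jumps. -/
lemma ae_pathLaw {i : Fin n} (hi : 0 < M.c i) : ∀ᵐ ω ∂(M.pathLaw i), (ω 0).1 = i ∧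
    (∀ k, 0 < (ω k).2) ∧ ∀ k, M.freeLevel ω (k + 1) ≠ 0 := by
  have hq : IsProbabilityMeasure (expMeasure (M.rate i)) :=
    isProbabilityMeasure_expMeasure (M.rate_pos i)
  have h0 : ∀ᵐ ω ∂(M.pathLaw i), (ω 0).1 = i ∧ 0 < (ω 0).2 := by
    have hms : MeasurableSet {z : Fin n × ℝ | z.1 = i ∧ 0 < z.2} :=
      (measurable_fst (measurableSet_singleton i)).inter
        (measurableSet_lt measurable_const measurable_snd)
    have h1 : ∀ᵐ z ∂((M.pathLaw i).map (fun ω => ω 0)), z.1 = i ∧ 0 < z.2 := by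
      rw [pathLaw_map_eval_zero, Measure.ae_prod_iff_ae_ae hms, ae_dirac_iff]
      · filter_upwards [ae_expMeasure_pos] with t ht using ⟨rfl, ht⟩
      · exact MeasurableSet.of_discrete
    exact ae_of_ae_map (measurable_pi_apply 0).aemeasurable h1
  -- a property of the next pair that holds for almost every holding time, given the past, holds a.s.
  have key : ∀ (k : ℕ) (p : (ℕ → Fin n × ℝ) → Fin n × ℝ → Prop),
      MeasurableSet {q : (ℕ → Fin n × ℝ) × (Fin n × ℝ) | p q.1 q.2} →
      (∀ ω ω' z, (∀ m ≤ k, ω m = ω' m) → p ω z → p ω' z) →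
      (∀ ω b, ∀ᵐ t ∂(expMeasure (M.rate b)), p ω (b, t)) →
      ∀ᵐ ω ∂(M.pathLaw i), p ω (ω (k + 1)) := by
    intro k p hp hdep h
    have hpc : MeasurableSet {q : (ℕ → Fin n × ℝ) × (Fin n × ℝ) | ¬ p q.1 q.2} := hp.compl
    have hF := lintegral_pathLaw_succ M i k (measurable_one.indicator hpc) (fun ω ω' z hω => by
      have : p ω z ↔ p ω' z := ⟨hdep _ _ _ hω, hdep _ _ _ fun m hm => (hω m hm).symm⟩
      by_cases hz : p ω z
      · rw [Set.indicator_of_notMem (by simpa using hz),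
          Set.indicator_of_notMem (by simpa using this.1 hz)]
      · rw [Set.indicator_of_mem (by simpa using hz),
          Set.indicator_of_mem (by simpa using fun h => hz (this.2 h))]
        rfl)
    have h1 : ∀ ω : ℕ → Fin n × ℝ, ∫⁻ z, {q : (ℕ → Fin n × ℝ) × (Fin n × ℝ) | ¬ p q.1 q.2}.indicator
        (1 : (ℕ → Fin n × ℝ) × (Fin n × ℝ) → ℝ≥0∞) (ω, z) ∂(M.jumpMeasure (ω k).1) = 0 := fun ω => by
      have h2 : ∀ᵐ z ∂(M.jumpMeasure (ω k).1), p ω z :=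
        M.ae_jumpMeasure _ (measurable_prodMk_left (x := ω) hp) (h ω)
      rw [← lintegral_zero (μ := M.jumpMeasure (ω k).1)]
      refine lintegral_congr_ae ?_
      filter_upwards [h2] with z hz
      exact Set.indicator_of_notMem (by simpa using hz) _
    rw [lintegral_congr h1, lintegral_zero] at hF
    have hF' := (lintegral_eq_zero_iff ((measurable_one.indicator hpc).comp
      (measurable_id.prodMk (measurable_pi_apply (k + 1))))).1 hF
    filter_upwards [hF'] with ω hω
    by_contra hne
    simp only [Pi.zero_apply, Function.comp_apply, id_eq] at hω
    rw [Set.indicator_of_mem (by simpa using hne)] at hω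
    exact one_ne_zero hω
  have hpos : ∀ k, ∀ᵐ ω ∂(M.pathLaw i), 0 < (ω (k + 1)).2 := fun k =>
    key k (fun _ z => 0 < z.2) (measurableSet_lt measurable_const (by fun_prop))
      (fun _ _ _ _ h => h) (fun _ _ => ae_expMeasure_pos)
  have hne : ∀ k, ∀ᵐ ω ∂(M.pathLaw i), M.freeLevel ω (k + 1) ≠ 0 →
      M.freeLevel ω (k + 2) ≠ 0 := by
    intro k
    have := key k (fun ω z => M.freeLevel ω (k + 1) ≠ 0 →
      M.freeLevel ω (k + 1) + M.c z.1 * z.2 ≠ 0) ?_ ?_ ?_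
    · filter_upwards [this] with ω hω h
      rw [freeLevel_succ]; exact hω h
    · have hy : Measurable fun q : (ℕ → Fin n × ℝ) × (Fin n × ℝ) => M.freeLevel q.1 (k + 1) :=
        (measurable_freeLevel (k + 1)).comp measurable_fst
      have hc : Measurable fun q : (ℕ → Fin n × ℝ) × (Fin n × ℝ) => M.c q.2.1 * q.2.2 :=
        (measurable_c_fst.comp measurable_snd).mul (by fun_prop)
      have e : {q : (ℕ → Fin n × ℝ) × (Fin n × ℝ) | M.freeLevel q.1 (k + 1) ≠ 0 →
          M.freeLevel q.1 (k + 1) + M.c q.2.1 * q.2.2 ≠ 0} =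
          {q | M.freeLevel q.1 (k + 1) = 0} ∪
            {q | M.freeLevel q.1 (k + 1) + M.c q.2.1 * q.2.2 = 0}ᶜ := by
        ext q
        simp only [Set.mem_ofPred_eq, Set.mem_union, Set.mem_compl_iff]
        tauto
      rw [e]
      exact (measurableSet_eq_fun hy measurable_const).union
        (measurableSet_eq_fun (hy.add hc) measurable_const).compl
    · intro ω ω' z h
      have h' : ∀ m < k + 1, ω m = ω' m := fun m hm => h m (Nat.lt_succ_iff.1 hm)
      rw [freeLevel_congr h']
      exact id
    · intro ω b
      have h1 : ∀ᵐ t ∂(expMeasure (M.rate b)), t ≠ -M.freeLevel ω (k + 1) / M.c b :=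
        (expMeasure_absolutelyContinuous _).ae_le (Measure.ae_ne volume _)
      filter_upwards [h1] with t ht h0 hz
      have hb : M.c b ≠ 0 := by
        intro hb
        simp only [hb, zero_mul, add_zero] at hz
        exact h0 hz
      refine ht ?_
      rw [eq_div_iff hb]
      linarith
  filter_upwards [h0, ae_all_iff.2 hpos, ae_all_iff.2 hne] with ω h0 hp hn
  refine ⟨h0.1, fun k => ?_, fun k => ?_⟩
  · cases k with
    | zero => exact h0.2
    | succ k => exact hp k
  · induction k with
    | zero =>
      rw [freeLevel_succ, freeLevel_zero, zero_add, h0.1]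
      exact (mul_pos hi h0.2).ne'
    | succ k ih => exact hn k ih

/-! ### Paths that start with an increase of the level -/

section Paths

variable {ω : ℕ → Fin n × ℝ} (hpos : ∀ k, 0 < (ω k).2)
include hpos

lemma strictMono_jumpTime : StrictMono (jumpTime ω) :=
  strictMono_nat_of_lt_succ fun k => by rw [jumpTime_succ]; linarith [hpos k]

lemma jumpCount_eq {N : ℕ} {t : ℝ} (h1 : jumpTime ω N ≤ t) (h2 : t < jumpTime ω (N + 1)) :
    jumpCount ω t = N := by
  unfold jumpCount
  refine IsLeast.csInf_eq ⟨h2, fun k hk => ?_⟩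
  by_contra! hlt
  have : jumpTime ω (k + 1) ≤ jumpTime ω N := (strictMono_jumpTime hpos).monotone hlt
  have hk : t < jumpTime ω (k + 1) := hk
  linarith

omit hpos in
/-- A time before some jump time lies between two consecutive jump times. -/
lemma exists_jumpTime_le_lt {t : ℝ} (h0 : 0 ≤ t) {K : ℕ} (h : t < jumpTime ω (K + 1)) :
    ∃ N ≤ K, jumpTime ω N ≤ t ∧ t < jumpTime ω (N + 1) := by
  classical
  have hex : ∃ k, t < jumpTime ω (k + 1) := ⟨K, h⟩
  refine ⟨Nat.find hex, Nat.find_min' hex h, ?_, Nat.find_spec hex⟩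
  cases hN : Nat.find hex with
  | zero => rw [jumpTime_zero]; exact h0
  | succ N => exact not_lt.1 (Nat.find_min hex (m := N) (by omega))

omit hpos in
lemma levelAtJump_eq {N : ℕ} (h : ∀ m ≤ N, 0 ≤ M.freeLevel ω m) :
    M.levelAtJump 0 ω N = M.freeLevel ω N := by
  induction N with
  | zero => rw [freeLevel_zero]; rfl
  | succ N ih =>
    rw [levelAtJump, ih fun m hm => h m (hm.trans (Nat.le_succ N)), ← freeLevel_succ,
      max_eq_right (h _ le_rfl)]

lemma level_eq {N : ℕ} (h : ∀ m ≤ N, 0 ≤ M.freeLevel ω m) {t : ℝ} (h1 : jumpTime ω N ≤ t)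
    (h2 : t < jumpTime ω (N + 1)) :
    M.level 0 ω t = max 0 (M.freeLevel ω N + M.c (ω N).1 * (t - jumpTime ω N)) := by
  rw [level, jumpCount_eq hpos h1 h2, levelAtJump_eq h]

variable (hc : 0 < M.c (ω 0).1) (hne : ∀ k, M.freeLevel ω (k + 1) ≠ 0)
include hc hne

omit hpos hc in
lemma freeLevel_pos {N : ℕ} (hN : 0 < N) (h : 0 ≤ M.freeLevel ω N) : 0 < M.freeLevel ω N := by
  obtain ⟨k, rfl⟩ := Nat.exists_eq_succ_of_ne_zero hN.ne'
  exact lt_of_le_of_ne h (hne k).symm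

lemma level_pos {N : ℕ} (h : ∀ m ≤ N + 1, 0 ≤ M.freeLevel ω m) {t : ℝ} (h0 : 0 < t)
    (h1 : jumpTime ω N ≤ t) (h2 : t < jumpTime ω (N + 1)) : 0 < M.level 0 ω t := by
  rw [level_eq hpos (fun m hm => h m (hm.trans (Nat.le_succ N))) h1 h2]
  refine lt_max_of_lt_right ?_
  rcases Nat.eq_zero_or_pos N with rfl | hN
  · rw [freeLevel_zero, jumpTime_zero, zero_add, sub_zero]
    exact mul_pos hc h0
  · have hy := freeLevel_pos hne hN (h N (Nat.le_succ N))
    have hy1 := h (N + 1) le_rfl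
    rw [freeLevel_succ] at hy1
    rw [jumpTime_succ] at h2
    rcases le_or_gt 0 (M.c (ω N).1) with hcN | hcN
    · have := mul_nonneg hcN (sub_nonneg.2 h1)
      linarith
    · nlinarith

/-- On `crossing j r` the level first returns to `0` at `crossTime j r`, in phase `j`. -/
lemma isLeast_crossTime {j : Fin n} {r : ℕ} (h : ω ∈ M.crossing j r) :
    IsLeast (M.zeroTimes ω) (M.crossTime j r ω) ∧ phase ω (M.crossTime j r ω) = j := by
  obtain ⟨halive, hj, hcj, hneg⟩ := h
  -- the initial phase increases the level
  have hr : 0 < r := by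
    rcases Nat.eq_zero_or_pos r with rfl | hr
    · rw [freeLevel_succ, freeLevel_zero, zero_add] at hneg
      have := mul_pos hc (hpos 0)
      linarith
    · exact hr
  have hy := freeLevel_pos hne hr (halive r le_rfl)
  rw [freeLevel_succ, hj] at hneg
  have hJ : 0 ≤ jumpTime ω r := by
    have := (strictMono_jumpTime hpos).monotone (Nat.zero_le r)
    rwa [jumpTime_zero] at this
  have hq : 0 < M.freeLevel ω r / |M.c j| := div_pos hy (abs_pos.2 hcj.ne)
  have hθ1 : jumpTime ω r ≤ M.crossTime j r ω := by rw [crossTime]; linarith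
  have hθ2 : M.crossTime j r ω < jumpTime ω (r + 1) := by
    rw [crossTime, jumpTime_succ, abs_of_neg hcj, add_lt_add_iff_left, div_lt_iff₀ (by linarith)]
    linarith
  have hθ0 : 0 < M.crossTime j r ω := by rw [crossTime]; linarith
  refine ⟨⟨⟨hθ0, ?_⟩, fun t ⟨ht0, ht⟩ => ?_⟩, ?_⟩
  · rw [level_eq hpos halive hθ1 hθ2, hj, crossTime, add_sub_cancel_left, abs_of_neg hcj]
    have : M.c j * (M.freeLevel ω r / -M.c j) = -M.freeLevel ω r := by field_simp [hcj.ne]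
    rw [this, add_neg_cancel, max_self]
  · by_contra! hlt
    obtain ⟨N, hNr, h1, h2⟩ := exists_jumpTime_le_lt ht0.le (hlt.trans hθ2)
    rcases hNr.lt_or_eq with hN | rfl
    · have := level_pos hpos hc hne (fun m hm => halive m (hm.trans hN)) ht0 h1 h2
      exact this.ne' ht
    · have hpos' : 0 < M.freeLevel ω N + M.c j * (t - jumpTime ω N) := by
        rw [crossTime, ← sub_lt_iff_lt_add', lt_div_iff₀ (abs_pos.2 hcj.ne), abs_of_neg hcj] at hlt
        linarith
      rw [level_eq hpos halive h1 h2, hj, max_eq_right hpos'.le] at ht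
      exact hpos'.ne' ht
  · rw [phase, jumpCount_eq hpos hθ1 hθ2, hj]

/-- If the free level never becomes negative then the level never returns to `0`; after an explosion
of the jump chain the level has the value that belongs to the initial phase, which is positive. -/
lemma zeroTimes_eq_empty (h : ∀ j r, ω ∉ M.crossing j r) : M.zeroTimes ω = ∅ := by
  have halive : ∀ m, 0 ≤ M.freeLevel ω m := by
    intro m
    induction m using Nat.strong_induction_on with
    | _ m ih =>
      rcases Nat.eq_zero_or_pos m with rfl | hm
      · rw [freeLevel_zero]
      · obtain ⟨r, rfl⟩ := Nat.exists_eq_succ_of_ne_zero hm.ne'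
        by_contra! hneg
        have h0 := ih r (Nat.lt_succ_self r)
        refine h (ω r).1 r ⟨fun m hm => ih m (Nat.lt_succ_of_le hm), rfl, ?_, hneg⟩
        rw [Nat.succ_eq_add_one, freeLevel_succ] at hneg
        by_contra! hcr
        have := mul_nonneg hcr (hpos r).le
        linarith
  rw [Set.eq_empty_iff_forall_notMem]
  rintro t ⟨ht0, ht⟩
  by_cases hex : ∃ K, t < jumpTime ω (K + 1)
  · obtain ⟨K, hK⟩ := hex
    obtain ⟨N, _, h1, h2⟩ := exists_jumpTime_le_lt ht0.le hK
    exact (level_pos hpos hc hne (fun m _ => halive m) ht0 h1 h2).ne' ht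
  -- past all the jump times `jumpCount` is `sInf ∅ = 0`
  · have h0 : jumpCount ω t = 0 := by
      unfold jumpCount
      rw [show {k | t < jumpTime ω (k + 1)} = ∅ from
        Set.eq_empty_of_forall_notMem fun k hk => hex ⟨k, hk⟩, Nat.sInf_empty]
    rw [level, h0, jumpTime_zero, sub_zero] at ht
    have h2 : 0 < M.levelAtJump 0 ω 0 + M.c (ω 0).1 * t := by
      rw [levelAtJump, zero_add]; exact mul_pos hc ht0
    rw [max_eq_right h2.le] at ht
    exact h2.ne' ht

omit hpos hc hne in
lemma crossing_unique {j j' : Fin n} {r r' : ℕ} (h : ω ∈ M.crossing j r)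
    (h' : ω ∈ M.crossing j' r') : r = r' ∧ j = j' := by
  have hr : r = r' := by
    rcases lt_trichotomy r r' with hlt | heq | hlt
    · exact absurd (h'.1 (r + 1) hlt) (not_le.2 h.2.2.2)
    · exact heq
    · exact absurd (h.1 (r' + 1) hlt) (not_le.2 h'.2.2.2)
  subst hr
  exact ⟨rfl, h.2.1.symm.trans h'.2.1⟩

/-- The first return decomposed by the number of jumps before it. -/
lemma indicator_return_eq_tsum (s : ℝ) (j : Fin n) :
    Set.indicator {ω | (M.zeroTimes ω).Nonempty ∧ phase ω (M.returnTime ω) = j}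
      (fun ω => ENNReal.ofReal (Real.exp (-s * M.returnTime ω))) ω =
    ∑' r, (M.crossing j r).indicator
      (fun ω => ENNReal.ofReal (Real.exp (-s * M.crossTime j r ω))) ω := by
  by_cases hex : ∃ j' r, ω ∈ M.crossing j' r
  · obtain ⟨j', r, h⟩ := hex
    obtain ⟨hl, hph⟩ := isLeast_crossTime hpos hc hne h
    have hret : M.returnTime ω = M.crossTime j' r ω := hl.csInf_eq
    by_cases hj : j' = j
    · subst hj
      rw [Set.indicator_of_mem (by exact ⟨⟨_, hl.1⟩, by rw [hret, hph]⟩), tsum_eq_single r,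
        Set.indicator_of_mem h, hret]
      intro r' hr'
      exact Set.indicator_of_notMem (fun h' => hr' (crossing_unique h' h).1) _
    · rw [Set.indicator_of_notMem, eq_comm, ENNReal.tsum_eq_zero]
      · intro r'
        exact Set.indicator_of_notMem (fun h' => hj (crossing_unique h h').2) _
      · rintro ⟨_, h2⟩
        rw [hret, hph] at h2
        exact hj h2
  · push Not at hex
    rw [Set.indicator_of_notMem, eq_comm, ENNReal.tsum_eq_zero]
    · exact fun r => Set.indicator_of_notMem (hex j r) _
    · rintro ⟨h1, _⟩
      rw [zeroTimes_eq_empty hpos hc hne hex] at h1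
      exact Set.not_nonempty_empty h1

end Paths

/-! ### `Ψ` as a first passage weight and as a Laplace–Stieltjes transform -/

lemma measurable_crossing_integrand (s : ℝ) (j : Fin n) (r : ℕ) :
    Measurable fun ω => ENNReal.ofReal (Real.exp (-s * M.crossTime j r ω)) := by
  have := measurable_crossTime (M := M) j r
  fun_prop

lemma psiLST_eq_tsum_crossing (s : ℝ) (i : M.S1) (j : M.S2) : M.psiLST s i j =
    ∑' r, (∫⁻ ω in M.crossing j r, ENNReal.ofReal (Real.exp (-s * M.crossTime j r ω))
      ∂(M.pathLaw i)) := by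
  calc M.psiLST s i j = ∫⁻ ω, (∑' r, (M.crossing j r).indicator
      (fun ω => ENNReal.ofReal (Real.exp (-s * M.crossTime j r ω))) ω) ∂(M.pathLaw i) := by
        refine lintegral_congr_ae ?_
        filter_upwards [ae_pathLaw i.2] with ω hω
        exact indicator_return_eq_tsum hω.2.1 (by rw [hω.1]; exact i.2) hω.2.2 s j
    _ = _ := by
        rw [lintegral_tsum fun r => ((measurable_crossing_integrand s _ r).indicator
          (measurableSet_crossing _ r)).aemeasurable]
        exact tsum_congr fun r => lintegral_indicator (measurableSet_crossing _ r) _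

/-- `Ψ(s)` is the weight of the first passage from level `0` to level `0`. -/
theorem psiLST_eq_passageLST (s : ℝ) (i : M.S1) (j : M.S2) :
    M.psiLST s i j = M.passageLST s i j 0 := by
  rw [psiLST_eq_tsum_crossing]
  exact tsum_congr fun r => lintegral_crossing _ s _ r

/-- `Ψ(s)` is the Laplace–Stieltjes transform of a measure on `[0, ∞)`. -/
theorem exists_measure_psiLST (i : M.S1) (j : M.S2) : ∃ ν : Measure ℝ, ν (Set.Iio 0) = 0 ∧
    ∀ s, M.psiLST s i j = ∫⁻ x, ENNReal.ofReal (Real.exp (-s * x)) ∂ν := by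
  refine ⟨Measure.sum fun r => ((M.pathLaw i).restrict (M.crossing j r)).map (M.crossTime j r),
    ?_, fun s => ?_⟩
  · rw [Measure.sum_apply _ measurableSet_Iio, ENNReal.tsum_eq_zero]
    intro r
    rw [Measure.map_apply (measurable_crossTime _ r) measurableSet_Iio,
      Measure.restrict_apply' (measurableSet_crossing _ r), measure_eq_zero_iff_ae_notMem]
    filter_upwards [ae_pathLaw i.2] with ω hω h
    have := (isLeast_crossTime hω.2.1 (by rw [hω.1]; exact i.2) hω.2.2 h.2).1.1.1
    exact lt_asymm this h.1
  · rw [psiLST_eq_tsum_crossing, lintegral_sum_measure]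
    refine tsum_congr fun r => ?_
    rw [lintegral_map (by fun_prop) (measurable_crossTime _ r)]

lemma psiLST_zero_le_one (i : M.S1) (j : M.S2) : M.psiLST 0 i j ≤ 1 := by
  calc M.psiLST 0 i j ≤ ∫⁻ _, 1 ∂(M.pathLaw i) := lintegral_mono fun ω => by
        refine (Set.indicator_le_self' (fun _ _ => zero_le) ω).trans ?_
        simp
    _ = 1 := by simp

/-! ### Positivity and finiteness of the passage weights -/

lemma passageLST_of_nonneg (s : ℝ) {l : Fin n} (hl : 0 ≤ M.c l) (a : Fin n) (y : ℝ) :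
    M.passageLST s a l y = 0 := by
  have h : ∀ r a y, M.passage s l r a y = 0 := by
    intro r
    induction r with
    | zero =>
      intro a y
      exact if_neg fun h => by rcases h with ⟨rfl, h⟩; exact hl.not_gt h
    | succ r ih =>
      intro a y
      rw [passage_succ, jumpStep]
      simp [ih]
  simp [passageLST, h]

lemma sum_S2_eq {f : Fin n → ℝ≥0∞} (h : ∀ l, 0 ≤ M.c l → f l = 0) : ∑ l, f l = ∑ l : M.S2, f l := by
  rw [← Fintype.sum_subtype_add_sum_subtype (fun l => M.c l < 0) f]
  rw [Finset.sum_eq_zero (s := Finset.univ (α := {l // ¬ M.c l < 0})) (fun l _ => h _ (not_lt.1 l.2)),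
    add_zero]

lemma passageLST_add_S2 (s : ℝ) (a j : Fin n) {x y : ℝ} (hx : 0 ≤ x) (hy : 0 ≤ y) :
    M.passageLST s a j (x + y) = ∑ l : M.S2, M.passageLST s a l x * M.passageLST s l j y := by
  rw [passageLST_add s a j hx hy]
  exact sum_S2_eq fun l hl => by rw [passageLST_of_nonneg s hl, zero_mul]

lemma exp_le_passageLST (s : ℝ) (j : M.S2) (y : ℝ) :
    ENNReal.ofReal (Real.exp (-((M.rate j + s) * (y / |M.c j|)))) ≤ M.passageLST s j j y := by
  rw [passageLST_eq, passage_zero_of_neg j.2]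
  exact le_self_add

lemma durations_zero_of_neg {a : Fin n} (ha : M.c a < 0) : M.durations a 0 = ∅ := by
  refine Set.eq_empty_of_forall_notMem fun t ht => ?_
  have h1 := mul_neg_of_neg_of_pos ha ht.1
  have h2 := ht.2
  linarith

lemma passageLST_zero (s : ℝ) (a j : M.S2) : M.passageLST s a j 0 = if a = j then 1 else 0 := by
  rw [passageLST_eq, jumpStep, durations_zero_of_neg a.2, Measure.restrict_empty,
    lintegral_zero_measure, add_zero]
  split_ifs with h
  · subst h
    rw [passage_zero_of_neg a.2]; simp
  · exact passage_zero_of_ne (fun h' => h (Subtype.ext h')) 0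

lemma ne_of_T_pos {a b : Fin n} (h : 0 < M.T a b) : a ≠ b := by
  rintro rfl
  have := M.rate_pos a
  unfold rate at this
  linarith

lemma isOpen_durations_gt (a : Fin n) (x y : ℝ) : IsOpen {t : ℝ | 0 < t ∧ x < y + M.c a * t} :=
  (isOpen_lt continuous_const continuous_id).inter
    (isOpen_lt (f := fun _ : ℝ => x) (g := fun t => y + M.c a * t) (by fun_prop) (by fun_prop))

/-- The first-jump operator charges a jump from `a` to `b` as soon as it can take place at a positive
level. -/
lemma jumpStep_pos {s : ℝ} {g : Fin n → ℝ → ℝ≥0∞} (hg : ∀ b, Measurable (g b)) {a b : Fin n}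
    (hab : 0 < M.T a b) (hpos : ∀ z, 0 < z → 0 < g b z) {y : ℝ}
    (hy : 0 < y ∨ 0 < M.c a ∧ 0 ≤ y) : 0 < M.jumpStep s g a y := by
  have hsub : {t : ℝ | 0 < t ∧ 0 < y + M.c a * t} ⊆ M.durations a y := fun t ht => ⟨ht.1, ht.2.le⟩
  refine lt_of_lt_of_le ?_ (lintegral_mono_set hsub)
  rw [setLIntegral_pos_iff (measurable_jumpStep_integrand hg a y)]
  have hopen := isOpen_durations_gt (M := M) a 0 y
  have hne : {t : ℝ | 0 < t ∧ 0 < y + M.c a * t}.Nonempty := by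
    rcases hy with hy | ⟨hc, hy⟩
    · refine ⟨y / (2 * (|M.c a| + 1)), by positivity, ?_⟩
      have h1 : |M.c a| * (y / (2 * (|M.c a| + 1))) ≤ y / 2 := by
        rw [mul_div_assoc', div_le_div_iff₀ (by positivity) (by positivity)]
        nlinarith [abs_nonneg (M.c a)]
      have h2 : -(|M.c a| * (y / (2 * (|M.c a| + 1)))) ≤ M.c a * (y / (2 * (|M.c a| + 1))) := by
        rw [← neg_mul]
        exact mul_le_mul_of_nonneg_right (neg_abs_le _) (by positivity)
      linarith
    · exact ⟨1, one_pos, by linarith⟩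
  refine lt_of_lt_of_le (hopen.measure_pos volume hne) (measure_mono fun t ht => ⟨?_, ht⟩)
  have h1 : 0 < ENNReal.ofReal (M.T a b) * g b (y + M.c a * t) :=
    ENNReal.mul_pos (ENNReal.ofReal_pos.2 hab).ne' (hpos _ ht.2).ne'
  have h2 : 0 < ∑ b ∈ Finset.univ.erase a, ENNReal.ofReal (M.T a b) * g b (y + M.c a * t) :=
    lt_of_lt_of_le h1 (Finset.single_le_sum
      (f := fun b => ENNReal.ofReal (M.T a b) * g b (y + M.c a * t)) (fun _ _ => zero_le)
      (Finset.mem_erase.2 ⟨(ne_of_T_pos hab).symm, Finset.mem_univ b⟩))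
  exact (ENNReal.mul_pos (ENNReal.ofReal_pos.2 (Real.exp_pos _)).ne' h2.ne').ne'

lemma passageLST_pos (s : ℝ) (a : Fin n) (j : M.S2) {y : ℝ} (hy : 0 < y) :
    0 < M.passageLST s a j y := by
  have h := M.irreducible a j
  induction h using Relation.ReflTransGen.head_induction_on generalizing y with
  | refl => exact (ENNReal.ofReal_pos.2 (Real.exp_pos _)).trans_le (exp_le_passageLST s j y)
  | head hab _ ih =>
    rw [passageLST_eq]
    exact (jumpStep_pos (fun b => measurable_passageLST s b j) hab (fun z hz => ih hz)
      (.inl hy)).trans_le le_add_self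

lemma exists_T_pos (i : Fin n) : ∃ k, 0 < M.T i k := by
  by_contra! h
  have h1 := M.rate_pos i
  rw [rate_eq] at h1
  exact absurd h1 (not_lt.2 (Finset.sum_nonpos fun k _ => h k))

lemma psiLST_pos (s : ℝ) (i : M.S1) (j : M.S2) : 0 < M.psiLST s i j := by
  obtain ⟨k, hk⟩ := M.exists_T_pos i
  rw [psiLST_eq_passageLST, passageLST_eq]
  exact (jumpStep_pos (fun b => measurable_passageLST s b j) hk
    (fun z hz => passageLST_pos s k j hz) (.inr ⟨i.2, le_rfl⟩)).trans_le le_add_self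

/-- Finiteness at one level implies finiteness at all lower levels. -/
lemma passageLST_lt_top_of_le {s : ℝ} {a : Fin n} {j : M.S2} {y z : ℝ} (hy : 0 ≤ y) (hyz : y ≤ z)
    (h : M.passageLST s a j z < ∞) : M.passageLST s a j y < ∞ := by
  have h1 : M.passageLST s a j y * M.passageLST s j j (z - y) ≤ M.passageLST s a j z := by
    have := passageLST_add_S2 (M := M) s a j hy (sub_nonneg.2 hyz)
    rw [add_sub_cancel] at this
    rw [this]
    exact Finset.single_le_sum (f := fun l : M.S2 =>
      M.passageLST s a l y * M.passageLST s l j (z - y)) (fun _ _ => zero_le) (Finset.mem_univ j)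
  refine ENNReal.lt_top_of_mul_ne_top_left (h1.trans_lt h).ne ?_
  exact ((ENNReal.ofReal_pos.2 (Real.exp_pos _)).trans_le (exp_le_passageLST s j _)).ne'

/-- If the first-jump integral is finite then its integrand is finite somewhere on each open set of
holding times. -/
lemma exists_lt_top_of_jumpStep {s : ℝ} {g : Fin n → ℝ → ℝ≥0∞} (hg : ∀ b, Measurable (g b))
    {a b : Fin n} (hab : 0 < M.T a b) {y : ℝ} (h : M.jumpStep s g a y < ∞) {O : Set ℝ}
    (hO : IsOpen O) (hne : O.Nonempty) (hsub : O ⊆ M.durations a y) :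
    ∃ t ∈ O, g b (y + M.c a * t) < ∞ := by
  by_contra! hall
  have htop : ∫⁻ t in O, (∞ : ℝ≥0∞) ≤ M.jumpStep s g a y := by
    refine le_trans ?_ (lintegral_mono_set hsub)
    refine setLIntegral_mono (measurable_jumpStep_integrand hg a y) fun t ht => ?_
    rw [top_le_iff]
    refine ENNReal.mul_eq_top.2 (.inl ⟨(ENNReal.ofReal_pos.2 (Real.exp_pos _)).ne', ?_⟩)
    rw [ENNReal.sum_eq_top]
    refine ⟨b, Finset.mem_erase.2 ⟨(ne_of_T_pos hab).symm, Finset.mem_univ b⟩, ?_⟩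
    rw [top_le_iff.1 (hall t ht)]
    exact ENNReal.mul_top (ENNReal.ofReal_pos.2 hab).ne'
  rw [setLIntegral_const, ENNReal.top_mul (hO.measure_pos volume hne).ne'] at htop
  exact (htop.trans_lt h).ne rfl

/-- If `Ψ(s)` is finite then all passage weights are finite: finiteness spreads along the
transitions of the driving chain. -/
theorem passageLST_lt_top {s : ℝ} (h : M.PsiFinite s) (a : Fin n) (j : M.S2) {y : ℝ} (hy : 0 ≤ y) :
    M.passageLST s a j y < ∞ := by
  have hmeas : ∀ b, Measurable (M.passageLST s b j) := fun b => measurable_passageLST s b j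
  have hlt : ∀ (a : Fin n) (y : ℝ), M.passageLST s a j y < ∞ →
      M.jumpStep s (fun b => M.passageLST s b j) a y < ∞ := fun a y h => by
    rw [passageLST_eq] at h
    exact lt_of_le_of_lt le_add_self h
  -- From level `y + 1`, a short holding time in `a` leaves a level above `y` at the jump to `b`.
  have hstep : ∀ a b, 0 < M.T a b → (∀ y, 0 ≤ y → M.passageLST s a j y < ∞) →
      ∀ y, 0 ≤ y → M.passageLST s b j y < ∞ := by
    intro a b hab ha y hy
    obtain ⟨t, ht, hfin⟩ := exists_lt_top_of_jumpStep hmeas hab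
      (hlt a (y + 1) (ha _ (by linarith))) (O := {t | 0 < t ∧ y < y + 1 + M.c a * t})
      (isOpen_durations_gt (M := M) a y (y + 1))
      ⟨1 / (|M.c a| + 1), by positivity, by
        have h1 : |M.c a| * (1 / (|M.c a| + 1)) < 1 := by
          rw [mul_one_div, div_lt_one (by positivity)]; linarith
        have h2 : -(|M.c a| * (1 / (|M.c a| + 1))) ≤ M.c a * (1 / (|M.c a| + 1)) := by
          rw [← neg_mul]
          exact mul_le_mul_of_nonneg_right (neg_abs_le _) (by positivity)
        linarith⟩
      (fun t ht => ⟨ht.1, hy.trans ht.2.le⟩)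
    exact passageLST_lt_top_of_le hy ht.2.le hfin
  obtain ⟨i, hi⟩ := M.exists_up
  obtain ⟨k, hk⟩ := M.exists_T_pos i
  -- From level `0`, a long holding time in an increasing phase leads to arbitrarily high levels.
  have hkfin : ∀ y, 0 ≤ y → M.passageLST s k j y < ∞ := by
    intro y hy
    have h0 : M.passageLST s i j 0 < ∞ := by
      have := h ⟨i, hi⟩ j
      rwa [psiLST_eq_passageLST] at this
    obtain ⟨t, ht, hfin⟩ := exists_lt_top_of_jumpStep hmeas hk (hlt i 0 h0)
      (O := {t | 0 < t ∧ y < 0 + M.c i * t})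
      (isOpen_durations_gt (M := M) i y 0)
      ⟨(y + 1) / M.c i, by positivity, by rw [mul_div_cancel₀ _ hi.ne']; linarith⟩
      (fun t ht => ⟨ht.1, hy.trans ht.2.le⟩)
    exact passageLST_lt_top_of_le hy ht.2.le hfin
  have hall : ∀ a, ∀ y, 0 ≤ y → M.passageLST s a j y < ∞ := by
    intro a
    have hr := M.irreducible k a
    induction hr with
    | refl => exact hkfin
    | tail _ hbc ih => exact hstep _ _ hbc ih
  exact hall a y hy

/-! ### The phases in which the level is constant -/

lemma durations_of_nonneg {a : Fin n} (ha : 0 ≤ M.c a) {y : ℝ} (hy : 0 ≤ y) :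
    M.durations a y = Set.Ioi 0 := by
  ext t
  exact ⟨fun h => h.1, fun h => ⟨h, add_nonneg hy (mul_nonneg ha (le_of_lt h))⟩⟩

lemma lintegral_exp_neg_mul {q : ℝ} (hq : 0 < q) :
    ∫⁻ t in Set.Ioi (0 : ℝ), ENNReal.ofReal (Real.exp (-(q * t))) = ENNReal.ofReal q⁻¹ := by
  have hp := isProbabilityMeasure_expMeasure hq
  have h1 : ∫⁻ _, 1 ∂(expMeasure q) = 1 := by simp
  rw [lintegral_expMeasure measurable_const] at h1
  simp only [mul_one] at h1
  have h2 : ∀ t : ℝ, ENNReal.ofReal (q * Real.exp (-(q * t))) =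
      ENNReal.ofReal q * ENNReal.ofReal (Real.exp (-(q * t))) := fun t => ENNReal.ofReal_mul hq.le
  simp only [h2] at h1
  rw [lintegral_const_mul' _ _ ENNReal.ofReal_ne_top] at h1
  rw [ENNReal.ofReal_inv_of_pos hq]
  exact ENNReal.eq_inv_of_mul_eq_one_left (by rwa [mul_comm])

/-- In a phase with rate `0`, the passage weights solve the linear first-jump equation, and the
discount does not exceed the total rate. -/
lemma passageLST_S0 {s : ℝ} (h : M.PsiFinite s) (a : M.S0) (j : M.S2) {y : ℝ} (hy : 0 ≤ y) :
    0 < M.rate a + s ∧ (M.rate a + s) * (M.passageLST s a j y).toReal =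
      ∑ b ∈ Finset.univ.erase a.1, M.T a b * (M.passageLST s b j y).toReal := by
  have hca : M.c a = 0 := a.2
  have heq : ∀ y, 0 ≤ y → M.passageLST s a j y =
      (∫⁻ t in Set.Ioi (0 : ℝ), ENNReal.ofReal (Real.exp (-((M.rate a + s) * t)))) *
        ∑ b ∈ Finset.univ.erase a.1, ENNReal.ofReal (M.T a b) * M.passageLST s b j y := by
    intro y hy
    rw [passageLST_eq, passage_zero_of_nonneg hca.ge, zero_add, jumpStep,
      durations_of_nonneg hca.ge hy]
    simp only [hca, zero_mul, add_zero]
    exact lintegral_mul_const _ (by fun_prop)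
  have hq : 0 < M.rate a + s := by
    by_contra! hq
    have h1 := heq 1 zero_le_one
    obtain ⟨k, hk⟩ := M.exists_T_pos a
    have h2 : 0 < ∑ b ∈ Finset.univ.erase a.1, ENNReal.ofReal (M.T a b) * M.passageLST s b j 1 :=
      lt_of_lt_of_le (ENNReal.mul_pos (ENNReal.ofReal_pos.2 hk).ne'
        (passageLST_pos s k j one_pos).ne') (Finset.single_le_sum
        (f := fun b => ENNReal.ofReal (M.T a b) * M.passageLST s b j 1) (fun _ _ => zero_le)
        (Finset.mem_erase.2 ⟨(ne_of_T_pos hk).symm, Finset.mem_univ k⟩))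
    have h3 : ∫⁻ t in Set.Ioi (0 : ℝ), ENNReal.ofReal (Real.exp (-((M.rate a + s) * t))) = ∞ := by
      rw [← top_le_iff]
      calc ∞ = ∫⁻ t in Set.Ioi (0 : ℝ), 1 := by simp
        _ ≤ _ := setLIntegral_mono (by fun_prop) fun t ht => by
            rw [← ENNReal.ofReal_one]
            refine ENNReal.ofReal_le_ofReal (Real.one_le_exp ?_)
            have := mul_nonpos_of_nonpos_of_nonneg hq (le_of_lt ht)
            linarith
    rw [h3, ENNReal.top_mul h2.ne'] at h1
    exact (passageLST_lt_top h a j zero_le_one).ne h1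
  refine ⟨hq, ?_⟩
  have h1 := congrArg ENNReal.toReal (heq y hy)
  rw [lintegral_exp_neg_mul hq, ENNReal.toReal_mul, ENNReal.toReal_ofReal (inv_nonneg.2 hq.le),
    ENNReal.toReal_sum fun b _ => ENNReal.mul_ne_top ENNReal.ofReal_ne_top
      (passageLST_lt_top h b j hy).ne] at h1
  rw [h1, ← mul_assoc, mul_inv_cancel₀ hq.ne', one_mul]
  refine Finset.sum_congr rfl fun b hb => ?_
  rw [ENNReal.toReal_mul, ENNReal.toReal_ofReal
    (M.offDiag_nonneg _ _ (Finset.ne_of_mem_erase hb).symm)]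

/-! ### The Riccati equation -/

lemma sum_phases {R : Type*} [AddCommMonoid R] (F : Fin n → R) :
    ∑ k, F k = ∑ k : M.S1, F k + ∑ k : M.S2, F k + ∑ k : M.S0, F k := by
  have f1 : ∀ (p : Fin n → Prop) [DecidablePred p], ∑ k : {k // p k}, F k =
      ∑ k, if p k then F k else 0 := fun p _ => by
    rw [← Finset.sum_filter]
    exact (Finset.sum_subtype _ (by simp) F).symm
  rw [f1, f1, f1, ← Finset.sum_add_distrib, ← Finset.sum_add_distrib]
  refine Finset.sum_congr rfl fun k _ => ?_
  rcases lt_trichotomy (M.c k) 0 with h | h | h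
  · simp [h, h.ne, h.not_gt]
  · simp [h]
  · simp [h, h.ne', h.not_gt]

lemma metzler_T : Metzler M.T := M.offDiag_nonneg

lemma irred_T : Irred M.T := M.irreducible

lemma metzler_R (s : ℝ) : Metzler (M.R s) := fun i j h => by
  have h1 := M.offDiag_nonneg i j fun h' => h (Subtype.ext h')
  simpa [R, T00, h] using h1

/-- The minimum principle for `R(s)`, from a positive vector `f` on all phases with `T f ≤ s f` on
the phases with rate `0`: a zero of `z - t f` would spread to all phases. -/
lemma minPrinciple_R_of_pos {s : ℝ} {f : Fin n → ℝ} (hf : ∀ a, 0 < f a)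
    (hTf : ∀ a : M.S0, (M.T *ᵥ f) a ≤ s * f a) : MinPrinciple (M.R s) := fun z hz i => by
  obtain ⟨m, -, hm⟩ := Finset.exists_min_image Finset.univ (fun i : M.S0 => z i / f i)
    ⟨i, Finset.mem_univ i⟩
  -- for the minimal ratio `t`, supposed negative, `Z = z - t f` is nonnegative with a zero at `m`
  set t := z m / f m with ht
  have hzt : ∀ k : M.S0, t * f k ≤ z k := fun k => by
    have := hm k (Finset.mem_univ _)
    rwa [le_div_iff₀ (hf k)] at this
  have hzm : z m = t * f m := by rw [ht, div_mul_cancel₀ _ (hf m).ne']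
  suffices 0 ≤ t from (mul_nonneg this (hf i).le).trans (hzt i)
  by_contra! hneg
  let z' : Fin n → ℝ := fun a => if h : M.c a = 0 then z ⟨a, h⟩ else 0
  have hz'0 : ∀ a : M.S0, z' a = z a := fun a => dif_pos a.2
  have hz'1 : ∀ a, M.c a ≠ 0 → z' a = 0 := fun a h => dif_neg h
  let Z : Fin n → ℝ := z' - t • f
  have hZ : ∀ a, 0 ≤ Z a := fun a => by
    by_cases h : M.c a = 0
    · have h1 := hzt ⟨a, h⟩
      have h2 := hz'0 ⟨a, h⟩
      simp only at h1 h2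
      simp only [Z, Pi.sub_apply, Pi.smul_apply, smul_eq_mul]
      linarith
    · have := mul_neg_of_neg_of_pos hneg (hf a)
      simp only [Z, Pi.sub_apply, Pi.smul_apply, smul_eq_mul, hz'1 a h]
      linarith
  have hpos : ∀ a, M.c a ≠ 0 → 0 < Z a := fun a h => by
    have := mul_neg_of_neg_of_pos hneg (hf a)
    simp only [Z, Pi.sub_apply, Pi.smul_apply, smul_eq_mul, hz'1 a h]
    linarith
  have hZm : Z m = 0 := by simp [Z, hz'0, hzm]
  have hTZ : ∀ a, Z a = 0 → (M.T *ᵥ Z) a ≤ 0 := by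
    intro a ha
    have hca : M.c a = 0 := by
      by_contra h
      exact (hpos a h).ne' ha
    have h1 : (M.T *ᵥ z') a = (M.R s *ᵥ z) ⟨a, hca⟩ + s * z ⟨a, hca⟩ := by
      simp only [mulVec, dotProduct]
      rw [sum_phases (M := M)]
      rw [Finset.sum_eq_zero (fun k _ => by rw [hz'1 _ k.2.ne', mul_zero]),
        Finset.sum_eq_zero (fun k _ => by rw [hz'1 _ k.2.ne, mul_zero]), zero_add, zero_add]
      simp only [R, T00, Matrix.sub_apply, Matrix.smul_apply, submatrix_apply, sub_mul, Finset.sum_sub_distrib,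
        hz'0, Matrix.one_apply, smul_eq_mul, mul_ite, mul_one, mul_zero, ite_mul, zero_mul,
        Finset.sum_ite_eq, Finset.mem_univ, if_true]
      ring
    have h2 := hTf ⟨a, hca⟩
    have h3 := hz ⟨a, hca⟩
    have h4 : z ⟨a, hca⟩ = t * f a := by
      have h5 := hz'0 ⟨a, hca⟩
      simp only [Z, Pi.sub_apply, Pi.smul_apply, smul_eq_mul] at ha
      simp only at h5
      linarith
    simp only [Z, mulVec_sub, mulVec_smul, Pi.sub_apply, Pi.smul_apply, smul_eq_mul, h1, h4]
    simp only at h2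
    nlinarith
  have hzero := metzler_T.eq_zero_of_zero irred_T hZ hTZ hZm
  obtain ⟨u, hu⟩ := M.exists_up
  exact (hpos u hu.ne').ne' (congrFun hzero u)

lemma exists_S1 : Nonempty M.S1 := let ⟨u, hu⟩ := M.exists_up; ⟨⟨u, hu⟩⟩

lemma exists_S2 : Nonempty M.S2 := let ⟨u, hu⟩ := M.exists_down; ⟨⟨u, hu⟩⟩

/-- Where `Ψ(s)` is finite, `T₀₀ - s I` obeys the minimum principle. -/
theorem minPrinciple_R {s : ℝ} (h : M.PsiFinite s) : MinPrinciple (M.R s) := by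
  obtain ⟨j⟩ := exists_S2 (M := M)
  refine minPrinciple_R_of_pos (f := fun a => (M.passageLST s a j 1).toReal) (fun a =>
    ENNReal.toReal_pos (passageLST_pos s a j one_pos).ne' (passageLST_lt_top h a j zero_le_one).ne)
    fun a => ?_
  have h1 := (passageLST_S0 h a j zero_le_one).2
  simp only [mulVec, dotProduct]
  rw [← Finset.add_sum_erase _ _ (Finset.mem_univ a.1), ← h1, rate]
  exact (by ring : _ = _).le

lemma C1_inv : M.C1⁻¹ = diagonal fun i : M.S1 => (M.c i)⁻¹ := by
  refine inv_eq_right_inv ?_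
  rw [C1, diagonal_mul_diagonal, ← diagonal_one]
  congr 1
  funext i
  exact mul_inv_cancel₀ i.2.ne'

lemma C2_inv : M.C2⁻¹ = diagonal fun i : M.S2 => |M.c i|⁻¹ := by
  refine inv_eq_right_inv ?_
  rw [C2, diagonal_mul_diagonal, ← diagonal_one]
  congr 1
  funext i
  exact mul_inv_cancel₀ (abs_pos.2 i.2.ne).ne'

/-- If `k y t` is close to `L` on the shrinking intervals `(0, y / c]`, then its integral divided by
`y` tends to `L / c`. -/
lemma tendsto_lintegral_div {k : ℝ → ℝ → ℝ≥0∞} {L c : ℝ} (hc : 0 < c) (hL : 0 ≤ L)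
    (h : ∀ ε > 0, ∀ᶠ y in 𝓝[>] (0 : ℝ), ∀ t ∈ Set.Ioc 0 (y / c),
      ENNReal.ofReal (L - ε) ≤ k y t ∧ k y t ≤ ENNReal.ofReal (L + ε)) :
    Tendsto (fun y => (∫⁻ t in Set.Ioc 0 (y / c), k y t).toReal / y) (𝓝[>] 0) (𝓝 (L / c)) := by
  rw [Metric.tendsto_nhds]
  intro ε hε
  filter_upwards [h (ε * c / 2) (by positivity), self_mem_nhdsWithin] with y hy hy0
  have hy0 : 0 < y := hy0
  have hyc : 0 < y / c := div_pos hy0 hc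
  have hup : ∫⁻ t in Set.Ioc 0 (y / c), k y t ≤ ENNReal.ofReal ((L + ε * c / 2) * (y / c)) := by
    calc ∫⁻ t in Set.Ioc 0 (y / c), k y t
        ≤ ∫⁻ t in Set.Ioc 0 (y / c), ENNReal.ofReal (L + ε * c / 2) :=
          setLIntegral_mono measurable_const fun t ht => (hy t ht).2
      _ = _ := by
          rw [setLIntegral_const, Real.volume_Ioc, sub_zero, ENNReal.ofReal_mul (by positivity)]
  have hlo : ENNReal.ofReal ((L - ε * c / 2) * (y / c)) ≤ ∫⁻ t in Set.Ioc 0 (y / c), k y t := by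
    calc ENNReal.ofReal ((L - ε * c / 2) * (y / c))
        = ∫⁻ t in Set.Ioc 0 (y / c), ENNReal.ofReal (L - ε * c / 2) := by
          rw [setLIntegral_const, Real.volume_Ioc, sub_zero, ENNReal.ofReal_mul' hyc.le]
      _ ≤ _ := setLIntegral_mono' measurableSet_Ioc fun t ht => (hy t ht).1
  have hfin : ∫⁻ t in Set.Ioc 0 (y / c), k y t ≠ ∞ := (hup.trans_lt ENNReal.ofReal_lt_top).ne
  have h1 := ENNReal.toReal_le_of_le_ofReal (by positivity) hup
  have h2 := (ENNReal.ofReal_le_iff_le_toReal hfin).1 hlo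
  rw [Real.dist_eq, abs_sub_lt_iff]
  have e1 : (L + ε * c / 2) * (y / c) / y = L / c + ε / 2 := by field_simp
  have e2 : (L - ε * c / 2) * (y / c) / y = L / c - ε / 2 := by field_simp
  have h3 := div_le_div_of_nonneg_right h1 hy0.le
  have h4 := div_le_div_of_nonneg_right h2 hy0.le
  rw [e1] at h3
  rw [e2] at h4
  constructor <;> linarith

section Derivative

lemma durations_of_neg {a : Fin n} (ha : M.c a < 0) (y : ℝ) :
    M.durations a y = Set.Ioc 0 (y / |M.c a|) := by
  ext t
  simp only [durations, Set.mem_ofPred_eq, Set.mem_Ioc, abs_of_neg ha, le_div_iff₀ (neg_pos.2 ha)]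
  refine and_congr_right fun _ => ?_
  constructor <;> intro h <;> linarith

variable {s : ℝ} (h : M.PsiFinite s)
include h

/-- The passage weights are bounded on `[0, 1]`. -/
lemma exists_passageLST_le (a : Fin n) (j : M.S2) :
    ∃ C < ∞, ∀ y, 0 ≤ y → y ≤ 1 → M.passageLST s a j y ≤ C := by
  set ε := ENNReal.ofReal (Real.exp (-(|M.rate j + s| * (1 / |M.c j|)))) with hε
  have hε0 : ε ≠ 0 := (ENNReal.ofReal_pos.2 (Real.exp_pos _)).ne'
  have hcj : 0 < |M.c j| := abs_pos.2 j.2.ne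
  refine ⟨M.passageLST s a j 1 / ε, ENNReal.div_lt_top (passageLST_lt_top h a j zero_le_one).ne hε0,
    fun y hy hy1 => ?_⟩
  rw [ENNReal.le_div_iff_mul_le (.inl hε0) (.inl ENNReal.ofReal_ne_top)]
  have h1 := passageLST_add_S2 (M := M) s a j hy (sub_nonneg.2 hy1)
  rw [add_sub_cancel] at h1
  rw [h1]
  refine le_trans ?_ (Finset.single_le_sum (f := fun l : M.S2 =>
      M.passageLST s a l y * M.passageLST s l j (1 - y)) (fun _ _ => zero_le) (Finset.mem_univ j))
  refine mul_le_mul_right ((ENNReal.ofReal_le_ofReal (Real.exp_le_exp.2 (neg_le_neg ?_))).trans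
    (exp_le_passageLST s j (1 - y))) _
  calc (M.rate j + s) * ((1 - y) / |M.c j|) ≤ |M.rate j + s| * ((1 - y) / |M.c j|) :=
        mul_le_mul_of_nonneg_right (le_abs_self _) (div_nonneg (sub_nonneg.2 hy1) hcj.le)
    _ ≤ _ := by gcongr; linarith

/-- Right continuity at level `0`, from the decreasing phases. -/
lemma tendsto_passageLST_S2 (l j : M.S2) : Tendsto (fun y => (M.passageLST s l j y).toReal)
    (𝓝[≥] 0) (𝓝 (M.passageLST s l j 0).toReal) := by
  have hcl : 0 < |M.c l| := abs_pos.2 l.2.ne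
  choose C hC hCb using fun b : Fin n => exists_passageLST_le h b j
  set C' : ℝ≥0∞ := ENNReal.ofReal (Real.exp (|M.rate l + s| * (1 / |M.c l|))) *
    ∑ b ∈ Finset.univ.erase l.1, ENNReal.ofReal (M.T l b) * C b with hC'
  have hC'top : C' ≠ ∞ := ENNReal.mul_ne_top ENNReal.ofReal_ne_top (ENNReal.sum_ne_top.2 fun b _ =>
    ENNReal.mul_ne_top ENNReal.ofReal_ne_top (hC b).ne)
  have hJ : ∀ y, 0 ≤ y → y ≤ 1 → M.jumpStep s (fun b => M.passageLST s b j) l y ≤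
      C' * ENNReal.ofReal (y / |M.c l|) := by
    intro y hy hy1
    rw [jumpStep, durations_of_neg l.2]
    calc _ ≤ ∫⁻ t in Set.Ioc 0 (y / |M.c l|), C' := by
          refine setLIntegral_mono measurable_const fun t ht => ?_
          have ht1 : t ≤ 1 / |M.c l| := ht.2.trans (by gcongr)
          have ht2 : 0 ≤ y + M.c l * t := by
            have := (le_div_iff₀ hcl).1 ht.2
            rw [abs_of_neg l.2] at this
            linarith
          have ht3 : y + M.c l * t ≤ 1 := by
            have := mul_neg_of_neg_of_pos l.2 ht.1
            linarith
          refine mul_le_mul' (ENNReal.ofReal_le_ofReal (Real.exp_le_exp.2 ?_))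
            (Finset.sum_le_sum fun b _ => by gcongr; exact hCb b _ ht2 ht3)
          calc -((M.rate l + s) * t) ≤ |M.rate l + s| * t := by
                rw [← neg_mul]; exact mul_le_mul_of_nonneg_right (neg_le_abs _) ht.1.le
            _ ≤ _ := by gcongr
      _ = _ := by rw [setLIntegral_const, Real.volume_Ioc, sub_zero]
  have hJ0 : Tendsto (fun y => (M.jumpStep s (fun b => M.passageLST s b j) l y).toReal) (𝓝[≥] 0)
      (𝓝 0) := by
    have hlim : Tendsto (fun y => C'.toReal * (y / |M.c l|)) (𝓝[≥] 0) (𝓝 0) := by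
      have : Tendsto (fun y => C'.toReal * (y / |M.c l|)) (𝓝 0) (𝓝 (C'.toReal * (0 / |M.c l|))) :=
        (by fun_prop : Continuous fun y => C'.toReal * (y / |M.c l|)).tendsto 0
      rw [zero_div, mul_zero] at this
      exact this.mono_left nhdsWithin_le_nhds
    have hev : ∀ᶠ y in 𝓝[≥] (0 : ℝ), y ≤ 1 :=
      mem_nhdsWithin_of_mem_nhds (Iic_mem_nhds zero_lt_one)
    refine squeeze_zero' (.of_forall fun _ => ENNReal.toReal_nonneg) ?_ hlim
    filter_upwards [hev, self_mem_nhdsWithin] with y hy1 hy0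
    have hy0 : 0 ≤ y := hy0
    have := ENNReal.toReal_mono (ENNReal.mul_ne_top hC'top ENNReal.ofReal_ne_top) (hJ y hy0 hy1)
    rwa [ENNReal.toReal_mul, ENNReal.toReal_ofReal (by positivity)] at this
  have hp : Tendsto (fun y => (M.passage s j 0 l y).toReal) (𝓝[≥] 0)
      (𝓝 (M.passageLST s l j 0).toReal) := by
    rw [passageLST_zero]
    by_cases hlj : l = j
    · subst hlj
      simp only [passage_zero_of_neg l.2, ENNReal.toReal_ofReal (Real.exp_pos _).le, if_true,
        ENNReal.toReal_one]
      have : Tendsto (fun y => Real.exp (-((M.rate l + s) * (y / |M.c l|)))) (𝓝 0)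
          (𝓝 (Real.exp (-((M.rate l + s) * (0 / |M.c l|))))) :=
        (by fun_prop : Continuous fun y => Real.exp (-((M.rate l + s) * (y / |M.c l|)))).tendsto 0
      rw [zero_div, mul_zero, neg_zero, Real.exp_zero] at this
      exact this.mono_left nhdsWithin_le_nhds
    · have : ∀ y, M.passage s j 0 l y = 0 := passage_zero_of_ne fun h' => hlj (Subtype.ext h')
      simp only [this, if_neg hlj]
      exact tendsto_const_nhds
  have hsum := hp.add hJ0
  rw [add_zero] at hsum
  refine hsum.congr' ?_
  filter_upwards [self_mem_nhdsWithin] with y hy0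
  have hfin := (passageLST_lt_top h l j hy0).ne
  rw [passageLST_eq] at hfin ⊢
  rw [ENNReal.toReal_add (fun h' => hfin (by rw [h', top_add])) (fun h' => hfin (by rw [h', add_top]))]

lemma passageLST_toReal_eq_sum (a : Fin n) (j : M.S2) {y : ℝ} (hy : 0 ≤ y) :
    (M.passageLST s a j y).toReal =
      ∑ l : M.S2, (M.passageLST s a l 0).toReal * (M.passageLST s l j y).toReal := by
  have h1 := passageLST_add_S2 (M := M) s a j le_rfl hy
  rw [zero_add] at h1
  rw [h1, ENNReal.toReal_sum fun l _ => ENNReal.mul_ne_top (passageLST_lt_top h a l le_rfl).ne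
    (passageLST_lt_top h l j hy).ne]
  exact Finset.sum_congr rfl fun l _ => ENNReal.toReal_mul

lemma tendsto_passageLST (a : Fin n) (j : M.S2) : Tendsto (fun y => (M.passageLST s a j y).toReal)
    (𝓝[≥] 0) (𝓝 (M.passageLST s a j 0).toReal) := by
  rw [passageLST_toReal_eq_sum h a j le_rfl]
  have h1 : Tendsto (fun y => ∑ l : M.S2, (M.passageLST s a l 0).toReal *
      (M.passageLST s l j y).toReal) (𝓝[≥] 0) (𝓝 (∑ l : M.S2, (M.passageLST s a l 0).toReal *
      (M.passageLST s l j 0).toReal)) :=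
    tendsto_finsetSum _ fun l _ => (tendsto_passageLST_S2 h l j).const_mul _
  refine h1.congr' ?_
  filter_upwards [self_mem_nhdsWithin] with y hy
  exact (passageLST_toReal_eq_sum h a j hy).symm

/-- The contribution of a first jump out of phase `a` that takes place during a time `y / c` and at a
level in `[0, y]`, to first order in `y`. -/
lemma tendsto_inflow_div (a : Fin n) (j : M.S2) {c : ℝ} (hc : 0 < c) {z : ℝ → ℝ → ℝ}
    (hz : ∀ y t, t ∈ Set.Ioc 0 (y / c) → 0 ≤ z y t ∧ z y t ≤ y) :
    Tendsto (fun y => (∫⁻ t in Set.Ioc 0 (y / c), ENNReal.ofReal (Real.exp (-((M.rate a + s) * t))) *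
      ∑ b ∈ Finset.univ.erase a, ENNReal.ofReal (M.T a b) * M.passageLST s b j (z y t)).toReal / y)
      (𝓝[>] 0) (𝓝 ((∑ b ∈ Finset.univ.erase a, M.T a b * (M.passageLST s b j 0).toReal) / c)) := by
  set G : ℝ → ℝ := fun y => ∑ b ∈ Finset.univ.erase a, M.T a b * (M.passageLST s b j y).toReal with hG
  have hT : ∀ b ∈ Finset.univ.erase a, 0 ≤ M.T a b := fun b hb =>
    M.offDiag_nonneg _ _ (Finset.ne_of_mem_erase hb).symm
  have hGnn : ∀ y, 0 ≤ G y := fun y => Finset.sum_nonneg fun b hb =>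
    mul_nonneg (hT b hb) ENNReal.toReal_nonneg
  have hGt : Tendsto G (𝓝[≥] 0) (𝓝 (G 0)) :=
    tendsto_finsetSum _ fun b _ => (tendsto_passageLST h b j).const_mul _
  refine tendsto_lintegral_div hc (hGnn 0) fun ε hε => ?_
  have hprod : Tendsto (fun p : ℝ × ℝ => Real.exp (-((M.rate a + s) * p.1)) * G p.2)
      (𝓝 0 ×ˢ 𝓝[≥] 0) (𝓝 (G 0)) := by
    have h1 : Tendsto (fun t => Real.exp (-((M.rate a + s) * t))) (𝓝 0)
        (𝓝 (Real.exp (-((M.rate a + s) * 0)))) :=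
      (by fun_prop : Continuous fun t => Real.exp (-((M.rate a + s) * t))).tendsto 0
    rw [mul_zero, neg_zero, Real.exp_zero] at h1
    have := (h1.comp tendsto_fst).mul (hGt.comp (tendsto_snd (f := 𝓝 (0 : ℝ))))
    rwa [one_mul] at this
  have hev := (Metric.tendsto_nhds.1 hprod) ε hε
  obtain ⟨P, hP, Q, hQ, hPQ⟩ := Filter.eventually_prod_iff.1 hev
  obtain ⟨δ₁, hδ₁, h₁⟩ := Metric.eventually_nhds_iff.1 hP
  obtain ⟨δ₂, hδ₂, h₂⟩ := Metric.eventually_nhds_iff.1 (eventually_nhdsWithin_iff.1 hQ)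
  have hlt : ∀ᶠ y in 𝓝[>] (0 : ℝ), y < min (δ₁ * c) δ₂ :=
    mem_nhdsWithin_of_mem_nhds (Iio_mem_nhds (lt_min (mul_pos hδ₁ hc) hδ₂))
  filter_upwards [hlt, self_mem_nhdsWithin] with y hy hy0 t ht
  have hy0 : 0 < y := hy0
  obtain ⟨hz0, hzy⟩ := hz y t ht
  have ht1 : P t := h₁ (by
    rw [Real.dist_eq, sub_zero, abs_of_pos ht.1]
    refine ht.2.trans_lt ?_
    rw [div_lt_iff₀ hc]
    exact hy.trans_le (min_le_left _ _))
  have hz1 : Q (z y t) := h₂ (by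
    rw [Real.dist_eq, sub_zero, abs_of_nonneg hz0]
    exact hzy.trans_lt (hy.trans_le (min_le_right _ _))) hz0
  have hd := hPQ ht1 hz1
  rw [Real.dist_eq, abs_sub_lt_iff] at hd
  have hk : ENNReal.ofReal (Real.exp (-((M.rate a + s) * t))) *
      ∑ b ∈ Finset.univ.erase a, ENNReal.ofReal (M.T a b) * M.passageLST s b j (z y t) =
      ENNReal.ofReal (Real.exp (-((M.rate a + s) * t)) * G (z y t)) := by
    rw [ENNReal.ofReal_mul (Real.exp_pos _).le, hG, ENNReal.ofReal_sum_of_nonneg fun b hb =>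
      mul_nonneg (hT b hb) ENNReal.toReal_nonneg]
    congr 1
    refine Finset.sum_congr rfl fun b hb => ?_
    rw [ENNReal.ofReal_mul (hT b hb), ENNReal.ofReal_toReal (passageLST_lt_top h b j hz0).ne]
  rw [hk]
  exact ⟨ENNReal.ofReal_le_ofReal (by linarith [hd.2]), ENNReal.ofReal_le_ofReal (by linarith [hd.1])⟩

omit h in
lemma tendsto_exp_sub_one_div (q : ℝ) :
    Tendsto (fun y => (Real.exp (-(q * y)) - 1) / y) (𝓝[>] 0) (𝓝 (-q)) := by
  have h1 : HasDerivAt (fun y => Real.exp (-(q * y))) (-q) 0 := by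
    have := ((hasDerivAt_id (0 : ℝ)).const_mul q).neg.exp
    simpa using this
  have h2 := h1.tendsto_slope_zero_right
  simpa [div_eq_inv_mul] using h2

omit h in
lemma sum_erase_eq (a : Fin n) (f : Fin n → ℝ) :
    ∑ b ∈ Finset.univ.erase a, M.T a b * f b = (M.T *ᵥ f) a + M.rate a * f a := by
  simp only [mulVec, dotProduct]
  rw [← Finset.add_sum_erase _ _ (Finset.mem_univ a), rate]
  ring

/-- The right derivative at level `0` of the passage weights from the decreasing phases. -/
lemma tendsto_slope_S2 (l j : M.S2) :
    Tendsto (fun y => ((M.passageLST s l j y).toReal - (M.passageLST s l j 0).toReal) / y) (𝓝[>] 0)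
      (𝓝 (((M.T *ᵥ fun b => (M.passageLST s b j 0).toReal) l -
        s * (M.passageLST s l j 0).toReal) / |M.c l|)) := by
  have hcl : 0 < |M.c l| := abs_pos.2 l.2.ne
  have h1 := tendsto_inflow_div h l j hcl (z := fun y t => y + M.c l * t) fun y t ht => by
    have h1 := (le_div_iff₀ hcl).1 ht.2
    have h2 := mul_neg_of_neg_of_pos l.2 ht.1
    rw [abs_of_neg l.2] at h1
    exact ⟨by linarith, by linarith⟩
  have h2 : Tendsto (fun y => ((M.passage s j 0 l y).toReal - (M.passageLST s l j 0).toReal) / y)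
      (𝓝[>] 0) (𝓝 (-((M.rate l + s) / |M.c l|) * (M.passageLST s l j 0).toReal)) := by
    rw [passageLST_zero]
    by_cases hlj : l = j
    · subst hlj
      simp only [passage_zero_of_neg l.2, ENNReal.toReal_ofReal (Real.exp_pos _).le, if_true,
        ENNReal.toReal_one, mul_one]
      have := tendsto_exp_sub_one_div ((M.rate l + s) / |M.c l|)
      refine this.congr fun y => ?_
      rw [div_mul_eq_mul_div, mul_div_assoc]
    · have : ∀ y, M.passage s j 0 l y = 0 := passage_zero_of_ne fun h' => hlj (Subtype.ext h')
      simp only [this, if_neg hlj, ENNReal.toReal_zero, sub_zero, zero_div, mul_zero]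
      exact tendsto_const_nhds
  have h3 := h2.add h1
  rw [sum_erase_eq] at h3
  have e : -((M.rate l + s) / |M.c l|) * (M.passageLST s l j 0).toReal +
      ((M.T *ᵥ fun b => (M.passageLST s b j 0).toReal) l +
        M.rate l * (M.passageLST s l j 0).toReal) / |M.c l| =
      ((M.T *ᵥ fun b => (M.passageLST s b j 0).toReal) l -
        s * (M.passageLST s l j 0).toReal) / |M.c l| := by
    field_simp; ring
  rw [e] at h3
  refine h3.congr' ?_
  filter_upwards [self_mem_nhdsWithin] with y hy0
  have hfin := (passageLST_lt_top h l j (le_of_lt hy0)).ne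
  have he := passageLST_eq (M := M) s l j y
  rw [he] at hfin
  have he' := congrArg ENNReal.toReal he
  rw [ENNReal.toReal_add (fun h' => hfin (by rw [h', top_add])) (fun h' => hfin (by rw [h', add_top])),
    jumpStep, durations_of_neg l.2] at he'
  rw [he', ← add_div]
  congr 1
  ring

omit h in
/-- The first-jump equation in an increasing phase, split when the level reaches `y`. -/
lemma passageLST_S1_split (a : M.S1) (j : M.S2) {y : ℝ} (hy : 0 ≤ y) :
    M.passageLST s a j 0 = (∫⁻ t in Set.Ioc 0 (y / M.c a),
      ENNReal.ofReal (Real.exp (-((M.rate a + s) * t))) *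
      ∑ b ∈ Finset.univ.erase a.1, ENNReal.ofReal (M.T a b) * M.passageLST s b j (M.c a * t)) +
      ENNReal.ofReal (Real.exp (-((M.rate a + s) * (y / M.c a)))) * M.passageLST s a j y := by
  have hca := a.2
  set τ := y / M.c a with hτ
  have hτ0 : 0 ≤ τ := div_nonneg hy hca.le
  have hcτ : M.c a * τ = y := mul_div_cancel₀ _ hca.ne'
  rw [passageLST_eq (M := M) s a j 0, passageLST_eq (M := M) s a j y, passage_zero_of_nonneg hca.le,
    passage_zero_of_nonneg hca.le, zero_add, zero_add, jumpStep, jumpStep,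
    durations_of_nonneg hca.le le_rfl, durations_of_nonneg hca.le hy]
  simp only [zero_add]
  rw [← Set.Ioc_union_Ioi_eq_Ioi hτ0, lintegral_union measurableSet_Ioi
    (Set.Ioc_disjoint_Ioi le_rfl)]
  congr 1
  rw [Set.Ioc_union_Ioi_eq_Ioi hτ0, ← lintegral_indicator measurableSet_Ioi,
    ← lintegral_indicator measurableSet_Ioi, ← lintegral_const_mul' _ _ ENNReal.ofReal_ne_top,
    ← lintegral_add_left_eq_self _ τ]
  refine lintegral_congr fun t => ?_
  by_cases ht : 0 < t
  · rw [Set.indicator_of_mem (show τ + t ∈ Set.Ioi τ by simpa using ht),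
      Set.indicator_of_mem (show t ∈ Set.Ioi 0 from ht), ← mul_assoc,
      ← ENNReal.ofReal_mul (Real.exp_pos _).le, ← Real.exp_add, mul_add, mul_add, hcτ, neg_add]
  · rw [Set.indicator_of_notMem (show τ + t ∉ Set.Ioi τ by simpa using ht),
      Set.indicator_of_notMem (show t ∉ Set.Ioi 0 from ht), mul_zero]

/-- The Riccati equation, entry by entry: the passage from level `0` back to `0` is split when the level
first reaches `y`, and the terms of first order in `y` are collected. -/
lemma riccati_entry (a : M.S1) (j : M.S2) :
    ((M.T *ᵥ fun b => (M.passageLST s b j 0).toReal) a - s * (M.passageLST s a j 0).toReal) / M.c a +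
      ∑ l : M.S2, (M.passageLST s a l 0).toReal *
        (((M.T *ᵥ fun b => (M.passageLST s b j 0).toReal) l -
        s * (M.passageLST s l j 0).toReal) / |M.c l|) = 0 := by
  have hca := a.2
  have h1 := tendsto_inflow_div h a j hca (z := fun y t => M.c a * t) fun y t ht =>
    ⟨mul_nonneg hca.le ht.1.le, by
      have := (le_div_iff₀ hca).1 ht.2
      linarith⟩
  rw [sum_erase_eq] at h1
  have h2 : Tendsto (fun y => (Real.exp (-((M.rate a + s) / M.c a * y)) - 1) / y *
      (M.passageLST s a j y).toReal) (𝓝[>] 0)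
      (𝓝 (-((M.rate a + s) / M.c a) * (M.passageLST s a j 0).toReal)) :=
    (tendsto_exp_sub_one_div _).mul
      ((tendsto_passageLST h a j).mono_left (nhdsWithin_mono _ Set.Ioi_subset_Ici_self))
  have h3 : Tendsto (fun y => ∑ l : M.S2, (M.passageLST s a l 0).toReal *
      (((M.passageLST s l j y).toReal - (M.passageLST s l j 0).toReal) / y)) (𝓝[>] 0)
      (𝓝 (∑ l : M.S2, (M.passageLST s a l 0).toReal *
        (((M.T *ᵥ fun b => (M.passageLST s b j 0).toReal) l -
        s * (M.passageLST s l j 0).toReal) / |M.c l|))) :=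
    tendsto_finsetSum _ fun l _ => (tendsto_slope_S2 h l j).const_mul _
  have h4 := (h1.add h2).add h3
  have e : ((M.T *ᵥ fun b => (M.passageLST s b j 0).toReal) a +
      M.rate a * (M.passageLST s a j 0).toReal) / M.c a +
      -((M.rate a + s) / M.c a) * (M.passageLST s a j 0).toReal =
      ((M.T *ᵥ fun b => (M.passageLST s b j 0).toReal) a - s * (M.passageLST s a j 0).toReal) /
        M.c a := by
    field_simp; ring
  rw [e] at h4
  refine tendsto_nhds_unique (h4.congr' ?_) (tendsto_const_nhds (x := (0 : ℝ)))
  filter_upwards [self_mem_nhdsWithin] with y hy0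
  have hy0 : 0 < y := hy0
  have hs := passageLST_S1_split (s := s) a j hy0.le
  have hfin := (passageLST_lt_top h a j le_rfl).ne
  rw [hs] at hfin
  have hs' := congrArg ENNReal.toReal hs
  rw [ENNReal.toReal_add (fun h' => hfin (by rw [h', top_add])) (fun h' => hfin (by rw [h', add_top])),
    ENNReal.toReal_mul, ENNReal.toReal_ofReal (Real.exp_pos _).le] at hs'
  have h5 : ∑ l : M.S2, (M.passageLST s a l 0).toReal *
      (((M.passageLST s l j y).toReal - (M.passageLST s l j 0).toReal) / y) =
      ((M.passageLST s a j y).toReal - (M.passageLST s a j 0).toReal) / y := by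
    rw [passageLST_toReal_eq_sum h a j hy0.le, passageLST_toReal_eq_sum h a j le_rfl,
      ← Finset.sum_sub_distrib, Finset.sum_div]
    exact Finset.sum_congr rfl fun l _ => by ring
  rw [h5, show (M.rate a + s) / M.c a * y = (M.rate a + s) * (y / M.c a) by ring]
  rw [div_mul_eq_mul_div, ← add_div, ← add_div, div_eq_zero_iff]
  left
  linarith

/-- The passage weights from level `0` and the phases with rate `0`, in terms of `Ψ`. -/
lemma passageLST_S0_eq (hR : IsUnit (M.R s)) :
    (Matrix.of fun (a : M.S0) (j : M.S2) => (M.passageLST s a j 0).toReal) =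
      -((M.R s)⁻¹ * (M.T01 * M.Psi s + M.T02)) := by
  set F0 := Matrix.of fun (a : M.S0) (j : M.S2) => (M.passageLST s a j 0).toReal with hF0
  have h1 : M.R s * F0 = -(M.T01 * M.Psi s + M.T02) := by
    ext a j
    have h2 := (passageLST_S0 h a j le_rfl).2
    rw [sum_erase_eq] at h2
    have h3 : (M.T *ᵥ fun b => (M.passageLST s b j 0).toReal) a =
        (M.T01 * M.Psi s + M.T02) a j + (M.T00 * F0) a j := by
      simp only [mulVec, dotProduct]
      rw [sum_phases (M := M)]
      simp only [Matrix.mul_apply, Matrix.add_apply, T01, T02, T00, submatrix_apply, hF0, of_apply, Psi,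
        psiLST_eq_passageLST]
      congr 2
      simp [passageLST_zero, apply_ite ENNReal.toReal]
    rw [R, Matrix.sub_mul, Matrix.smul_mul, Matrix.one_mul, Matrix.sub_apply, Matrix.smul_apply, smul_eq_mul,
      Matrix.neg_apply]
    rw [h3] at h2
    simp only [hF0, of_apply] at h2 ⊢
    linarith
  rw [← Matrix.mul_neg, ← h1, ← Matrix.mul_assoc, nonsing_inv_mul _ ((isUnit_iff_isUnit_det _).1 hR),
    Matrix.one_mul]

/-- **The Riccati equation** for `Ψ(s)`. -/
theorem riccati_Psi : riccati (M.Q11 s) (M.Q12 s) (M.Q21 s) (M.Q22 s) (M.Psi s) = 0 := by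
  have hR := (isUnit_and_inv_nonpos (minPrinciple_R h)).1
  have hF0 := passageLST_S0_eq h hR
  have hS1 : (Matrix.of fun (a : M.S1) (j : M.S2) =>
      ((M.T *ᵥ fun b => (M.passageLST s b j 0).toReal) a - s * (M.passageLST s a j 0).toReal) /
        M.c a) = M.Q12 s + M.Q11 s * M.Psi s := by
    have e : M.Q12 s + M.Q11 s * M.Psi s = M.C1⁻¹ * (M.T11 * M.Psi s + M.T12 +
        M.T10 * -((M.R s)⁻¹ * (M.T01 * M.Psi s + M.T02)) - s • M.Psi s) := by
      simp only [Q12, Q11, Matrix.mul_assoc, ← Matrix.mul_add]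
      congr 1
      simp only [Matrix.sub_mul, Matrix.mul_add, Matrix.mul_neg, Matrix.smul_mul, Matrix.one_mul,
        Matrix.mul_assoc]
      abel
    rw [e, ← hF0, C1_inv]
    ext a j
    rw [diagonal_mul, of_apply, div_eq_inv_mul]
    congr 1
    simp only [mulVec, dotProduct]
    rw [sum_phases (M := M)]
    simp only [Matrix.sub_apply, Matrix.smul_apply, smul_eq_mul, Matrix.mul_apply, Matrix.add_apply, T11, T12, T10,
      submatrix_apply, of_apply, Psi, psiLST_eq_passageLST]
    congr 3
    simp [passageLST_zero, apply_ite ENNReal.toReal]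
  have hS2 : (Matrix.of fun (l : M.S2) (j : M.S2) =>
      ((M.T *ᵥ fun b => (M.passageLST s b j 0).toReal) l - s * (M.passageLST s l j 0).toReal) /
        |M.c l|) = M.Q22 s + M.Q21 s * M.Psi s := by
    have e : M.Q22 s + M.Q21 s * M.Psi s = M.C2⁻¹ * (M.T21 * M.Psi s + M.T22 +
        M.T20 * -((M.R s)⁻¹ * (M.T01 * M.Psi s + M.T02)) - s • (1 : Matrix M.S2 M.S2 ℝ)) := by
      simp only [Q22, Q21, Matrix.mul_assoc, ← Matrix.mul_add]
      congr 1
      simp only [Matrix.sub_mul, Matrix.mul_add, Matrix.mul_neg, Matrix.mul_assoc]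
      abel
    rw [e, ← hF0, C2_inv]
    ext l j
    rw [diagonal_mul, of_apply, div_eq_inv_mul]
    congr 1
    simp only [mulVec, dotProduct]
    rw [sum_phases (M := M)]
    simp only [Matrix.sub_apply, Matrix.smul_apply, smul_eq_mul, Matrix.mul_apply, Matrix.add_apply, T21, T22, T20,
      submatrix_apply, of_apply, Psi, psiLST_eq_passageLST, Matrix.one_apply]
    congr 1
    · congr 2
      simp [passageLST_zero, apply_ite ENNReal.toReal]
    · simp [passageLST_zero, apply_ite ENNReal.toReal]
  have hsum : riccati (M.Q11 s) (M.Q12 s) (M.Q21 s) (M.Q22 s) (M.Psi s) =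
      (M.Q12 s + M.Q11 s * M.Psi s) + M.Psi s * (M.Q22 s + M.Q21 s * M.Psi s) := by
    simp only [riccati, Matrix.mul_add, Matrix.mul_assoc]
    abel
  rw [hsum, ← hS1, ← hS2]
  ext a j
  rw [Matrix.add_apply, Matrix.mul_apply, Matrix.zero_apply]
  simp only [of_apply, Psi, psiLST_eq_passageLST]
  exact riccati_entry h a j

end Derivative

/-! ### Extension of vectors to the phases with rate `0` -/

lemma mulVec_phases (F : Fin n → ℝ) (a : Fin n) : (M.T *ᵥ F) a =
    ∑ k : M.S1, M.T a k * F k + ∑ k : M.S2, M.T a k * F k + ∑ k : M.S0, M.T a k * F k :=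
  sum_phases (M := M) fun k => M.T a k * F k

variable (M) in
/-- The extension of a vector on the phases with nonzero rate to all phases that solves `T z = s z`
on the phases with rate `0`. -/
def extend (s : ℝ) (z₁ : M.S1 → ℝ) (z₂ : M.S2 → ℝ) (a : Fin n) : ℝ :=
  if h₁ : 0 < M.c a then z₁ ⟨a, h₁⟩ else if h₂ : M.c a < 0 then z₂ ⟨a, h₂⟩ else
    (-((M.R s)⁻¹ *ᵥ (M.T01 *ᵥ z₁ + M.T02 *ᵥ z₂)))
      ⟨a, le_antisymm (not_lt.1 h₁) (not_lt.1 h₂)⟩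

section Extend

variable {s : ℝ} {z₁ : M.S1 → ℝ} {z₂ : M.S2 → ℝ}

lemma extend_S1 (a : M.S1) : M.extend s z₁ z₂ a = z₁ a := dif_pos a.2

lemma extend_S2 (a : M.S2) : M.extend s z₁ z₂ a = z₂ a := by
  rw [extend, dif_neg a.2.not_gt, dif_pos a.2]

lemma extend_S0 (a : M.S0) :
    M.extend s z₁ z₂ a = (-((M.R s)⁻¹ *ᵥ (M.T01 *ᵥ z₁ + M.T02 *ᵥ z₂))) a := by
  rw [extend, dif_neg a.2.not_gt, dif_neg a.2.not_lt]

lemma T01_nonneg (i : M.S0) (j : M.S1) : 0 ≤ M.T01 i j :=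
  M.offDiag_nonneg _ _ fun h => j.2.ne' (h ▸ i.2)
lemma T02_nonneg (i : M.S0) (j : M.S2) : 0 ≤ M.T02 i j :=
  M.offDiag_nonneg _ _ fun h => j.2.ne (h ▸ i.2)
lemma T10_nonneg (i : M.S1) (j : M.S0) : 0 ≤ M.T10 i j :=
  M.offDiag_nonneg _ _ fun h => i.2.ne' (h ▸ j.2)
lemma T20_nonneg (i : M.S2) (j : M.S0) : 0 ≤ M.T20 i j :=
  M.offDiag_nonneg _ _ fun h => i.2.ne (h ▸ j.2)
lemma T12_nonneg (i : M.S1) (j : M.S2) : 0 ≤ M.T12 i j :=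
  M.offDiag_nonneg _ _ fun h => i.2.not_gt (h ▸ j.2)
lemma T21_nonneg (i : M.S2) (j : M.S1) : 0 ≤ M.T21 i j :=
  M.offDiag_nonneg _ _ fun h => i.2.not_gt (h ▸ j.2)

lemma T_mulVec_extend_S0 (hR : IsUnit (M.R s)) (a : M.S0) :
    (M.T *ᵥ M.extend s z₁ z₂) a = s * M.extend s z₁ z₂ a := by
  have h1 : M.R s *ᵥ (-((M.R s)⁻¹ *ᵥ (M.T01 *ᵥ z₁ + M.T02 *ᵥ z₂))) =
      -(M.T01 *ᵥ z₁ + M.T02 *ᵥ z₂) := by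
    rw [mulVec_neg, mulVec_mulVec, mul_nonsing_inv _ ((isUnit_iff_isUnit_det _).1 hR), one_mulVec]
  have h2 := congrFun h1 a
  simp only [extend_S0]
  set z₀ := -((M.R s)⁻¹ *ᵥ (M.T01 *ᵥ z₁ + M.T02 *ᵥ z₂)) with hz₀
  rw [R, sub_mulVec, smul_mulVec, one_mulVec] at h2
  rw [mulVec_phases]
  simp only [extend_S1, extend_S2, extend_S0, ← hz₀]
  simp only [Pi.sub_apply, Pi.neg_apply, Pi.add_apply, Pi.smul_apply, smul_eq_mul, mulVec,
    dotProduct, T01, T02, T00, submatrix_apply] at h2 ⊢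
  linarith

lemma T_mulVec_extend_S1 (a : M.S1) : (M.T *ᵥ M.extend s z₁ z₂) a =
    M.c a * (M.Q11 s *ᵥ z₁ + M.Q12 s *ᵥ z₂) a + s * z₁ a := by
  have e : M.C1 *ᵥ (M.Q11 s *ᵥ z₁ + M.Q12 s *ᵥ z₂) =
      M.T11 *ᵥ z₁ - s • z₁ + M.T12 *ᵥ z₂ +
        M.T10 *ᵥ (-((M.R s)⁻¹ *ᵥ (M.T01 *ᵥ z₁ + M.T02 *ᵥ z₂))) := by
    have hC : M.C1 * M.C1⁻¹ = 1 := by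
      rw [C1_inv, C1, diagonal_mul_diagonal, ← diagonal_one]
      congr 1
      funext i
      exact mul_inv_cancel₀ i.2.ne'
    rw [mulVec_add, mulVec_mulVec, mulVec_mulVec, Q11, Q12, ← Matrix.mul_assoc, ← Matrix.mul_assoc,
      hC, Matrix.one_mul, Matrix.one_mul]
    simp only [sub_mulVec, smul_mulVec, one_mulVec, mulVec_neg, mulVec_add, mulVec_mulVec,
      Matrix.mul_assoc]
    abel
  have e1 := congrFun e a
  rw [C1, mulVec_diagonal] at e1
  rw [mulVec_phases, e1]
  simp only [extend_S1, extend_S2, extend_S0]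
  simp only [Pi.sub_apply, Pi.add_apply, Pi.smul_apply, smul_eq_mul, mulVec, dotProduct, T11, T12,
    T10, submatrix_apply]
  ring

lemma T_mulVec_extend_S2 (a : M.S2) : (M.T *ᵥ M.extend s z₁ z₂) a =
    |M.c a| * (M.Q21 s *ᵥ z₁ + M.Q22 s *ᵥ z₂) a + s * z₂ a := by
  have e : M.C2 *ᵥ (M.Q21 s *ᵥ z₁ + M.Q22 s *ᵥ z₂) =
      M.T21 *ᵥ z₁ - s • z₂ + M.T22 *ᵥ z₂ +
        M.T20 *ᵥ (-((M.R s)⁻¹ *ᵥ (M.T01 *ᵥ z₁ + M.T02 *ᵥ z₂))) := by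
    have hC : M.C2 * M.C2⁻¹ = 1 := by
      rw [C2_inv, C2, diagonal_mul_diagonal, ← diagonal_one]
      congr 1
      funext i
      exact mul_inv_cancel₀ (abs_pos.2 i.2.ne).ne'
    rw [mulVec_add, mulVec_mulVec, mulVec_mulVec, Q21, Q22, ← Matrix.mul_assoc, ← Matrix.mul_assoc,
      hC, Matrix.one_mul, Matrix.one_mul]
    simp only [sub_mulVec, smul_mulVec, one_mulVec, mulVec_neg, mulVec_add, mulVec_mulVec,
      Matrix.mul_assoc]
    abel
  have e1 := congrFun e a
  rw [C2, mulVec_diagonal] at e1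
  rw [mulVec_phases, e1]
  simp only [extend_S1, extend_S2, extend_S0]
  simp only [Pi.sub_apply, Pi.add_apply, Pi.smul_apply, smul_eq_mul, mulVec, dotProduct, T21, T22,
    T20, submatrix_apply]
  ring

variable (hR : MinPrinciple (M.R s))
include hR

lemma extend_nonneg (h1 : ∀ i, 0 ≤ z₁ i) (h2 : ∀ i, 0 ≤ z₂ i) (a : Fin n) :
    0 ≤ M.extend s z₁ z₂ a := by
  rw [extend]
  split_ifs
  · exact h1 _
  · exact h2 _
  · rw [Pi.neg_apply, Left.nonneg_neg_iff, mulVec, dotProduct]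
    exact Finset.sum_nonpos fun k _ => mul_nonpos_of_nonpos_of_nonneg
      ((isUnit_and_inv_nonpos hR).2 _ _)
      (add_nonneg (mulVec_entry_nonneg T01_nonneg h1 k) (mulVec_entry_nonneg T02_nonneg h2 k))

/-- The block matrix `Q(s)` inherits irreducibility from `T`. -/
lemma Q_irreducible (h1 : ∀ i, 0 ≤ z₁ i) (h2 : ∀ i, 0 ≤ z₂ i)
    (e1 : ∀ i, z₁ i = 0 → (M.Q11 s *ᵥ z₁ + M.Q12 s *ᵥ z₂) i ≤ 0)
    (e2 : ∀ i, z₂ i = 0 → (M.Q21 s *ᵥ z₁ + M.Q22 s *ᵥ z₂) i ≤ 0) {a : Fin n}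
    (ha : M.extend s z₁ z₂ a = 0) : z₁ = 0 ∧ z₂ = 0 := by
  have hU := (isUnit_and_inv_nonpos hR).1
  have h0 := metzler_T.eq_zero_of_zero (irred_T (M := M)) (extend_nonneg hR h1 h2) (fun b hb => ?_) ha
  · constructor
    · funext i
      rw [← extend_S1 (s := s) (z₁ := z₁) (z₂ := z₂) i, h0]; rfl
    · funext i
      rw [← extend_S2 (s := s) (z₁ := z₁) (z₂ := z₂) i, h0]; rfl
  · rcases lt_trichotomy (M.c b) 0 with hc | hc | hc
    · have hz : z₂ ⟨b, hc⟩ = 0 := (extend_S2 (M := M) ⟨b, hc⟩).symm.trans hb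
      rw [T_mulVec_extend_S2 ⟨b, hc⟩, hz, mul_zero, add_zero]
      exact mul_nonpos_of_nonneg_of_nonpos (abs_nonneg _) (e2 _ hz)
    · rw [T_mulVec_extend_S0 hU ⟨b, hc⟩, hb, mul_zero]
    · have hz : z₁ ⟨b, hc⟩ = 0 := (extend_S1 (M := M) ⟨b, hc⟩).symm.trans hb
      rw [T_mulVec_extend_S1 ⟨b, hc⟩, hz, mul_zero, add_zero]
      exact mul_nonpos_of_nonneg_of_nonpos hc.le (e1 _ hz)

lemma extend_pos (h1 : ∀ i, 0 < z₁ i) (h2 : ∀ i, 0 < z₂ i) (a : Fin n) :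
    0 < M.extend s z₁ z₂ a := by
  refine lt_of_le_of_ne (extend_nonneg hR (fun i => (h1 i).le) (fun i => (h2 i).le) a) fun h => ?_
  obtain ⟨i⟩ := exists_S1 (M := M)
  have := (Q_irreducible hR (fun i => (h1 i).le) (fun i => (h2 i).le)
    (fun i hi => absurd hi (h1 i).ne') (fun i hi => absurd hi (h2 i).ne') h.symm).1
  exact (h1 i).ne' (congrFun this i)

end Extend

/-! ### Signs and irreducibility of the fluid generator -/

section Signs

variable {s : ℝ} (hR : MinPrinciple (M.R s))

lemma sandwich_nonpos {α β : Type*} {A : Matrix α M.S0 ℝ} {B : Matrix M.S0 β ℝ}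
    (hR : MinPrinciple (M.R s)) (hA : ∀ i j, 0 ≤ A i j) (hB : ∀ i j, 0 ≤ B i j) (i : α) (j : β) :
    (A * (M.R s)⁻¹ * B) i j ≤ 0 := by
  have h1 : ∀ i j, 0 ≤ (-(M.R s)⁻¹) i j := fun i j => by
    simpa using (isUnit_and_inv_nonpos hR).2 i j
  have := mul_entry_nonneg (mul_entry_nonneg hA h1) hB i j
  rw [Matrix.mul_neg, Matrix.neg_mul, Matrix.neg_apply] at this
  linarith

include hR

lemma Q12_nonneg (i j) : 0 ≤ M.Q12 s i j := by
  rw [Q12, C1_inv, diagonal_mul, Matrix.sub_apply]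
  exact mul_nonneg (inv_nonneg.2 i.2.le) (sub_nonneg.2
    ((sandwich_nonpos hR T10_nonneg T02_nonneg i j).trans (T12_nonneg i j)))

lemma Q21_nonneg (i j) : 0 ≤ M.Q21 s i j := by
  rw [Q21, C2_inv, diagonal_mul, Matrix.sub_apply]
  exact mul_nonneg (inv_nonneg.2 (abs_nonneg _)) (sub_nonneg.2
    ((sandwich_nonpos hR T20_nonneg T01_nonneg i j).trans (T21_nonneg i j)))

lemma metzler_Q11 : Metzler (M.Q11 s) := fun i j hij => by
  rw [Q11, C1_inv, diagonal_mul, Matrix.sub_apply, Matrix.sub_apply, Matrix.smul_apply,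
    Matrix.one_apply_ne hij, smul_zero, sub_zero]
  exact mul_nonneg (inv_nonneg.2 i.2.le) (sub_nonneg.2
    ((sandwich_nonpos hR T10_nonneg T01_nonneg i j).trans
      (M.offDiag_nonneg _ _ fun h => hij (Subtype.ext h))))

lemma metzler_Q22 : Metzler (M.Q22 s) := fun i j hij => by
  rw [Q22, C2_inv, diagonal_mul, Matrix.sub_apply, Matrix.sub_apply, Matrix.smul_apply,
    Matrix.one_apply_ne hij, smul_zero, sub_zero]
  exact mul_nonneg (inv_nonneg.2 (abs_nonneg _)) (sub_nonneg.2
    ((sandwich_nonpos hR T20_nonneg T02_nonneg i j).trans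
      (M.offDiag_nonneg _ _ fun h => hij (Subtype.ext h))))

lemma Q21_ne_zero : M.Q21 s ≠ 0 := fun h0 => by
  obtain ⟨i⟩ := exists_S1 (M := M)
  obtain ⟨j⟩ := exists_S2 (M := M)
  have := (Q_irreducible hR (z₁ := 1) (z₂ := 0) (fun _ => zero_le_one) (fun _ => le_rfl)
    (fun i hi => absurd hi one_ne_zero) (fun i _ => by simp [h0])
    (a := j) (extend_S2 j)).1
  exact one_ne_zero (congrFun this i)

variable {X : Matrix M.S1 M.S2 ℝ} (hX : ∀ i j, 0 < X i j)
include hX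

lemma metzler_K : Metzler (M.Q11 s + X * M.Q21 s) := fun i j hij =>
  add_nonneg (a := M.Q11 s i j) (metzler_Q11 hR i j hij)
    (mul_entry_nonneg (fun i j => (hX i j).le) (Q21_nonneg hR) i j)

lemma metzler_D : Metzler (M.Q22 s + M.Q21 s * X) := fun i j hij =>
  add_nonneg (a := M.Q22 s i j) (metzler_Q22 hR i j hij)
    (mul_entry_nonneg (Q21_nonneg hR) (fun i j => (hX i j).le) i j)

lemma irred_K : Irred (M.Q11 s + X * M.Q21 s) := by
  refine irred_of_forall fun z hz hKz i hi => ?_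
  obtain ⟨j⟩ := exists_S2 (M := M)
  have hQz := mulVec_entry_nonneg (Q21_nonneg hR) hz
  have hsplit : ∀ i, ((M.Q11 s + X * M.Q21 s) *ᵥ z) i =
      (M.Q11 s *ᵥ z) i + (X *ᵥ (M.Q21 s *ᵥ z)) i := fun i => by
    rw [add_mulVec, mulVec_mulVec, Pi.add_apply]
  have h11 : ∀ i, z i = 0 → 0 ≤ (M.Q11 s *ᵥ z) i := fun i hi => by
    rw [mulVec, dotProduct]
    refine Finset.sum_nonneg fun k _ => ?_
    by_cases h : i = k
    · rw [← h, hi, mul_zero]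
    · exact mul_nonneg (metzler_Q11 hR i k h) (hz k)
  have hXQ := mulVec_entry_nonneg (fun i j => (hX i j).le) hQz
  -- positivity of `X` forces `Q₂₁ z = 0`, so that `(z, 0)` is a test vector for `Q(s)`
  have hQ0 : M.Q21 s *ᵥ z = 0 := by
    by_contra hne
    have h1 := mulVec_pos_of_pos hX hQz hne i
    have h2 := hKz i hi
    rw [hsplit] at h2
    linarith [h11 i hi]
  exact (Q_irreducible hR (z₁ := z) (z₂ := 0) hz (fun _ => le_rfl) (fun k hk => by
      have h1 := hKz k hk
      rw [hsplit] at h1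
      simp only [mulVec_zero, add_zero]
      linarith [hXQ k])
    (fun k _ => by simp [hQ0]) (a := j) (extend_S2 j)).1

lemma irred_D : Irred (M.Q22 s + M.Q21 s * X) := by
  refine irred_of_forall fun z hz hDz i hi => ?_
  by_contra hne
  have hXz : ∀ i, 0 < (X *ᵥ z) i := mulVec_pos_of_pos hX hz hne
  exact hne (Q_irreducible hR (z₁ := X *ᵥ z) (z₂ := z) (fun i => (hXz i).le) hz
    (fun k hk => absurd hk (hXz k).ne')
    (fun k hk => by
      have := hDz k hk
      rwa [add_mulVec, ← mulVec_mulVec, add_comm] at this)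
    (a := i) ((extend_S2 i).trans hi)).2

end Signs

/-! ### Dependence of the fluid generator on `s` -/

lemma continuous_R : Continuous M.R := by
  unfold R
  fun_prop

section Slopes

variable {s s₀ : ℝ}

lemma resolvent_identity (h₀ : IsUnit (M.R s₀)) (h : IsUnit (M.R s)) :
    (M.R s)⁻¹ - (M.R s₀)⁻¹ = (s - s₀) • ((M.R s₀)⁻¹ * (M.R s)⁻¹) := by
  have e : M.R s₀ - M.R s = (s - s₀) • (1 : Matrix M.S0 M.S0 ℝ) := by
    rw [R, R, sub_smul]; abel
  calc (M.R s)⁻¹ - (M.R s₀)⁻¹ = (M.R s₀)⁻¹ * (M.R s₀ - M.R s) * (M.R s)⁻¹ := by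
        rw [Matrix.mul_sub, nonsing_inv_mul _ ((isUnit_iff_isUnit_det _).1 h₀), Matrix.sub_mul,
          Matrix.one_mul, Matrix.mul_assoc, mul_nonsing_inv _ ((isUnit_iff_isUnit_det _).1 h),
          Matrix.mul_one]
    _ = _ := by rw [e]; simp

variable (h₀ : IsUnit (M.R s₀)) (h : IsUnit (M.R s))
include h₀ h

lemma sandwich_sub {α β : Type*} (A : Matrix α M.S0 ℝ) (B : Matrix M.S0 β ℝ) :
    A * (M.R s)⁻¹ * B - A * (M.R s₀)⁻¹ * B = (s - s₀) • (A * ((M.R s₀)⁻¹ * (M.R s)⁻¹) * B) := by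
  rw [← Matrix.sub_mul, ← Matrix.mul_sub, resolvent_identity h₀ h, Matrix.mul_smul, Matrix.smul_mul]

lemma Q11_sub : M.Q11 s₀ - M.Q11 s =
    (s - s₀) • (M.C1⁻¹ * (1 + M.T10 * ((M.R s₀)⁻¹ * (M.R s)⁻¹) * M.T01)) := by
  rw [Q11, Q11, ← Matrix.mul_sub, ← Matrix.mul_smul, smul_add, ← sandwich_sub h₀ h, sub_smul]
  congr 1
  abel

lemma Q12_sub : M.Q12 s₀ - M.Q12 s =
    (s - s₀) • (M.C1⁻¹ * (M.T10 * ((M.R s₀)⁻¹ * (M.R s)⁻¹) * M.T02)) := by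
  rw [Q12, Q12, ← Matrix.mul_sub, ← Matrix.mul_smul, ← sandwich_sub h₀ h]
  congr 1
  abel

lemma Q21_sub : M.Q21 s₀ - M.Q21 s =
    (s - s₀) • (M.C2⁻¹ * (M.T20 * ((M.R s₀)⁻¹ * (M.R s)⁻¹) * M.T01)) := by
  rw [Q21, Q21, ← Matrix.mul_sub, ← Matrix.mul_smul, ← sandwich_sub h₀ h]
  congr 1
  abel

lemma Q22_sub : M.Q22 s₀ - M.Q22 s =
    (s - s₀) • (M.C2⁻¹ * (1 + M.T20 * ((M.R s₀)⁻¹ * (M.R s)⁻¹) * M.T02)) := by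
  rw [Q22, Q22, ← Matrix.mul_sub, ← Matrix.mul_smul, smul_add, ← sandwich_sub h₀ h, sub_smul]
  congr 1
  abel

end Slopes

section Limits

variable {s₀ : ℝ} (h₀ : MinPrinciple (M.R s₀))
include h₀

lemma eventually_minPrinciple_R : ∀ᶠ s in 𝓝 s₀, MinPrinciple (M.R s) :=
  Metzler.eventually_minPrinciple metzler_R continuous_R.continuousAt h₀

lemma tendsto_R_inv : Tendsto (fun s => (M.R s)⁻¹) (𝓝 s₀) (𝓝 (M.R s₀)⁻¹) :=
  by
  have hdet := (isUnit_iff_isUnit_det _).1 (isUnit_and_inv_nonpos h₀).1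
  exact (continuousAt_matrix_inv (M.R s₀)
    (NormedRing.inverse_continuousAt hdet.unit)).tendsto.comp (continuous_R.tendsto s₀)

lemma tendsto_sandwich {α β : Type*} (A : Matrix α M.S0 ℝ) (B : Matrix M.S0 β ℝ) :
    Tendsto (fun s => A * (M.R s)⁻¹ * B) (𝓝 s₀) (𝓝 (A * (M.R s₀)⁻¹ * B)) :=
  tendsto_matrix_mul (tendsto_matrix_mul tendsto_const_nhds (tendsto_R_inv h₀)) tendsto_const_nhds

lemma tendsto_sandwich_mul {α β : Type*} (A : Matrix α M.S0 ℝ) (B : Matrix M.S0 β ℝ) :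
    Tendsto (fun s => A * ((M.R s₀)⁻¹ * (M.R s)⁻¹) * B) (𝓝 s₀) (𝓝 (A * ((M.R s₀)⁻¹) ^ 2 * B)) := by
  rw [sq]
  exact tendsto_matrix_mul (tendsto_matrix_mul tendsto_const_nhds
    (tendsto_matrix_mul tendsto_const_nhds (tendsto_R_inv h₀))) tendsto_const_nhds

lemma tendsto_sandwich_sq {α β : Type*} (A : Matrix α M.S0 ℝ) (B : Matrix M.S0 β ℝ) :
    Tendsto (fun s => A * ((M.R s)⁻¹) ^ 2 * B) (𝓝 s₀) (𝓝 (A * ((M.R s₀)⁻¹) ^ 2 * B)) := by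
  simp only [sq]
  exact tendsto_matrix_mul (tendsto_matrix_mul tendsto_const_nhds
    (tendsto_matrix_mul (tendsto_R_inv h₀) (tendsto_R_inv h₀))) tendsto_const_nhds

lemma tendsto_Q11 : Tendsto M.Q11 (𝓝 s₀) (𝓝 (M.Q11 s₀)) :=
  tendsto_matrix_mul tendsto_const_nhds ((tendsto_const_nhds.sub
    (tendsto_id.smul_const _)).sub (tendsto_sandwich h₀ _ _))

lemma tendsto_Q12 : Tendsto M.Q12 (𝓝 s₀) (𝓝 (M.Q12 s₀)) :=
  tendsto_matrix_mul tendsto_const_nhds (tendsto_const_nhds.sub (tendsto_sandwich h₀ _ _))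

lemma tendsto_Q21 : Tendsto M.Q21 (𝓝 s₀) (𝓝 (M.Q21 s₀)) :=
  tendsto_matrix_mul tendsto_const_nhds (tendsto_const_nhds.sub (tendsto_sandwich h₀ _ _))

lemma tendsto_Q22 : Tendsto M.Q22 (𝓝 s₀) (𝓝 (M.Q22 s₀)) :=
  tendsto_matrix_mul tendsto_const_nhds ((tendsto_const_nhds.sub
    (tendsto_id.smul_const _)).sub (tendsto_sandwich h₀ _ _))

lemma tendsto_A11 : Tendsto M.A11 (𝓝 s₀) (𝓝 (M.A11 s₀)) :=
  tendsto_matrix_mul tendsto_const_nhds (tendsto_const_nhds.add (tendsto_sandwich_sq h₀ _ _))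

lemma tendsto_A12 : Tendsto M.A12 (𝓝 s₀) (𝓝 (M.A12 s₀)) :=
  tendsto_matrix_mul tendsto_const_nhds (tendsto_sandwich_sq h₀ _ _)

lemma tendsto_A21 : Tendsto M.A21 (𝓝 s₀) (𝓝 (M.A21 s₀)) :=
  tendsto_matrix_mul tendsto_const_nhds (tendsto_sandwich_sq h₀ _ _)

lemma tendsto_A22 : Tendsto M.A22 (𝓝 s₀) (𝓝 (M.A22 s₀)) :=
  tendsto_matrix_mul tendsto_const_nhds (tendsto_const_nhds.add (tendsto_sandwich_sq h₀ _ _))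

lemma tendsto_slope_aux {α β : Type*} {Q : ℝ → Matrix α β ℝ} {P : ℝ → Matrix α β ℝ}
    {A : Matrix α β ℝ}
    (hQ : ∀ s, IsUnit (M.R s) → Q s₀ - Q s = (s - s₀) • P s) (hP : Tendsto P (𝓝 s₀) (𝓝 A)) :
    Tendsto (fun s => (s - s₀)⁻¹ • (Q s₀ - Q s)) (𝓝[>] s₀) (𝓝 A) := by
  refine (hP.mono_left nhdsWithin_le_nhds).congr' ?_
  filter_upwards [self_mem_nhdsWithin,
    nhdsWithin_le_nhds (eventually_minPrinciple_R h₀)] with s hs hR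
  rw [hQ s (isUnit_and_inv_nonpos hR).1, smul_smul, inv_mul_cancel₀ (sub_pos.2 hs).ne', one_smul]

lemma tendsto_slope_Q11 :
    Tendsto (fun s => (s - s₀)⁻¹ • (M.Q11 s₀ - M.Q11 s)) (𝓝[>] s₀) (𝓝 (M.A11 s₀)) :=
  tendsto_slope_aux h₀ (fun _ hs => Q11_sub (isUnit_and_inv_nonpos h₀).1 hs)
    (tendsto_matrix_mul tendsto_const_nhds (tendsto_const_nhds.add (tendsto_sandwich_mul h₀ _ _)))

lemma tendsto_slope_Q12 :
    Tendsto (fun s => (s - s₀)⁻¹ • (M.Q12 s₀ - M.Q12 s)) (𝓝[>] s₀) (𝓝 (M.A12 s₀)) :=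
  tendsto_slope_aux h₀ (fun _ hs => Q12_sub (isUnit_and_inv_nonpos h₀).1 hs)
    (tendsto_matrix_mul tendsto_const_nhds (tendsto_sandwich_mul h₀ _ _))

lemma tendsto_slope_Q21 :
    Tendsto (fun s => (s - s₀)⁻¹ • (M.Q21 s₀ - M.Q21 s)) (𝓝[>] s₀) (𝓝 (M.A21 s₀)) :=
  tendsto_slope_aux h₀ (fun _ hs => Q21_sub (isUnit_and_inv_nonpos h₀).1 hs)
    (tendsto_matrix_mul tendsto_const_nhds (tendsto_sandwich_mul h₀ _ _))

lemma tendsto_slope_Q22 :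
    Tendsto (fun s => (s - s₀)⁻¹ • (M.Q22 s₀ - M.Q22 s)) (𝓝[>] s₀) (𝓝 (M.A22 s₀)) :=
  tendsto_slope_aux h₀ (fun _ hs => Q22_sub (isUnit_and_inv_nonpos h₀).1 hs)
    (tendsto_matrix_mul tendsto_const_nhds (tendsto_const_nhds.add (tendsto_sandwich_mul h₀ _ _)))

end Limits

/-! ### The interval of finiteness of `Ψ` -/

lemma ae_nonneg_of_Iio {ν : Measure ℝ} (hν : ν (Set.Iio 0) = 0) : ∀ᵐ x ∂ν, 0 ≤ x :=
  measure_mono_null (fun x hx => not_le.1 (show ¬ (0 : ℝ) ≤ x from hx)) hν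

lemma psiLST_antitone {s s' : ℝ} (hs : s ≤ s') (i : M.S1) (j : M.S2) :
    M.psiLST s' i j ≤ M.psiLST s i j := by
  obtain ⟨ν, hν, h⟩ := exists_measure_psiLST i j
  rw [h, h]
  have hae := ae_nonneg_of_Iio hν
  refine lintegral_mono_ae (hae.mono fun x hx => ENNReal.ofReal_le_ofReal (Real.exp_le_exp.2 ?_))
  nlinarith

lemma PsiFinite.mono {s s' : ℝ} (h : M.PsiFinite s) (hs : s ≤ s') : M.PsiFinite s' := fun i j =>
  (psiLST_antitone hs i j).trans_lt (h i j)

lemma psiFinite_zero : M.PsiFinite 0 := fun i j =>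
  (psiLST_zero_le_one i j).trans_lt ENNReal.one_lt_top

lemma Psi_antitone {s s' : ℝ} (h : M.PsiFinite s) (hs : s ≤ s') (i : M.S1) (j : M.S2) :
    M.Psi s' i j ≤ M.Psi s i j :=
  ENNReal.toReal_mono (h i j).ne (psiLST_antitone hs i j)

lemma Psi_pos {s : ℝ} (h : M.PsiFinite s) (i : M.S1) (j : M.S2) : 0 < M.Psi s i j :=
  ENNReal.toReal_pos (psiLST_pos s i j).ne' (h i j).ne

/-! ### Bounds from the Riccati equation -/

lemma Q11_diag_ge {s : ℝ} (hR : MinPrinciple (M.R s)) (i : M.S1) :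
    (M.c i)⁻¹ * (M.T i i - s) ≤ M.Q11 s i i := by
  rw [Q11, C1_inv, diagonal_mul]
  refine mul_le_mul_of_nonneg_left ?_ (inv_nonneg.2 i.2.le)
  have := sandwich_nonpos hR T10_nonneg T01_nonneg i i
  rw [Matrix.sub_apply, Matrix.sub_apply, Matrix.smul_apply, Matrix.one_apply_eq, smul_eq_mul,
    mul_one, T11, submatrix_apply]
  linarith

lemma Q22_diag_ge {s : ℝ} (hR : MinPrinciple (M.R s)) (j : M.S2) :
    |M.c j|⁻¹ * (M.T j j - s) ≤ M.Q22 s j j := by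
  rw [Q22, C2_inv, diagonal_mul]
  refine mul_le_mul_of_nonneg_left ?_ (inv_nonneg.2 (abs_nonneg _))
  have := sandwich_nonpos hR T20_nonneg T02_nonneg j j
  rw [Matrix.sub_apply, Matrix.sub_apply, Matrix.smul_apply, Matrix.one_apply_eq, smul_eq_mul,
    mul_one, T22, submatrix_apply]
  linarith

section Entries

variable {s : ℝ} (h : M.PsiFinite s)
include h

/-- An entry of the Riccati equation, with the diagonal terms singled out: all the terms in brackets
are nonnegative. -/
lemma riccati_offDiag (i : M.S1) (j : M.S2) :
    M.Q12 s i j + ∑ k ∈ Finset.univ.erase i, (M.Q11 s + M.Psi s * M.Q21 s) i k * M.Psi s k j +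
      (M.Psi s * M.Q21 s) i i * M.Psi s i j +
      ∑ l ∈ Finset.univ.erase j, M.Psi s i l * M.Q22 s l j =
      -(M.Q11 s i i + M.Q22 s j j) * M.Psi s i j := by
  have h1 : (M.Q12 s + (M.Q11 s + M.Psi s * M.Q21 s) * M.Psi s + M.Psi s * M.Q22 s) i j = 0 := by
    have := riccati_Psi h
    rw [riccati] at this
    rw [Matrix.add_mul, show M.Q12 s + (M.Q11 s * M.Psi s + M.Psi s * M.Q21 s * M.Psi s) +
      M.Psi s * M.Q22 s = M.Q12 s + M.Q11 s * M.Psi s + M.Psi s * M.Q22 s +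
      M.Psi s * M.Q21 s * M.Psi s by abel, this]
    rfl
  rw [Matrix.add_apply, Matrix.add_apply, Matrix.mul_apply, Matrix.mul_apply (M := M.Psi s),
    ← Finset.add_sum_erase _ _ (Finset.mem_univ i), ← Finset.add_sum_erase _ _ (Finset.mem_univ j),
    Matrix.add_apply] at h1
  linarith

lemma K_offDiag_nonneg (i k : M.S1) (hik : i ≠ k) : 0 ≤ (M.Q11 s + M.Psi s * M.Q21 s) i k :=
  metzler_K (minPrinciple_R h) (Psi_pos h) i k hik

lemma PsiQ21_nonneg (i k : M.S1) : 0 ≤ (M.Psi s * M.Q21 s) i k :=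
  mul_entry_nonneg (fun i j => (Psi_pos h i j).le) (Q21_nonneg (minPrinciple_R h)) i k

lemma riccati_terms_nonneg (i : M.S1) (j : M.S2) : 0 ≤ M.Q12 s i j ∧
    (∀ k ∈ Finset.univ.erase i, 0 ≤ (M.Q11 s + M.Psi s * M.Q21 s) i k * M.Psi s k j) ∧
    0 ≤ (M.Psi s * M.Q21 s) i i * M.Psi s i j ∧
    ∀ l ∈ Finset.univ.erase j, 0 ≤ M.Psi s i l * M.Q22 s l j :=
  ⟨Q12_nonneg (minPrinciple_R h) i j,
    fun k hk => mul_nonneg (K_offDiag_nonneg h i k (Finset.ne_of_mem_erase hk).symm)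
      (Psi_pos h k j).le,
    mul_nonneg (PsiQ21_nonneg h i i) (Psi_pos h i j).le,
    fun l hl => mul_nonneg (Psi_pos h i l).le
      (metzler_Q22 (minPrinciple_R h) l j (Finset.ne_of_mem_erase hl))⟩

lemma diag_nonpos (i : M.S1) (j : M.S2) : M.Q11 s i i + M.Q22 s j j ≤ 0 := by
  obtain ⟨h1, h2, h3, h4⟩ := riccati_terms_nonneg h i j
  have h5 := riccati_offDiag h i j
  have h6 := Finset.sum_nonneg h2
  have h7 := Finset.sum_nonneg h4
  by_contra! hpos
  have := mul_pos hpos (Psi_pos h i j)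
  linarith

end Entries

lemma bddBelow_psiFinite : BddBelow {s | M.PsiFinite s} := by
  obtain ⟨i⟩ := exists_S1 (M := M)
  obtain ⟨j⟩ := exists_S2 (M := M)
  have h1 : 0 < (M.c i)⁻¹ := inv_pos.2 i.2
  have h2 : 0 < |M.c j|⁻¹ := inv_pos.2 (abs_pos.2 j.2.ne)
  refine ⟨((M.c i)⁻¹ * M.T i i + |M.c j|⁻¹ * M.T j j) / ((M.c i)⁻¹ + |M.c j|⁻¹), fun s hs => ?_⟩
  rw [div_le_iff₀ (by positivity)]
  have h3 := diag_nonpos hs i j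
  have h4 := Q11_diag_ge (minPrinciple_R hs) i
  have h5 := Q22_diag_ge (minPrinciple_R hs) j
  linarith

/-- Nonnegativity of the increments of `Q`: `R(s₀)⁻¹ R(s)⁻¹` is a product of two nonpositive
matrices. -/
lemma sandwich_mul_nonneg {α β : Type*} {s s₀ : ℝ} {A : Matrix α M.S0 ℝ} {B : Matrix M.S0 β ℝ}
    (h₀ : MinPrinciple (M.R s₀)) (h : MinPrinciple (M.R s)) (hA : ∀ i j, 0 ≤ A i j)
    (hB : ∀ i j, 0 ≤ B i j) (i : α) (j : β) : 0 ≤ (A * ((M.R s₀)⁻¹ * (M.R s)⁻¹) * B) i j := by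
  refine mul_entry_nonneg (mul_entry_nonneg hA ?_) hB i j
  rw [← neg_mul_neg]
  exact mul_entry_nonneg (fun i j => by simpa using (isUnit_and_inv_nonpos h₀).2 i j)
    (fun i j => by simpa using (isUnit_and_inv_nonpos h).2 i j)

section Antitone

variable {s : ℝ} (h₀ : MinPrinciple (M.R 0)) (h : MinPrinciple (M.R s)) (hs : s ≤ 0)
include h₀ h hs

lemma Q21_zero_le (i j) : M.Q21 0 i j ≤ M.Q21 s i j := by
  have h1 := congrFun (congrFun (Q21_sub (isUnit_and_inv_nonpos h₀).1
    (isUnit_and_inv_nonpos h).1) i) j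
  rw [Matrix.sub_apply, Matrix.smul_apply, C2_inv, diagonal_mul, smul_eq_mul] at h1
  have h2 := mul_nonneg (inv_nonneg.2 (abs_nonneg (M.c i)))
    (sandwich_mul_nonneg h₀ h T20_nonneg T01_nonneg i j)
  nlinarith

lemma Q11_zero_le (i j) (hij : i ≠ j) : M.Q11 0 i j ≤ M.Q11 s i j := by
  have h1 := congrFun (congrFun (Q11_sub (isUnit_and_inv_nonpos h₀).1
    (isUnit_and_inv_nonpos h).1) i) j
  rw [Matrix.sub_apply, Matrix.smul_apply, C1_inv, diagonal_mul, smul_eq_mul, Matrix.add_apply,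
    Matrix.one_apply_ne hij, zero_add] at h1
  have h2 := mul_nonneg (inv_nonneg.2 i.2.le)
    (sandwich_mul_nonneg h₀ h T10_nonneg T01_nonneg i j)
  nlinarith

lemma Q22_zero_le (i j) (hij : i ≠ j) : M.Q22 0 i j ≤ M.Q22 s i j := by
  have h1 := congrFun (congrFun (Q22_sub (isUnit_and_inv_nonpos h₀).1
    (isUnit_and_inv_nonpos h).1) i) j
  rw [Matrix.sub_apply, Matrix.smul_apply, C2_inv, diagonal_mul, smul_eq_mul, Matrix.add_apply,
    Matrix.one_apply_ne hij, zero_add] at h1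
  have h2 := mul_nonneg (inv_nonneg.2 (abs_nonneg (M.c i)))
    (sandwich_mul_nonneg h₀ h T20_nonneg T02_nonneg i j)
  nlinarith

end Antitone

/-- `Ψ` is bounded on its interval of finiteness, to the left of `0`: the Riccati equation bounds
`(Ψ Q₂₁)ᵢᵢ`, hence some entry of `Ψ`, and it compares neighbouring entries of `Ψ`. -/
lemma Psi_bounded (i : M.S1) (j : M.S2) : ∃ C, ∀ s ≤ 0, M.PsiFinite s → M.Psi s i j ≤ C := by
  have hf0 := psiFinite_zero (M := M)
  have h₀ := minPrinciple_R hf0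
  -- the bound on the diagonal coefficient, uniform in `s ≤ 0`
  set c₀ : M.S1 → M.S2 → ℝ := fun i j => -((M.c i)⁻¹ * M.T i i + |M.c j|⁻¹ * M.T j j) with hc₀
  have hdiag : ∀ s ≤ 0, M.PsiFinite s → ∀ i j,
      -(M.Q11 s i i + M.Q22 s j j) * M.Psi s i j ≤ c₀ i j * M.Psi s i j := fun s hs h i j => by
    refine mul_le_mul_of_nonneg_right ?_ (Psi_pos h i j).le
    have h4 := Q11_diag_ge (minPrinciple_R h) i
    have h5 := Q22_diag_ge (minPrinciple_R h) j
    have h1 : 0 < (M.c i)⁻¹ := inv_pos.2 i.2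
    have h2 : 0 < |M.c j|⁻¹ := inv_pos.2 (abs_pos.2 j.2.ne)
    simp only [hc₀]
    nlinarith
  -- entries at `s ≤ 0` dominate those at `0`, so the edges of `K(0)` and `D(0)` can be used for all `s`
  have hPQ : ∀ s ≤ 0, M.PsiFinite s → ∀ i k, (M.Psi 0 * M.Q21 0) i k ≤ (M.Psi s * M.Q21 s) i k :=
    fun s hs h i k => by
      rw [Matrix.mul_apply, Matrix.mul_apply]
      exact Finset.sum_le_sum fun l _ => mul_le_mul (Psi_antitone h hs i l)
        (Q21_zero_le h₀ (minPrinciple_R h) hs l k) (Q21_nonneg h₀ l k) (Psi_pos h i l).le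
  have hedgeK : ∀ i k j, i ≠ k → ∀ s ≤ 0, M.PsiFinite s →
      (M.Q11 0 + M.Psi 0 * M.Q21 0) i k * M.Psi s k j ≤ c₀ i j * M.Psi s i j :=
    fun i k j hik s hs h => by
      obtain ⟨h1, h2, h3, h4⟩ := riccati_terms_nonneg h i j
      have h5 := riccati_offDiag h i j
      have h6 := Finset.single_le_sum h2 (Finset.mem_erase.2 ⟨hik.symm, Finset.mem_univ k⟩)
      have h7 := Finset.sum_nonneg h4
      have h8 := hdiag s hs h i j
      have h9 : (M.Q11 0 + M.Psi 0 * M.Q21 0) i k * M.Psi s k j ≤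
          (M.Q11 s + M.Psi s * M.Q21 s) i k * M.Psi s k j := by
        refine mul_le_mul_of_nonneg_right ?_ (Psi_pos h k j).le
        exact add_le_add (Q11_zero_le h₀ (minPrinciple_R h) hs i k hik) (hPQ s hs h i k)
      linarith
  have hdiagPQ : ∀ i j, ∀ s ≤ 0, M.PsiFinite s → (M.Psi s * M.Q21 s) i i ≤ c₀ i j :=
    fun i j s hs h => by
      obtain ⟨h1, h2, h3, h4⟩ := riccati_terms_nonneg h i j
      have h5 := riccati_offDiag h i j
      have h6 := Finset.sum_nonneg h2
      have h7 := Finset.sum_nonneg h4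
      have h8 := hdiag s hs h i j
      exact le_of_mul_le_mul_right (by linarith) (Psi_pos h i j)
  have hedge2 : ∀ i l j, l ≠ j → ∀ s ≤ 0, M.PsiFinite s →
      M.Psi s i l * M.Q22 0 l j ≤ c₀ i j * M.Psi s i j :=
    fun i l j hlj s hs h => by
      obtain ⟨h1, h2, h3, h4⟩ := riccati_terms_nonneg h i j
      have h5 := riccati_offDiag h i j
      have h6 := Finset.sum_nonneg h2
      have h7 := Finset.single_le_sum h4 (Finset.mem_erase.2 ⟨hlj, Finset.mem_univ l⟩)
      have h8 := hdiag s hs h i j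
      have h9 : M.Psi s i l * M.Q22 0 l j ≤ M.Psi s i l * M.Q22 s l j :=
        mul_le_mul_of_nonneg_left (Q22_zero_le h₀ (minPrinciple_R h) hs l j hlj) (Psi_pos h i l).le
      linarith
  have hedgeD : ∀ i l j, l ≠ j → ∀ s ≤ 0, M.PsiFinite s →
      M.Psi s i l * (M.Q22 0 + M.Q21 0 * M.Psi 0) l j ≤ (c₀ i j + c₀ i j) * M.Psi s i j :=
    fun i l j hlj s hs h => by
      obtain ⟨h1, h2, h3, h4⟩ := riccati_terms_nonneg h i j
      have hR := minPrinciple_R h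
      have h5 := riccati_offDiag h i j
      have h6 : M.Psi s i l * (M.Q21 0 * M.Psi 0) l j ≤ (M.Psi s * M.Q21 s * M.Psi s) i j := by
        rw [Matrix.mul_assoc, Matrix.mul_apply (M := M.Psi s)]
        refine le_trans (mul_le_mul_of_nonneg_left ?_ (Psi_pos h i l).le)
          (Finset.single_le_sum (f := fun l => M.Psi s i l * (M.Q21 s * M.Psi s) l j) (fun l _ =>
            mul_nonneg (Psi_pos h i l).le (mul_entry_nonneg (Q21_nonneg hR)
              (fun i j => (Psi_pos h i j).le) l j)) (Finset.mem_univ l))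
        rw [Matrix.mul_apply, Matrix.mul_apply]
        exact Finset.sum_le_sum fun k _ => mul_le_mul (Q21_zero_le h₀ hR hs l k)
          (Psi_antitone h hs k j) (Psi_pos hf0 k j).le (Q21_nonneg hR l k)
      have h7 : (M.Psi s * M.Q21 s * M.Psi s) i j ≤ (M.Psi s * M.Q21 s) i i * M.Psi s i j +
          ∑ k ∈ Finset.univ.erase i, (M.Q11 s + M.Psi s * M.Q21 s) i k * M.Psi s k j := by
        rw [Matrix.mul_apply, ← Finset.add_sum_erase _ _ (Finset.mem_univ i)]
        refine add_le_add_right (Finset.sum_le_sum fun k hk =>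
          mul_le_mul_of_nonneg_right ?_ (Psi_pos h k j).le) _
        exact le_add_of_nonneg_left (metzler_Q11 hR i k (Finset.ne_of_mem_erase hk).symm)
      have h8 := hdiag s hs h i j
      have h9 := hedge2 i l j hlj s hs h
      have h10 := Finset.sum_nonneg h4
      rw [Matrix.add_apply, mul_add]
      linarith
  obtain ⟨l₀, k₀, hlk⟩ : ∃ l k, 0 < M.Q21 0 l k := by
    by_contra! hneg
    exact Q21_ne_zero h₀ (by ext l k; exact le_antisymm (hneg l k) (Q21_nonneg h₀ l k))
  have hbase : ∃ C, ∀ s ≤ 0, M.PsiFinite s → M.Psi s k₀ l₀ ≤ C := by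
    obtain ⟨j⟩ := exists_S2 (M := M)
    refine ⟨c₀ k₀ j / M.Q21 0 l₀ k₀, fun s hs h => ?_⟩
    rw [le_div_iff₀ hlk]
    refine le_trans ?_ (hdiagPQ k₀ j s hs h)
    rw [Matrix.mul_apply]
    calc M.Psi s k₀ l₀ * M.Q21 0 l₀ k₀ ≤ M.Psi s k₀ l₀ * M.Q21 s l₀ k₀ :=
          mul_le_mul_of_nonneg_left (Q21_zero_le h₀ (minPrinciple_R h) hs _ _) (Psi_pos h _ _).le
      _ ≤ _ := Finset.single_le_sum (f := fun l => M.Psi s k₀ l * M.Q21 s l k₀) (fun l _ =>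
          mul_nonneg (Psi_pos h _ _).le (Q21_nonneg (minPrinciple_R h) _ _)) (Finset.mem_univ l₀)
  -- the bound spreads along column `l₀` by the edges of `K(0)`, then along the rows by those of `D(0)`
  have hrow : ∃ C, ∀ s ≤ 0, M.PsiFinite s → M.Psi s i l₀ ≤ C := by
    induction irred_K h₀ (Psi_pos hf0) k₀ i with
    | refl => exact hbase
    | @tail a b _ hab ih =>
      by_cases hne : a = b
      · exact hne ▸ ih
      · obtain ⟨C, hC⟩ := ih
        refine ⟨|c₀ a l₀| * C / (M.Q11 0 + M.Psi 0 * M.Q21 0) a b, fun s hs h => ?_⟩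
        rw [le_div_iff₀ hab, mul_comm]
        refine (hedgeK a b l₀ hne s hs h).trans ((mul_le_mul_of_nonneg_right (le_abs_self _)
          (Psi_pos h _ _).le).trans (mul_le_mul_of_nonneg_left (hC s hs h) (abs_nonneg _)))
  induction (irred_D h₀ (Psi_pos hf0)).transpose l₀ j with
  | refl => exact hrow
  | @tail a b _ hab ih =>
    by_cases hne : a = b
    · exact hne ▸ ih
    · obtain ⟨C, hC⟩ := ih
      rw [transpose_apply] at hab
      refine ⟨|c₀ i a + c₀ i a| * C / (M.Q22 0 + M.Q21 0 * M.Psi 0) b a, fun s hs h => ?_⟩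
      rw [le_div_iff₀ hab]
      refine (hedgeD i b a (Ne.symm hne) s hs h).trans ((mul_le_mul_of_nonneg_right (le_abs_self _)
        (Psi_pos h _ _).le).trans (mul_le_mul_of_nonneg_left (hC s hs h) (abs_nonneg _)))

/-- The interval of finiteness has a least element, by Fatou's lemma and the bound on `Ψ`. -/
lemma exists_psiFinite_iff : ∃ s₀ ≤ 0, ∀ s, M.PsiFinite s ↔ s₀ ≤ s := by
  set S := {s | M.PsiFinite s} ∩ Set.Iic 0 with hS
  have hne : S.Nonempty := ⟨0, psiFinite_zero, Set.mem_Iic.2 le_rfl⟩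
  have hbdd : BddBelow S := bddBelow_psiFinite.mono Set.inter_subset_left
  have hle : sInf S ≤ 0 := csInf_le hbdd ⟨psiFinite_zero, Set.mem_Iic.2 le_rfl⟩
  have hfin : M.PsiFinite (sInf S) := by
    intro i j
    obtain ⟨u, -, hu, huS⟩ := exists_seq_tendsto_sInf hne hbdd
    obtain ⟨C, hC⟩ := Psi_bounded i j
    obtain ⟨ν, hν, hlst⟩ := exists_measure_psiLST i j
    have h1 : ∀ k, ∫⁻ x, ENNReal.ofReal (Real.exp (-u k * x)) ∂ν ≤ ENNReal.ofReal C := fun k => by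
      rw [← hlst, ← ENNReal.ofReal_toReal ((huS k).1 i j).ne]
      exact ENNReal.ofReal_le_ofReal (hC _ (huS k).2 (huS k).1)
    have h2 := lintegral_liminf_le (μ := ν) (u := atTop)
      (f := fun k x => ENNReal.ofReal (Real.exp (-u k * x))) (fun k => by fun_prop)
    have h3 : ∀ x, liminf (fun k => ENNReal.ofReal (Real.exp (-u k * x))) atTop =
        ENNReal.ofReal (Real.exp (-sInf S * x)) := fun x =>
      (ENNReal.tendsto_ofReal ((Real.continuous_exp.tendsto _).comp
        (hu.neg.mul_const x))).liminf_eq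
    simp only [h3] at h2
    rw [hlst]
    refine (h2.trans (c := ENNReal.ofReal C) ?_).trans_lt ENNReal.ofReal_lt_top
    exact (liminf_le_liminf (.of_forall h1)).trans (liminf_const _).le
  refine ⟨sInf S, hle, fun s => ⟨fun h => ?_, fun h => hfin.mono h⟩⟩
  rcases le_total s 0 with hs | hs
  · exact csInf_le hbdd ⟨h, hs⟩
  · exact hle.trans hs

lemma singularSet_eq : M.singularSet = {M.sStar} := by
  obtain ⟨s₀, h0, h⟩ := exists_psiFinite_iff (M := M)
  have h1 : M.singularSet = {s₀} := by
    ext s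
    simp only [singularSet, h, Set.mem_ofPred_eq, Set.mem_singleton_iff, not_le]
    constructor
    · rintro ⟨-, h2, h3⟩
      by_contra hne
      have hlt : s₀ < s := lt_of_le_of_ne h2 (Ne.symm hne)
      exact lt_irrefl _ (h3 s₀ hlt)
    · rintro rfl
      exact ⟨h0, le_rfl, fun z hz => hz⟩
  rw [sStar, h1, csSup_singleton]

lemma sStar_mem : M.sStar ∈ M.singularSet := by rw [singularSet_eq]; rfl

lemma psiFinite_of_sStar_le {s : ℝ} (hs : M.sStar ≤ s) : M.PsiFinite s :=
  PsiFinite.mono sStar_mem.2.1 hs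

/-! ### The derivative of `Ψ` -/

section Derivative

variable {s : ℝ}

/-- The derivative is that of a moment generating function, at an interior point of its domain. -/
lemma hasDerivAt_Psi (hs : M.sStar < s) (i : M.S1) (j : M.S2) :
    ∃ m ≤ 0, HasDerivAt (fun u => M.Psi u i j) m s := by
  obtain ⟨ν, hν, h⟩ := exists_measure_psiLST i j
  have hae := ae_nonneg_of_Iio hν
  have hmeas : ∀ u : ℝ, AEStronglyMeasurable (fun x => Real.exp (u * x)) ν := fun u => by fun_prop
  have heq : ∀ u, M.Psi u i j = mgf (fun x => -x) ν u := fun u => by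
    rw [Psi, of_apply, h, mgf, integral_eq_lintegral_of_nonneg_ae
      (.of_forall fun x => (Real.exp_pos _).le) (by fun_prop)]
    simp only [mul_neg, neg_mul]
  have hsub : Set.Ici M.sStar ⊆ integrableExpSet (fun x => -x) ν := fun u hu => by
    have hfin := psiFinite_of_sStar_le hu i j
    rw [h] at hfin
    refine ⟨by fun_prop, ?_⟩
    rw [hasFiniteIntegral_iff_ofReal (.of_forall fun x => (Real.exp_pos _).le)]
    simpa only [mul_neg, neg_mul] using hfin
  have hmem : s ∈ interior (integrableExpSet (fun x => -x) ν) :=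
    interior_mono hsub (by rw [interior_Ici]; exact hs)
  refine ⟨_, ?_, (hasDerivAt_mgf hmem).congr_of_eventuallyEq (.of_forall heq)⟩
  exact integral_nonpos_of_ae (hae.mono fun x hx =>
    mul_nonpos_of_nonpos_of_nonneg (neg_nonpos.2 hx) (Real.exp_pos _).le)

lemma differentiableAt_Psi (hs : M.sStar < s) (i : M.S1) (j : M.S2) :
    DifferentiableAt ℝ (fun u => M.Psi u i j) s :=
  let ⟨_, _, h⟩ := hasDerivAt_Psi hs i j
  h.differentiableAt

lemma Phi_nonpos (hs : M.sStar < s) (i : M.S1) (j : M.S2) : M.Phi s i j ≤ 0 := by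
  obtain ⟨m, hm, h⟩ := hasDerivAt_Psi hs i j
  rw [Phi, of_apply, h.deriv]
  exact hm

lemma tendsto_Psi (hs : M.sStar ≤ s) : Tendsto M.Psi (𝓝[>] s) (𝓝 (M.Psi s)) := by
  rw [tendsto_matrix_iff]
  intro i j
  obtain ⟨ν, hν, h⟩ := exists_measure_psiLST i j
  have hae := ae_nonneg_of_Iio hν
  have hfin := (psiFinite_of_sStar_le hs i j).ne
  refine (ENNReal.tendsto_toReal hfin).comp ?_
  rw [h] at hfin ⊢
  simp only [h]
  refine tendsto_lintegral_filter_of_dominated_convergence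
    (fun x => ENNReal.ofReal (Real.exp (-s * x))) (.of_forall fun u => by fun_prop) ?_ hfin
    (.of_forall fun x => ?_)
  · filter_upwards [self_mem_nhdsWithin] with u hu
    have hu : s < u := hu
    filter_upwards [hae] with x hx
    refine ENNReal.ofReal_le_ofReal (Real.exp_le_exp.2 ?_)
    nlinarith
  · refine ENNReal.tendsto_ofReal ?_
    exact ((by fun_prop : Continuous fun u => Real.exp (-u * x)).tendsto s).mono_left
      nhdsWithin_le_nhds

/-- The derivative of the Riccati equation. -/
lemma sylvester_Phi (hs : M.sStar < s) : M.K s * M.Phi s + M.Phi s * M.D s = M.U s := by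
  have hR := minPrinciple_R (psiFinite_of_sStar_le hs.le)
  refine sylvester_of_slope (tendsto_slope_Q11 hR) (tendsto_slope_Q12 hR) (tendsto_slope_Q21 hR)
    (tendsto_slope_Q22 hR) (fun u hu => riccati_Psi (psiFinite_of_sStar_le (hs.le.trans hu)))
    (tendsto_Psi hs.le) ?_
  rw [tendsto_matrix_iff]
  intro i j
  have := ((differentiableAt_Psi hs i j).hasDerivAt.tendsto_slope).mono_left
    (nhdsWithin_mono _ fun u (hu : s < u) => hu.ne')
  exact this

lemma U_pos (hs : M.sStar ≤ s) (i : M.S1) (j : M.S2) : 0 < M.U s i j := by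
  have hf := psiFinite_of_sStar_le hs
  have hR := minPrinciple_R hf
  have hΨ : ∀ i j, 0 ≤ M.Psi s i j := fun i j => (Psi_pos hf i j).le
  have hC1 : ∀ i j, 0 ≤ M.C1⁻¹ i j := fun i j => by
    rw [C1_inv, diagonal_apply]
    split_ifs
    exacts [inv_nonneg.2 i.2.le, le_rfl]
  have hC2 : ∀ i j, 0 ≤ M.C2⁻¹ i j := fun i j => by
    rw [C2_inv, diagonal_apply]
    split_ifs
    exacts [inv_nonneg.2 (abs_nonneg _), le_rfl]
  have hA12 : ∀ i j, 0 ≤ M.A12 s i j := by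
    rw [A12, sq]
    exact mul_entry_nonneg hC1 (sandwich_mul_nonneg hR hR T10_nonneg T02_nonneg)
  have hA21 : ∀ i j, 0 ≤ M.A21 s i j := by
    rw [A21, sq]
    exact mul_entry_nonneg hC2 (sandwich_mul_nonneg hR hR T20_nonneg T01_nonneg)
  have hone : ∀ {ι : Type} [DecidableEq ι] (i j : ι), 0 ≤ (1 : Matrix ι ι ℝ) i j := fun i j => by
    rw [Matrix.one_apply]
    split_ifs
    exacts [zero_le_one, le_rfl]
  have hA22 : ∀ i j, 0 ≤ M.A22 s i j := by
    rw [A22, sq]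
    exact mul_entry_nonneg hC2 fun i j => add_nonneg (a := (1 : Matrix M.S2 M.S2 ℝ) i j) (hone i j)
      (sandwich_mul_nonneg hR hR T20_nonneg T02_nonneg i j)
  have hE : ∀ i j, 0 ≤ (M.C1⁻¹ * (M.T10 * ((M.R s)⁻¹ * (M.R s)⁻¹) * M.T01) * M.Psi s) i j :=
    mul_entry_nonneg (mul_entry_nonneg hC1 (sandwich_mul_nonneg hR hR T10_nonneg T01_nonneg)) hΨ
  have hA11 : 0 < (M.A11 s * M.Psi s) i j := by
    rw [A11, sq, Matrix.mul_add, Matrix.mul_one, Matrix.add_mul, Matrix.add_apply]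
    refine add_pos_of_pos_of_nonneg ?_ (hE i j)
    rw [C1_inv, diagonal_mul]
    exact mul_pos (inv_pos.2 i.2) (Psi_pos hf i j)
  rw [U, Matrix.add_apply, Matrix.add_apply, Matrix.add_apply]
  have h1 := hA12 i j
  have h2 := mul_entry_nonneg hΨ hA22 i j
  have h3 := mul_entry_nonneg (mul_entry_nonneg hΨ hA21) hΨ i j
  linarith

lemma tendsto_U (hs : M.sStar ≤ s) : Tendsto M.U (𝓝[>] s) (𝓝 (M.U s)) := by
  have hR := minPrinciple_R (psiFinite_of_sStar_le hs)
  have hΨ := tendsto_Psi hs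
  have hle : 𝓝[>] s ≤ 𝓝 s := nhdsWithin_le_nhds
  exact (((tendsto_A12 hR).mono_left hle).add
    (tendsto_matrix_mul ((tendsto_A11 hR).mono_left hle) hΨ)).add
    (tendsto_matrix_mul hΨ ((tendsto_A22 hR).mono_left hle)) |>.add
    (tendsto_matrix_mul (tendsto_matrix_mul hΨ ((tendsto_A21 hR).mono_left hle)) hΨ)

lemma tendsto_K (hs : M.sStar ≤ s) : Tendsto M.K (𝓝[>] s) (𝓝 (M.K s)) := by
  have hR := minPrinciple_R (psiFinite_of_sStar_le hs)
  exact ((tendsto_Q11 hR).mono_left nhdsWithin_le_nhds).add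
    (tendsto_matrix_mul (tendsto_Psi hs) ((tendsto_Q21 hR).mono_left nhdsWithin_le_nhds))

lemma tendsto_D (hs : M.sStar ≤ s) : Tendsto M.D (𝓝[>] s) (𝓝 (M.D s)) := by
  have hR := minPrinciple_R (psiFinite_of_sStar_le hs)
  exact ((tendsto_Q22 hR).mono_left nhdsWithin_le_nhds).add
    (tendsto_matrix_mul ((tendsto_Q21 hR).mono_left nhdsWithin_le_nhds) (tendsto_Psi hs))

end Derivative

/-! ### Supersolutions -/

lemma lintegral_Ioc_exp_neg_mul {κ τ : ℝ} (hκ : 0 < κ) (hτ : 0 ≤ τ) :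
    ∫⁻ t in Set.Ioc 0 τ, ENNReal.ofReal (κ * Real.exp (-(κ * t))) =
      ENNReal.ofReal (1 - Real.exp (-(κ * τ))) := by
  have hint : IntervalIntegrable (fun t => κ * Real.exp (-(κ * t))) volume 0 τ :=
    (by fun_prop : Continuous fun t => κ * Real.exp (-(κ * t))).intervalIntegrable _ _
  rw [← ofReal_integral_eq_lintegral_ofReal ((intervalIntegrable_iff_integrableOn_Ioc_of_le hτ).1
    hint) (.of_forall fun t => (mul_pos hκ (Real.exp_pos _)).le), ←
    intervalIntegral.integral_of_le hτ]
  congr 1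
  have hderiv : ∀ t ∈ Set.uIcc 0 τ, HasDerivAt (fun t => -Real.exp (-(κ * t)))
      (κ * Real.exp (-(κ * t))) t := fun t _ => by
    have := ((hasDerivAt_id t).const_mul κ).neg.exp.neg
    refine this.congr_deriv ?_
    simp [mul_comm]
  rw [intervalIntegral.integral_eq_sub_of_hasDerivAt hderiv hint]
  simp
  ring

/-- If `T f ≤ (s - η c) f` with `f > 0`, then `f a * exp (η y)` is a supersolution of the first-jump
equations, and bounds the passage weights. -/
lemma psiFinite_of_exp_supersolution {s η : ℝ} {f : Fin n → ℝ} (hf : ∀ a, 0 < f a)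
    (hT : ∀ a, (M.T *ᵥ f) a ≤ (s - η * M.c a) * f a) : M.PsiFinite s := by
  have key : ∀ (a : Fin n) (y : ℝ), 0 ≤ y → ∑ j, M.passage s j 0 a y * ENNReal.ofReal (f j) +
      M.jumpStep s (fun a y => ENNReal.ofReal (f a * Real.exp (η * y))) a y ≤
      ENNReal.ofReal (f a * Real.exp (η * y)) := by
    intro a y hy
    -- the hypothesis says that the total inflow `G` is at most `κ f a`
    set κ := M.rate a + s - η * M.c a with hκ
    set G := ∑ b ∈ Finset.univ.erase a, M.T a b * f b with hG
    have hTnn : ∀ b ∈ Finset.univ.erase a, 0 ≤ M.T a b := fun b hb =>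
      M.offDiag_nonneg _ _ (Finset.ne_of_mem_erase hb).symm
    have hGle : G ≤ κ * f a := by
      rw [hG, sum_erase_eq, hκ]
      linarith [hT a]
    have hGpos : 0 < G := by
      obtain ⟨b, hab⟩ := M.exists_T_pos a
      exact Finset.sum_pos' (fun b hb => mul_nonneg (hTnn b hb) (hf b).le)
        ⟨b, Finset.mem_erase.2 ⟨(ne_of_T_pos hab).symm, Finset.mem_univ _⟩, mul_pos hab (hf b)⟩
    have hκpos : 0 < κ := pos_of_mul_pos_left (hGpos.trans_le hGle) (hf a).le
    have hstep : M.jumpStep s (fun a y => ENNReal.ofReal (f a * Real.exp (η * y))) a y ≤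
        ENNReal.ofReal (f a * Real.exp (η * y)) *
          ∫⁻ t in M.durations a y, ENNReal.ofReal (κ * Real.exp (-(κ * t))) := by
      rw [jumpStep, ← lintegral_const_mul' _ _ ENNReal.ofReal_ne_top]
      refine lintegral_mono fun t => ?_
      have h1 : ∑ b ∈ Finset.univ.erase a, ENNReal.ofReal (M.T a b) *
          ENNReal.ofReal (f b * Real.exp (η * (y + M.c a * t))) =
          ENNReal.ofReal (G * Real.exp (η * (y + M.c a * t))) := by
        rw [hG, Finset.sum_mul, ENNReal.ofReal_sum_of_nonneg fun b hb => mul_nonneg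
          (mul_nonneg (hTnn b hb) (hf b).le) (Real.exp_pos _).le]
        refine Finset.sum_congr rfl fun b hb => ?_
        rw [← ENNReal.ofReal_mul (hTnn b hb), mul_assoc]
      simp only [h1]
      rw [← ENNReal.ofReal_mul (Real.exp_pos _).le, ← ENNReal.ofReal_mul
        (mul_pos (hf a) (Real.exp_pos _)).le]
      refine ENNReal.ofReal_le_ofReal ?_
      calc Real.exp (-((M.rate a + s) * t)) * (G * Real.exp (η * (y + M.c a * t)))
          ≤ Real.exp (-((M.rate a + s) * t)) * (κ * f a * Real.exp (η * (y + M.c a * t))) := by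
            gcongr
        _ = κ * f a * Real.exp (-((M.rate a + s) * t) + η * (y + M.c a * t)) := by
            rw [Real.exp_add]; ring
        _ = κ * f a * Real.exp (η * y + -(κ * t)) := by rw [hκ]; ring_nf
        _ = _ := by rw [Real.exp_add]; ring
    rcases le_or_gt 0 (M.c a) with hc | hc
    · have h0 : ∑ j, M.passage s j 0 a y * ENNReal.ofReal (f j) = 0 :=
        Finset.sum_eq_zero fun j _ => by rw [passage_zero_of_nonneg hc, zero_mul]
      rw [h0, zero_add]
      refine hstep.trans_eq ?_
      rw [durations_of_nonneg hc hy]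
      simp only [ENNReal.ofReal_mul hκpos.le]
      rw [lintegral_const_mul' _ _ ENNReal.ofReal_ne_top, lintegral_exp_neg_mul hκpos,
        ← ENNReal.ofReal_mul hκpos.le]
      rw [mul_inv_cancel₀ hκpos.ne', ENNReal.ofReal_one, mul_one]
    · have h0 : ∑ j, M.passage s j 0 a y * ENNReal.ofReal (f j) =
          ENNReal.ofReal (Real.exp (-((M.rate a + s) * (y / |M.c a|))) * f a) := by
        rw [Finset.sum_eq_single a (fun j _ hj => by rw [passage_zero_of_ne (Ne.symm hj), zero_mul])
          (fun h => absurd (Finset.mem_univ a) h), passage_zero_of_neg hc,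
          ENNReal.ofReal_mul (Real.exp_pos _).le]
      have hac : 0 < |M.c a| := abs_pos.2 hc.ne
      have hτ : 0 ≤ y / |M.c a| := div_nonneg hy hac.le
      rw [h0]
      refine (add_le_add_right hstep _).trans_eq ?_
      rw [durations_of_neg hc, lintegral_Ioc_exp_neg_mul hκpos hτ,
        ← ENNReal.ofReal_mul (mul_pos (hf a) (Real.exp_pos _)).le, ← ENNReal.ofReal_add
        (mul_pos (Real.exp_pos _) (hf a)).le (mul_nonneg (mul_pos (hf a) (Real.exp_pos _)).le
          (sub_nonneg.2 (Real.exp_le_one_iff.2 (neg_nonpos.2 (mul_nonneg hκpos.le hτ)))))]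
      congr 1
      have h1 : -((M.rate a + s) * (y / |M.c a|)) = η * y + -(κ * (y / |M.c a|)) := by
        have h2 : M.c a = -|M.c a| := by rw [abs_of_neg hc, neg_neg]
        rw [hκ, show η * M.c a = -(η * |M.c a|) by rw [h2, abs_neg, abs_abs]; ring]
        field_simp
        ring
      rw [h1, Real.exp_add]
      ring
  intro i j
  rw [psiLST_eq_passageLST]
  have h1 := sum_passageLST_le key i.1 le_rfl
  have h2 : M.passageLST s i j 0 * ENNReal.ofReal (f j) < ∞ :=
    ((Finset.single_le_sum (f := fun j => M.passageLST s i j 0 * ENNReal.ofReal (f j))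
      (fun _ _ => zero_le) (Finset.mem_univ j.1)).trans h1).trans_lt ENNReal.ofReal_lt_top
  exact (ENNReal.lt_top_of_mul_ne_top_left h2.ne (ENNReal.ofReal_pos.2 (hf j)).ne')

/-- A positive supersolution `X` of the Riccati equation at `s` makes `Ψ(s)` finite: with the
Perron–Frobenius eigenvector `u` of `Q₂₂ + Q₂₁ X`, the vector `(X u, u)`, extended to the phases with
rate `0`, gives an exponential supersolution of the first-jump equations. -/
theorem psiFinite_of_riccati_nonpos {s : ℝ} (hR : MinPrinciple (M.R s)) {X : Matrix M.S1 M.S2 ℝ}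
    (hX : ∀ i j, 0 < X i j)
    (hric : ∀ i j, riccati (M.Q11 s) (M.Q12 s) (M.Q21 s) (M.Q22 s) X i j ≤ 0) :
    M.PsiFinite s := by
  have := exists_S2 (M := M)
  have := exists_S1 (M := M)
  obtain ⟨η, u, hu, hDu⟩ := (metzler_D hR hX).exists_pos_eigenvector (irred_D hR hX)
  have hXu : ∀ i, 0 < (X *ᵥ u) i := mulVec_pos_of_pos hX (fun j => (hu j).le) fun h => by
    obtain ⟨j⟩ := exists_S2 (M := M)
    exact (hu j).ne' (congrFun h j)
  have hS2 : M.Q21 s *ᵥ (X *ᵥ u) + M.Q22 s *ᵥ u = η • u := by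
    rw [← hDu, add_mulVec, mulVec_mulVec, add_comm]
  have hS1 : ∀ i, (M.Q11 s *ᵥ (X *ᵥ u) + M.Q12 s *ᵥ u) i ≤ -η * (X *ᵥ u) i := by
    intro i
    have h1 : riccati (M.Q11 s) (M.Q12 s) (M.Q21 s) (M.Q22 s) X *ᵥ u =
        M.Q11 s *ᵥ (X *ᵥ u) + M.Q12 s *ᵥ u + η • (X *ᵥ u) := by
      rw [← mulVec_smul, ← hS2, riccati]
      simp only [add_mulVec, mulVec_add, mulVec_mulVec, Matrix.mul_assoc]
      abel
    have h2 : (riccati (M.Q11 s) (M.Q12 s) (M.Q21 s) (M.Q22 s) X *ᵥ u) i ≤ 0 := by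
      rw [mulVec, dotProduct]
      exact Finset.sum_nonpos fun j _ => mul_nonpos_of_nonpos_of_nonneg (hric i j) (hu j).le
    rw [h1, Pi.add_apply, Pi.smul_apply, smul_eq_mul] at h2
    linarith
  refine psiFinite_of_exp_supersolution (η := η) (f := M.extend s (X *ᵥ u) u)
    (extend_pos hR hXu hu) fun a => ?_
  rcases lt_trichotomy (M.c a) 0 with hc | hc | hc
  · rw [T_mulVec_extend_S2 ⟨a, hc⟩, hS2, extend_S2 ⟨a, hc⟩, Pi.smul_apply, smul_eq_mul]
    simp only [abs_of_neg hc]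
    exact (by ring : _ = _).le
  · rw [T_mulVec_extend_S0 (isUnit_and_inv_nonpos hR).1 ⟨a, hc⟩]
    simp only [hc, mul_zero, sub_zero, le_refl]
  · rw [T_mulVec_extend_S1 ⟨a, hc⟩, extend_S1 ⟨a, hc⟩]
    have := mul_le_mul_of_nonneg_left (hS1 ⟨a, hc⟩) hc.le
    simp only at this ⊢
    linarith

/-! ### Criticality at `s*` -/

/-- The growth rate of `H ↦ K H + H D` at `s*` is not positive: otherwise it would be positive at
nearby `s > s*`, against `K Φ + Φ D = U > 0 ≥ Φ`. -/
lemma growth_nonpos {a : M.S1 → ℝ} {d : M.S2 → ℝ} {κ η : ℝ} (ha0 : ∀ i, 0 < a i)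
    (hd0 : ∀ j, 0 < d j) (ha : a ᵥ* M.K M.sStar = κ • a) (hd : M.D M.sStar *ᵥ d = η • d) :
    κ + η ≤ 0 := by
  have := exists_S1 (M := M)
  have := exists_S2 (M := M)
  by_contra! hpos
  set δ := (κ + η) / 2 with hδ
  have hKt := tendsto_matrix_iff.1 (tendsto_K (M := M) le_rfl)
  have hDt := tendsto_matrix_iff.1 (tendsto_D (M := M) le_rfl)
  have h1 : ∀ k, ∀ᶠ s in 𝓝[>] M.sStar, (κ - δ) * a k < (a ᵥ* M.K s) k := fun k => by
    have ht : Tendsto (fun s => (a ᵥ* M.K s) k) (𝓝[>] M.sStar) (𝓝 ((a ᵥ* M.K M.sStar) k)) := by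
        simp only [vecMul, dotProduct]
        exact tendsto_finsetSum _ fun i _ => (hKt i k).const_mul _
    refine ht.eventually_const_lt ?_
    rw [ha, Pi.smul_apply, smul_eq_mul]
    exact mul_lt_mul_of_pos_right (by linarith) (ha0 k)
  have h2 : ∀ j, ∀ᶠ s in 𝓝[>] M.sStar, (η - δ) * d j < (M.D s *ᵥ d) j := fun j => by
    have ht : Tendsto (fun s => (M.D s *ᵥ d) j) (𝓝[>] M.sStar) (𝓝 ((M.D M.sStar *ᵥ d) j)) := by
        simp only [mulVec, dotProduct]
        exact tendsto_finsetSum _ fun l _ => (hDt j l).mul_const _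
    refine ht.eventually_const_lt ?_
    rw [hd, Pi.smul_apply, smul_eq_mul]
    exact mul_lt_mul_of_pos_right (by linarith) (hd0 j)
  obtain ⟨s, ⟨hs1, hs2⟩, hs⟩ :=
    (((eventually_all.2 h1).and (eventually_all.2 h2)).and self_mem_nhdsWithin).exists
  have hs : M.sStar < s := hs
  have h3 := pairing_sylvester_ge ha0 hd0 (fun k => (hs1 k).le) (fun j => (hs2 j).le)
    (H := -M.Phi s) (fun i j => neg_nonneg.2 (Phi_nonpos hs i j))
  rw [Matrix.mul_neg, Matrix.neg_mul, ← neg_add, sylvester_Phi hs, map_neg (pairing a d) (M.U s),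
    show κ - δ + (η - δ) = 0 by rw [hδ]; ring, zero_mul] at h3
  have h4 := pairing_pos ha0 hd0 (U_pos hs.le)
  linarith

/-- The growth rate of `H ↦ K H + H D` at `s*` is not negative: otherwise a small multiple of its
positive eigenvector, added to `Ψ(s*)`, would be a strict supersolution of the Riccati equation, and
remain a supersolution at some `s < s*`. -/
lemma growth_nonneg {a : M.S1 → ℝ} {d : M.S2 → ℝ} {κ η : ℝ} (ha0 : ∀ i, 0 < a i)
    (hd0 : ∀ j, 0 < d j) (ha : M.K M.sStar *ᵥ a = κ • a) (hd : d ᵥ* M.D M.sStar = η • d) :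
    0 ≤ κ + η := by
  by_contra! hneg
  have hf := psiFinite_of_sStar_le (M := M) le_rfl
  have hR := minPrinciple_R hf
  set V := vecMulVec a d with hV
  have hVpos : ∀ i j, 0 < V i j := fun i j => mul_pos (ha0 i) (hd0 j)
  set N := V * M.Q21 M.sStar * V with hN
  have hexp : ∀ ε : ℝ, riccati (M.Q11 M.sStar) (M.Q12 M.sStar) (M.Q21 M.sStar) (M.Q22 M.sStar)
      (M.Psi M.sStar + ε • V) = ε • ((κ + η) • V + ε • N) := fun ε => by
    have h1 := sylvester_vecMulVec ha hd
    rw [← hV] at h1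
    have h2 := riccati_Psi hf
    rw [← h1, hN]
    rw [riccati] at h2 ⊢
    have h3 : ε • (M.K M.sStar * V + V * M.D M.sStar + ε • (V * M.Q21 M.sStar * V)) =
        ε • (M.K M.sStar * V + V * M.D M.sStar + ε • (V * M.Q21 M.sStar * V)) + 0 := (add_zero _).symm
    rw [h3, ← h2, K, D]
    simp only [Matrix.mul_add, Matrix.add_mul, Matrix.mul_smul, Matrix.smul_mul, smul_add,
      Matrix.mul_assoc]
    abel
  have h1 : ∀ i j, ∀ᶠ ε in 𝓝[>] (0 : ℝ), ((κ + η) • V + ε • N) i j < 0 := fun i j => by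
    have ht : Tendsto (fun ε : ℝ => (κ + η) * V i j + ε * N i j) (𝓝[>] 0)
        (𝓝 ((κ + η) * V i j + 0 * N i j)) :=
      ((by fun_prop : Continuous fun ε : ℝ => (κ + η) * V i j + ε * N i j).tendsto 0).mono_left
        nhdsWithin_le_nhds
    refine ht.eventually_lt_const ?_
    rw [zero_mul, add_zero]
    exact mul_neg_of_neg_of_pos hneg (hVpos i j)
  obtain ⟨ε, hε, hε0⟩ :=
    ((eventually_all.2 fun i => eventually_all.2 (h1 i)).and self_mem_nhdsWithin).exists
  have hε0 : 0 < ε := hε0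
  set X := M.Psi M.sStar + ε • V with hX
  have hXpos : ∀ i j, 0 < X i j := fun i j =>
    add_pos (Psi_pos hf i j) (mul_pos hε0 (hVpos i j))
  have hric : ∀ i j, ∀ᶠ s in 𝓝[<] M.sStar,
      riccati (M.Q11 s) (M.Q12 s) (M.Q21 s) (M.Q22 s) X i j < 0 := fun i j => by
    have hle : 𝓝[<] M.sStar ≤ 𝓝 M.sStar := nhdsWithin_le_nhds
    have ht : Tendsto (fun s => riccati (M.Q11 s) (M.Q12 s) (M.Q21 s) (M.Q22 s) X) (𝓝[<] M.sStar)
        (𝓝 (riccati (M.Q11 M.sStar) (M.Q12 M.sStar) (M.Q21 M.sStar) (M.Q22 M.sStar) X)) :=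
      ((((tendsto_Q12 hR).add (tendsto_matrix_mul (tendsto_Q11 hR) tendsto_const_nhds)).add
        (tendsto_matrix_mul tendsto_const_nhds (tendsto_Q22 hR))).add
        (tendsto_matrix_mul (tendsto_matrix_mul tendsto_const_nhds (tendsto_Q21 hR))
          tendsto_const_nhds)).mono_left hle
    refine (tendsto_matrix_iff.1 ht i j).eventually_lt_const ?_
    rw [hexp, Matrix.smul_apply, smul_eq_mul]
    exact mul_neg_of_pos_of_neg hε0 (hε i j)
  obtain ⟨s, ⟨hs1, hs2⟩, hs⟩ := (((eventually_all.2 fun i => eventually_all.2 (hric i)).and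
    (nhdsWithin_le_nhds (eventually_minPrinciple_R hR))).and self_mem_nhdsWithin).exists
  exact sStar_mem.2.2 s hs (psiFinite_of_riccati_nonpos hs2 hXpos fun i j => (hs1 i j).le)

/-- The square-root expansion of `Ψ` at `s*`, in matrix form. -/
theorem Psi_sqrt_expansion : ∃ B Y : Matrix M.S1 M.S2 ℝ, (∀ i j, 0 < B i j) ∧
    Tendsto (fun s => (√(s - M.sStar))⁻¹ • (M.Psi M.sStar - M.Psi s)) (𝓝[>] M.sStar) (𝓝 B) ∧
    Tendsto (fun s => M.K M.sStar * M.Phi s + M.Phi s * M.D M.sStar) (𝓝[>] M.sStar) (𝓝 Y) ∧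
    B * M.Q21 M.sStar * B = M.U M.sStar - Y ∧ M.K M.sStar * B + B * M.D M.sStar = 0 := by
  have := exists_S1 (M := M)
  have := exists_S2 (M := M)
  have hf := psiFinite_of_sStar_le (M := M) le_rfl
  have hR := minPrinciple_R hf
  have hK := metzler_K hR (Psi_pos hf)
  have hKI := irred_K hR (Psi_pos hf)
  have hD := metzler_D hR (Psi_pos hf)
  have hDI := irred_D hR (Psi_pos hf)
  obtain ⟨κ, a, a', ha0, ha'0, ha, ha'⟩ := Metzler.exists_pos_eigenvectors hK hKI
  obtain ⟨η, d', d, hd'0, hd0, hd', hd⟩ := Metzler.exists_pos_eigenvectors hD hDI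
  have hκη : κ + η = 0 := le_antisymm (growth_nonpos ha0 hd0 ha hd) (growth_nonneg ha'0 hd'0 ha' hd')
  obtain rfl : η = -κ := by linarith
  have hV0 : ∀ i j, 0 < vecMulVec a' d' i j := fun i j => mul_pos (ha'0 i) (hd'0 j)
  have hp := pairing_pos ha0 hd0 hV0
  set t := (pairing a d (vecMulVec a' d'))⁻¹ with ht
  have hV : M.K M.sStar * (t • vecMulVec a' d') + (t • vecMulVec a' d') * M.D M.sStar = 0 := by
    rw [Matrix.mul_smul, Matrix.smul_mul, ← smul_add, K, D, sylvester_vecMulVec ha' hd', hκη,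
      zero_smul, smul_zero]
  exact riccati_sqrt_expansion (tendsto_slope_Q11 hR) (tendsto_slope_Q12 hR) (tendsto_slope_Q21 hR)
    (tendsto_slope_Q22 hR) (fun s hs => riccati_Psi (psiFinite_of_sStar_le hs)) (tendsto_Psi le_rfl)
    (fun s hs => Psi_antitone hf hs.le) rfl (U_pos le_rfl) (tendsto_U le_rfl)
    (fun s hs => sylvester_Phi hs) (fun s hs => Phi_nonpos hs) rfl rfl hK hKI hD hDI
    (Q21_nonneg hR) (Q21_ne_zero hR) (V := t • vecMulVec a' d')
    (fun i j => mul_pos (inv_pos.2 hp) (hV0 i j)) hV ha0 hd0 ha hd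
    (by rw [map_smul, smul_eq_mul, ht, inv_mul_cancel₀ hp.ne'])

end FluidModel

end

theorem mainTheorem1 {n : ℕ} (M : FluidModel n) :
    IsGreatest M.singularSet M.sStar ∧
    (∀ s, M.sStar ≤ s → M.PsiFinite s ∧ IsUnit (M.T00 - s • (1 : Matrix M.S0 M.S0 ℝ))) ∧
    (∀ s, M.sStar < s → ∀ i j, DifferentiableAt ℝ (fun u => M.Psi u i j) s) ∧
    ∃ B Y : Matrix M.S1 M.S2 ℝ,
      (∀ i j, 0 < B i j) ∧
      (∀ i j, (fun s => M.Psi s i j - (M.Psi M.sStar i j - B i j * √(s - M.sStar)))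
        =o[𝓝[>] M.sStar] fun s => √(s - M.sStar)) ∧
      Tendsto (fun s => M.K M.sStar * M.Phi s + M.Phi s * M.D M.sStar) (𝓝[>] M.sStar) (𝓝 Y) ∧
      B * M.Q21 M.sStar * B = M.U M.sStar - Y ∧
      M.K M.sStar * B + B * M.D M.sStar = 0 := by
  refine ⟨?_, fun s hs => ⟨FluidModel.psiFinite_of_sStar_le hs, (isUnit_and_inv_nonpos
    (FluidModel.minPrinciple_R (FluidModel.psiFinite_of_sStar_le hs))).1⟩,
    fun s hs i j => FluidModel.differentiableAt_Psi hs i j, ?_⟩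
  · rw [FluidModel.singularSet_eq]
    exact isGreatest_singleton
  obtain ⟨B, Y, hB, hlim, hY, h1, h2⟩ := FluidModel.Psi_sqrt_expansion (M := M)
  refine ⟨B, Y, hB, fun i j => ?_, hY, h1, h2⟩
  have hev : ∀ᶠ s in 𝓝[>] M.sStar, 0 < √(s - M.sStar) := by
    filter_upwards [self_mem_nhdsWithin] with s hs
    exact Real.sqrt_pos.2 (sub_pos.2 hs)
  rw [Asymptotics.isLittleO_iff_tendsto' (hev.mono fun s hs h => absurd h hs.ne')]
  have h3 := (tendsto_matrix_iff.1 hlim i j).const_sub (B i j)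
  rw [sub_self] at h3
  refine h3.congr' (hev.mono fun s hs => ?_)
  rw [Matrix.smul_apply, Matrix.sub_apply, smul_eq_mul]
  field_simp
  ring
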